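/- **Setting.** Let $N\ge 1$ and let $\Delta\subset\mathbb R^N$ be a reflexive polytope: a lattice polytope with $0$ in its interior whose polar $\Delta^D=\{u:\langle u,m\rangle\ge -1\ \forall m\in\Delta\}$ is also a lattice polytope. Suppose $\Delta$ is nonsingular: every vertex lies on exactly $N$ edges, and the lattice points of these edges generate $\mathbb Z^N$ as an affine lattice. Let $A\subset\Delta\cap\mathbb Z^N$ with $0\in A$ and $\operatorname{conv}A=\Delta$. Let $T$ be a triangulation of $\Delta$ with vertices in $A$ that is central (every $N$-dimensional simplex has $0$ as a vertex). Let $\lambda:A\to\mathbb Z$ be such that the function $\psi_\lambda:\Delta\to\mathbb R$ that is affine on the simplices of $T$ and equals $\lambda$ at the vertices of $T$ satisfies $\psi_\lambda(tx+(1-t)y)\ge t\psi_\lambda(x)+(1-t)\psi_\lambda(y)$ for $x,y\in\Delta$, $0\le t\le1$, every convex set on which $\psi_\lambda$ is affine lies in a simplex of $T$, and $\psi_\lambda(\omega)\ge\lambda(\omega)$ for $\omega\in A$, with equality exactly at the vertices of $T$. Let $\partial T$ be the induced triangulation of $\partial\Delta$. For a simplex $\tau\in\partial T$ let $\Theta_\tau$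 be the smallest face of $\Delta$ containing $\tau$. **Cells.** For $\tau\in\partial T$ let $V^0_\tau$ be the union of the simplices of the second barycentric subdivision of $\partial T$ that have the center of $\tau$ as a vertex. Let $V_\tau\supset V^0_\tau$ be small open neighbourhoods in $\partial\Delta$: $V_\tau\cap V_{\tau'}\ne\emptyset$ only if $\tau\subset\tau'$ or $\tau'\subset\tau$, and $\overline V_\tau$ lies in the open star of $\tau$ (it misses every simplex of $\partial T$ that does not have $\tau$ as a face). Put $W_\tau=\overline V_\tau\setminus\bigcup_{\tau'\supsetneq\tau}V_{\tau'}$. **Coordinates.** For $t\in\mathbb C^*$ the weighted moment map $$\mu_t(x)=\frac{\sum_{\omega\in A}|t^{\lambda(\omega)}||x^\omega|\,\omega}{\sum_{\omega\in A}|t^{\lambda(\omega)}||x^\omega|}$$ identifies $(\mathbb R_{>0})^N$ with $\operatorname{int}\Delta$. So each $|x^v|$, $v\in\mathbb Z^N$, is a function on $\operatorname{int}\Delta$; it is extended by continuity to the boundary points where this is possible. For $\tau\in\partial T$ with $k=\dim\tau$, $l=\dim\Theta_\tau$, *$\tau$-associated coordinates* are $y_i=x^{\omega_i-\Omega}$,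 $1\le i\le N$, where $\Omega$ is a vertex of $\tau$, $\{\Omega,\omega_1,\dots,\omega_N\}$ is an affine basis of $\mathbb Z^N$, $\{\Omega,\omega_1,\dots,\omega_k\}$ and $\{\Omega,\omega_1,\dots,\omega_l\}$ are affine bases of the lattices $\mathbb Z^N\cap\operatorname{aff}\tau$ and $\mathbb Z^N\cap\operatorname{aff}\Theta_\tau$, $0-\Omega=\sum_{i>l}(\omega_i-\Omega)$, and for $i>l$ one has $\langle u,\omega_i-\Omega\rangle\ge0$ for every $u\in\Delta^D$ with $\langle u,\cdot\rangle=-1$ on $\Theta_\tau$. Write $m_i=|y_i|(m)$; these are used at points $m\in\Delta$ such that every face of $\Delta$ containing $m$ contains $\Theta_\tau$. **Intervals.** Let $r>0$ be such that the closed ball of radius $r$ around $0$ lies in $\operatorname{int}\Delta$, let $B$ be the open ball of radius $r$ around $0$, let $\Delta^0=\Delta\setminus B$, and let $\Delta'=\varepsilon\Delta$ with $\varepsilon>0$ and $\Delta'\subset B$. For $s'\in\partial\Delta'$ in the relative interior of $\varepsilon\Theta$, $\Theta$ a proper face of $\Delta$ of dimension $l$, the *curved normal cone* is $$n(s')=\{m: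 m_i=s'_i\ (i\le l),\ m_i\le s'_i\ (i>l)\},$$ where the coordinates are $\tau$-associated for some $\tau\in\partial T$ with $\Theta_\tau=\Theta$ (the choice does not matter). The *fat cone* $N(\varepsilon\Theta)$ is the union of the $n(s')$ over $s'$ in the relative interior of $\varepsilon\Theta$. For $s\in\partial\Delta$ with $s\in n(s')$, $I_s\subset n(s')$ is the segment from $s$ to $s'$ given by $m_i=(1-\theta)s_i+\theta s'_i$ $(i>l)$, $0\le\theta\le1$. For a $k$-dimensional $\tau\in\partial T$, $s$ is a *$\tau$-point* if $|y_1|,\dots,|y_k|$ are constant along $I_s$ in all $\tau$-associated coordinates and $I_s$ lies in $N(\varepsilon\Theta)$ for some proper face $\Theta\supseteq\Theta_\tau$. All of this depends on $t$. **Proposition 3.1.** Given the above data and the cells $\{W_\tau\}$, there is a real number $R>0$ such that for every $t\in\mathbb C$ with $|t|\ge R$: 1. the intervals trivialize $\Delta^0\cong S^{N-1}\times I$: every $s\in\partial\Delta$ lies in $n(s')$ for exactly one $s'\in\partial\Delta'$, and there are a homeomorphism $h:S^{N-1}\to\partial\Delta$ and a homeomorphism $\Phi:S^{N-1}\times[0,1]\to\Delta^0$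 with $\Phi(p,0)=h(p)$ and $\Phi(\{p\}\times[0,1])=I_{h(p)}\cap\Delta^0$ for all $p$; 2. the collection $\{I_s\}_{s\in\partial\Delta}$ is $W$-supported: for every $\tau\in\partial T$, every point of $W_\tau$ is a $\tau$-point. -/

import Mathlib

open Set Topology
open scoped Pointwise

namespace TorusFib

/-- The real vector space `M = ℤ^N ⊗ ℝ`. -/
abbrev Vec (N : ℕ) : Type := EuclideanSpace ℝ (Fin N)

/-- The lattice `ℤ^N`. -/
abbrev Lat (N : ℕ) : Type := Fin N → ℤ

/-- A lattice vector, seen as a point of `M`. -/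
noncomputable def latPt {N : ℕ} (z : Lat N) : Vec N := WithLp.toLp 2 (fun i => (z i : ℝ))

/-! ### Polytopes and their faces -/

/-- A convex integral polyhedron: the convex hull of finitely many lattice points. -/
def IsLatticePolytope {N : ℕ} (P : Set (Vec N)) : Prop :=
  ∃ S : Finset (Lat N), P = convexHull ℝ (latPt '' (S : Set (Lat N)))

/-- The polar polyhedron `{u | ⟨u, m⟩ ≥ -1 for all m ∈ P}`
(the dual space is identified with `M` by the standard pairing). -/
def polarBody {N : ℕ} (P : Set (Vec N)) : Set (Vec N) :=
  {u | ∀ m ∈ P, -1 ≤ inner ℝ u m}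

/-- Reflexive polyhedron. -/
def IsReflexive {N : ℕ} (P : Set (Vec N)) : Prop :=
  IsLatticePolytope P ∧ (0 : Vec N) ∈ interior P ∧ IsLatticePolytope (polarBody P)

/-- Nonempty faces of a polytope (the polytope is a face of itself). -/
def IsFace {N : ℕ} (P F : Set (Vec N)) : Prop := F.Nonempty ∧ IsExposed ℝ P F

/-- The smallest face of `P` that contains `S`. -/
def minFace {N : ℕ} (P S : Set (Vec N)) : Set (Vec N) :=
  ⋂₀ {F | IsFace P F ∧ S ⊆ F}

/-- The dimension of (the affine span of) a set. -/
noncomputable def polyDim {N : ℕ} (S : Set (Vec N)) : ℕ :=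
  Module.finrank ℝ (vectorSpan ℝ S)

/-- The edges of `P` that emanate from `v`. -/
def edgesAt {N : ℕ} (P : Set (Vec N)) (v : Vec N) : Set (Set (Vec N)) :=
  {E | IsFace P E ∧ polyDim E = 1 ∧ v ∈ E}

/-- Nonsingular polytope: at every vertex `v` there are exactly `N` edges, and the lattice
points of these edges generate the lattice `ℤ^N` (as an affine lattice, with `v` as origin). -/
def IsNonsingular {N : ℕ} (P : Set (Vec N)) : Prop :=
  ∀ v : Lat N, IsFace P {latPt v} →
    (edgesAt P (latPt v)).ncard = N ∧
    AddSubgroup.closure {z : Lat N | ∃ E ∈ edgesAt P (latPt v), latPt (v + z) ∈ E} = ⊤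

/-! ### Triangulations and the characteristic function -/

/-- `ψ` is the characteristic function of `lam` for the triangulation `T`: affine-linear on
every simplex of `T`, with value `lam` at the vertices of `T`.
It is determined by this on the space of `T`. -/
def IsCharacteristic {N : ℕ} (T : Geometry.SimplicialComplex ℝ (Vec N)) (lam : Lat N → ℤ)
    (ψ : Vec N → ℝ) : Prop :=
  (∀ s ∈ T.faces, ∃ a : Vec N →ᵃ[ℝ] ℝ, EqOn ψ a (convexHull ℝ (s : Set (Vec N)))) ∧
  ∀ z : Lat N, latPt z ∈ T.vertices → ψ (latPt z) = lam z

/-- Strict convexity of a `T`-piecewise linear function, with the sign convention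
`ψ (t x + (1 - t) y) ≥ t ψ x + (1 - t) ψ y`: the domains of linearity of `ψ` are no larger than
the simplices of `T`. -/
def IsStrictlyConvexFor {N : ℕ} (T : Geometry.SimplicialComplex ℝ (Vec N)) (P : Set (Vec N))
    (ψ : Vec N → ℝ) : Prop :=
  ConcaveOn ℝ P ψ ∧
  ∀ D : Set (Vec N), D ⊆ P → Convex ℝ D → (∃ a : Vec N →ᵃ[ℝ] ℝ, EqOn ψ a D) →
    ∃ s ∈ T.faces, D ⊆ convexHull ℝ (s : Set (Vec N))

/-- The fixed data: a nonsingular reflexive polytope `P` in `ℝ^N`, a set `A` of lattice points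
with `0 ∈ A` and convex hull `P`, a central triangulation `T` of `(P, A)`, and an integral vector
`lam` in the interior of the cone `C(T)` (in particular `T` is coherent). -/
structure CYData (N : ℕ) where
  P : Set (Vec N)
  A : Finset (Lat N)
  T : Geometry.SimplicialComplex ℝ (Vec N)
  lam : Lat N → ℤ
  reflexive : IsReflexive P
  nonsingular : IsNonsingular P
  zero_mem : (0 : Lat N) ∈ A
  hull : convexHull ℝ (latPt '' (A : Set (Lat N))) = P
  space_eq : T.space = P
  vertices_subset : T.vertices ⊆ latPt '' (A : Set (Lat N))
  central : ∀ s ∈ T.faces, s.card = N + 1 → (0 : Vec N) ∈ s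
  lam_interior : ∃ ψ : Vec N → ℝ, IsCharacteristic T lam ψ ∧ IsStrictlyConvexFor T P ψ ∧
    ∀ ω ∈ A, (lam ω : ℝ) ≤ ψ (latPt ω) ∧ (ψ (latPt ω) = lam ω ↔ latPt ω ∈ T.vertices)

/-- The simplices (given by their vertex sets) of the triangulation `∂T` of `∂P`. -/
def CYData.bdry {N : ℕ} (D : CYData N) : Set (Finset (Vec N)) :=
  {τ | τ ∈ D.T.faces ∧ convexHull ℝ (τ : Set (Vec N)) ⊆ frontier D.P}

/-! ### The cells `W_τ` -/

/-- The center `O(s)` of a simplex. -/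
noncomputable def center {N : ℕ} (s : Finset (Vec N)) : Vec N := (s.card : ℝ)⁻¹ • ∑ v ∈ s, v

/-- First barycentric subdivision: one simplex for every nonempty chain of simplices,
with the centers of the members of the chain as vertices. -/
def barSubdivision {N : ℕ} (K : Set (Finset (Vec N))) : Set (Finset (Vec N)) :=
  {ρ | ∃ c : Finset (Finset (Vec N)), c.Nonempty ∧ (c : Set (Finset (Vec N))) ⊆ K ∧
    IsChain (· ⊆ ·) (c : Set (Finset (Vec N))) ∧
    (ρ : Set (Vec N)) = center '' (c : Set (Finset (Vec N)))}

/-- `V⁰_τ`: the union of the simplices of the second barycentric subdivision of `∂T` that have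
`O(τ)` as a vertex. -/
def CYData.V0 {N : ℕ} (D : CYData N) (τ : Finset (Vec N)) : Set (Vec N) :=
  ⋃ ρ ∈ {ρ | ρ ∈ barSubdivision (barSubdivision D.bdry) ∧ center τ ∈ ρ},
    convexHull ℝ (ρ : Set (Vec N))

/-- The `V τ` are small open neighbourhoods in `∂P` of the `V⁰_τ`: small enough that `V τ` and
`V τ'` meet only for nested `τ`, `τ'`, and that the closure of `V τ` stays inside the open star of
`τ` in `∂T` (which contains the compact set `V⁰_τ`), i.e. misses every simplex of `∂T` that does
not have `τ` as a face. -/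
structure CYData.IsDualCover {N : ℕ} (D : CYData N) (V : Finset (Vec N) → Set (Vec N)) :
    Prop where
  isOpen : ∀ τ ∈ D.bdry, ∃ O : Set (Vec N), IsOpen O ∧ V τ = O ∩ frontier D.P
  V0_subset : ∀ τ ∈ D.bdry, D.V0 τ ⊆ V τ
  nested : ∀ τ ∈ D.bdry, ∀ τ' ∈ D.bdry, (V τ ∩ V τ').Nonempty → τ ⊆ τ' ∨ τ' ⊆ τ
  star : ∀ τ ∈ D.bdry, ∀ ρ ∈ D.bdry, ¬ τ ⊆ ρ →
    Disjoint (closure (V τ)) (convexHull ℝ (ρ : Set (Vec N)))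

/-- The cell `W_τ`: the closure of `V_τ` minus all `V_τ'` with `τ'` strictly larger than `τ`. -/
def CYData.W {N : ℕ} (D : CYData N) (V : Finset (Vec N) → Set (Vec N)) (τ : Finset (Vec N)) :
    Set (Vec N) :=
  closure (V τ) \ ⋃ τ' ∈ {τ' | τ' ∈ D.bdry ∧ τ ⊂ τ'}, V τ'

/-! ### The weighted moment map and the coordinates `|y_i|` on `P` -/

/-- The monomial `x^v` on the torus. -/
noncomputable def monom {N : ℕ} (x : Fin N → ℂ) (v : Lat N) : ℂ := ∏ i, x i ^ v i

/-- The weighted moment map `μ_t` on the open torus orbit of `X_P`. -/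
noncomputable def CYData.moment {N : ℕ} (D : CYData N) (t : ℂ) (x : Fin N → ℂ) : Vec N :=
  (∑ ω ∈ D.A, ‖t ^ D.lam ω‖ * ‖monom x ω‖)⁻¹ •
    ∑ ω ∈ D.A, (‖t ^ D.lam ω‖ * ‖monom x ω‖) • latPt ω

/-- The inverse of the homeomorphism from the positive real points of the torus to the interior
of `P` given by `μ_t`. -/
noncomputable def CYData.posPoint {N : ℕ} (D : CYData N) (t : ℂ) : Vec N → Fin N → ℝ :=
  Function.invFunOn (fun x : Fin N → ℝ => D.moment t (fun i => (x i : ℂ))) {x | ∀ i, 0 < x i}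

/-- The function `|x^v|` on `P`, transported from the nonnegative real part of `X_P` by `μ_t`: it
is given by the monomial in the interior of `P`, and extended to boundary points by continuity
(it is used only at points where this extension exists). -/
noncomputable def CYData.absMonom {N : ℕ} (D : CYData N) (t : ℂ) (v : Lat N) : Vec N → ℝ :=
  extendFrom (interior D.P) (fun m => ‖monom (fun i => (D.posPoint t m i : ℂ)) v‖)

/-- The lattice vectors parallel to `S`. -/
def latticeDir {N : ℕ} (S : Set (Vec N)) : Set (Lat N) :=
  {z | latPt z ∈ vectorSpan ℝ S}

/-- `τ`-associated coordinates, for a simplex `τ` of dimension `k` (so `τ.card = k + 1`) whose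
minimal face `Θ_τ` has dimension `l`. The indices `1, …, N` of the usual numbering are `0, …, N - 1` here. -/
structure AssocCoords {N : ℕ} (P : Set (Vec N)) (τ : Finset (Vec N)) where
  /-- the reference point `Ω` -/
  base : Lat N
  /-- the points `ω_1, …, ω_N` -/
  pt : Fin N → Lat N
  base_mem : latPt base ∈ τ
  /-- `Ω, ω_1, …, ω_N` is an affine basis of the lattice -/
  basis : AddSubgroup.closure (range fun i => pt i - base) = ⊤
  /-- `Ω, ω_1, …, ω_k` generate the affine lattice of `τ` -/
  simplex_basis :
    (AddSubgroup.closure {z | ∃ i : Fin N, (i : ℕ) + 1 < τ.card ∧ z = pt i - base} :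
      Set (Lat N)) = latticeDir (τ : Set (Vec N))
  /-- `Ω, ω_1, …, ω_l` generate the affine lattice of the minimal face -/
  face_basis :
    (AddSubgroup.closure
      {z | ∃ i : Fin N, (i : ℕ) < polyDim (minFace P (τ : Set (Vec N))) ∧ z = pt i - base} :
      Set (Lat N)) = latticeDir (minFace P (τ : Set (Vec N)))
  /-- `0 - Ω = (ω_{l+1} - Ω) + … + (ω_N - Ω)` -/
  sum_eq :
    -base = Finset.sum
      (Finset.univ.filter fun i : Fin N => polyDim (minFace P (τ : Set (Vec N))) ≤ (i : ℕ))
      (fun i => pt i - base)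
  /-- `y_{l+1}, …, y_N` are regular along the toric divisors of the facets through `Θ_τ`
  (whose inner normals are the vertices of the face of the polar body used here) -/
  regular : ∀ i : Fin N, polyDim (minFace P (τ : Set (Vec N))) ≤ (i : ℕ) →
    ∀ u ∈ polarBody P, (∀ m ∈ minFace P (τ : Set (Vec N)), inner ℝ u m = -1) →
      0 ≤ inner ℝ u (latPt (pt i - base))

/-- The coordinate `m_i = |y_i|(m)`, where `y_i = x^(ω_i - Ω)`. -/
noncomputable def CYData.coord {N : ℕ} (D : CYData N) (t : ℂ) {τ : Finset (Vec N)}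
    (c : AssocCoords D.P τ) (i : Fin N) (m : Vec N) : ℝ :=
  D.absMonom t (c.pt i - c.base) m

/-- The part of `P` on which `τ`-associated coordinates are defined, with `y_1, …, y_l`
invertible: all faces of `P` not containing `F = Θ_τ` are removed. -/
def chart {N : ℕ} (P F : Set (Vec N)) : Set (Vec N) :=
  {m | m ∈ P ∧ F ⊆ minFace P {m}}

/-! ### Curved normal cones, the intervals `I_s`, and `τ`-points

The mini-copy `P'` of `P` is `ε • P`, and the mini-copy of a face `Θ` is `ε • Θ`. -/

/-- The curved normal cone at `s'`, in the `τ`-associated coordinates `c`. -/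
def CYData.coneIn {N : ℕ} (D : CYData N) (t : ℂ) {τ : Finset (Vec N)} (c : AssocCoords D.P τ)
    (s' : Vec N) : Set (Vec N) :=
  {m | m ∈ chart D.P (minFace D.P (τ : Set (Vec N))) ∧
    (∀ i : Fin N, (i : ℕ) < polyDim (minFace D.P (τ : Set (Vec N))) →
      D.coord t c i m = D.coord t c i s') ∧
    (∀ i : Fin N, polyDim (minFace D.P (τ : Set (Vec N))) ≤ (i : ℕ) →
      D.coord t c i m ≤ D.coord t c i s')}

/-- `τ` is a simplex of `∂T` such that `s'` is an interior point of the mini-copy of `Θ_τ`. -/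
def CYData.Carries {N : ℕ} (D : CYData N) (ε : ℝ) (τ : Finset (Vec N)) (s' : Vec N) : Prop :=
  τ ∈ D.bdry ∧ minFace D.P (τ : Set (Vec N)) = minFace D.P {ε⁻¹ • s'}

/-- The curved normal cone `n(s')` at a point `s'` of `∂P'`. -/
def CYData.normalCone {N : ℕ} (D : CYData N) (t : ℂ) (ε : ℝ) (s' : Vec N) : Set (Vec N) :=
  {m | ∃ τ, D.Carries ε τ s' ∧ ∃ c : AssocCoords D.P τ, m ∈ D.coneIn t c s'}

/-- The fat curved normal cone `N(Θ')`: the union of the curved normal cones at the points in the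
relative interior of the mini-copy `Θ'` of the proper face `Θ`. -/
def CYData.fatCone {N : ℕ} (D : CYData N) (t : ℂ) (ε : ℝ) (Θ : Set (Vec N)) : Set (Vec N) :=
  {m | ∃ s' ∈ frontier (ε • D.P), minFace D.P {ε⁻¹ • s'} = Θ ∧ m ∈ D.normalCone t ε s'}

/-- The interval `I_s`, for `s ∈ ∂P`: with `s' ∈ ∂P'` the point whose curved normal cone contains
`s`, the segment from `s` to `s'` in `n(s')` that is affine in the last `N - l` of the
coordinates. -/
def CYData.interval {N : ℕ} (D : CYData N) (t : ℂ) (ε : ℝ) (s : Vec N) : Set (Vec N) :=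
  {m | ∃ s' ∈ frontier (ε • D.P), ∃ τ, D.Carries ε τ s' ∧ ∃ c : AssocCoords D.P τ,
    s ∈ D.coneIn t c s' ∧ m ∈ D.coneIn t c s' ∧
    ∃ θ ∈ Icc (0 : ℝ) 1, ∀ i : Fin N, polyDim (minFace D.P (τ : Set (Vec N))) ≤ (i : ℕ) →
      D.coord t c i m = (1 - θ) * D.coord t c i s + θ * D.coord t c i s'}

/-- `s` is a `τ`-point: the first `k` coordinates are constant along `I_s` in any `τ`-associated
coordinate system, and `I_s` lies in the fat cone `N(Θ')` for some proper face `Θ ⊇ Θ_τ`. -/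
def CYData.IsTauPoint {N : ℕ} (D : CYData N) (t : ℂ) (ε : ℝ) (τ : Finset (Vec N)) (s : Vec N) :
    Prop :=
  (∀ c : AssocCoords D.P τ, ∀ i : Fin N, (i : ℕ) + 1 < τ.card →
    ∀ m ∈ D.interval t ε s, ∀ m' ∈ D.interval t ε s, D.coord t c i m = D.coord t c i m') ∧
  ∃ Θ : Set (Vec N), IsFace D.P Θ ∧ Θ ⊆ frontier D.P ∧ minFace D.P (τ : Set (Vec N)) ⊆ Θ ∧
    D.interval t ε s ⊆ D.fatCone t ε Θ

/-- The collection `{I_s}` is `W`-supported. -/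
def CYData.IsWSupported {N : ℕ} (D : CYData N) (t : ℂ) (ε : ℝ)
    (V : Finset (Vec N) → Set (Vec N)) : Prop :=
  ∀ τ ∈ D.bdry, ∀ s ∈ D.W V τ, D.IsTauPoint t ε τ s

/-- `P⁰`: the polytope with the ball of radius `r` around the origin removed. -/
def CYData.P0 {N : ℕ} (D : CYData N) (r : ℝ) : Set (Vec N) := D.P \ Metric.ball 0 r

/-- The collection `{I_s}` trivializes `P⁰ ≅ S^{N-1} × I`: every `s ∈ ∂P` lies in the curved normal
cone of exactly one point of `∂P'`, and there is a homeomorphism of `S^{N-1} × [0,1]` with `P⁰`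
that restricts on `S^{N-1} × {0}` to a homeomorphism `h` with `∂P` and maps each `{p} × [0,1]`
onto `I_{h p} ∩ P⁰`. -/
def CYData.IsTrivialization {N : ℕ} (D : CYData N) (t : ℂ) (ε r : ℝ) : Prop :=
  (∀ s ∈ frontier D.P, ∃! s', s' ∈ frontier (ε • D.P) ∧ s ∈ D.normalCone t ε s') ∧
  ∃ (h : Metric.sphere (0 : Vec N) 1 ≃ₜ frontier D.P)
    (Φ : (Metric.sphere (0 : Vec N) 1 × Icc (0 : ℝ) 1) ≃ₜ D.P0 r),
    (∀ p, (Φ (p, 0) : Vec N) = h p) ∧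
    ∀ p, (range fun θ : Icc (0 : ℝ) 1 => (Φ (p, θ) : Vec N)) =
      D.interval t ε (h p) ∩ D.P0 r

end TorusFib

namespace TorusFib

variable {N : ℕ}

/-! ### Lattice points and the heights over the facets -/

/-! Put x = exp(ξ) and L = log|t|. On positive points the moment map sends ξ to the mean of the
points of A for the Gibbs weights proportional to exp(L λ(ω) + ⟨ω, ξ⟩); it is the gradient of log Z,
with Z the sum of these exponentials (`hasDerivAt_log_part`), and it is strictly monotone
(`inner_sub_bary_wt_pos`). The closure of the set of weight vectors is compact and is mapped
bijectively onto the polytope by taking means (`bary_injOn_toric`, `bary_image_toric`), so a point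
of the polytope, on the boundary or not, can be replaced by its weights.

In these terms the curved normal cones are simple. The points of n(s') arise from s' by multiplying
the weight of each ω by the product of y_u^(1 + ⟨u, ω⟩), where y_u in [0, 1] is free for the facets
u through s'/ε and equal to 1 otherwise (`mem_coneIn_iff`). For y > 0 this translates ξ by the sum
of log y_u · u (`twistN_wt`); the value y_u = 0 reaches the boundary. By nonsingularity the normals
of the facets through a face are dual to the transverse associated coordinates, whose values are
s'_i y_u. Hence the cone does not depend on the coordinates, and I_s is the path y ↦ (1 - θ) y + θ
(`mem_interval_iff`).

For every t ≠ 0 the cones fill the complement of ε P without overlap. For an interior point outside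
ε P the tip comes from minimizing log Z(ξ + ∑ c_u u) + ε ∑ c_u over c ≥ 0: the optimality conditions
say that the moment image lies on ∂(ε P) and that c is supported on the facets through it
(`exists_push_eq_of_interior`); the boundary follows by compactness. Two tips for one point would
contradict the strict monotonicity of the moment map, by complementary slackness (`push_fst_eq`).

Large |t| is needed only for concentration. The weights at m maximize the mean of λ up to an error
of order 1/L, and strict convexity of ψ leaves non-negligible weight only to the vertices of a
simplex containing m (`sum_lam_lt`, `exists_forall_weights_le`). As T is central, at a point s' of
∂(ε P) these are 0 and points of the face Θ of s'/ε. On ∂P the weight of 0 vanishes, so boundary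
points of n(s') are near Θ. Since the closure of V_τ avoids the faces that do not contain τ, meeting
it forces τ ⊆ Θ (`exists_forall_subset_minFace`), and monomials parallel to τ are then constant on
n(s'). Moreover, while y grows inside the ball, the change of the weight of 0 dominates all other
changes. An interval that has entered the ball therefore stays in it (`norm_push_lt`), the crossing
time is continuous, and rescaling by it gives the trivialization (`exists_trivialization`). -/

theorem inner_latPt (u z : Lat N) :
    inner ℝ (latPt u) (latPt z) = ((u ⬝ᵥ z : ℤ) : ℝ) := by
  simp [latPt, PiLp.inner_apply, dotProduct, mul_comm]

theorem latPt_injective : Function.Injective (latPt (N := N)) := by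
  intro a b h
  funext i
  have := congrArg (fun v : Vec N => v i) h
  simpa [latPt] using this

theorem latPt_add (a b : Lat N) : latPt (a + b) = latPt a + latPt b := by
  ext i; simp [latPt]

theorem latPt_sub (a b : Lat N) : latPt (a - b) = latPt a - latPt b := by
  ext i; simp [latPt]

theorem latPt_neg (a : Lat N) : latPt (-a) = -latPt a := by
  ext i; simp [latPt]

theorem latPt_zero : latPt (0 : Lat N) = 0 := by
  ext i; simp [latPt]

theorem latPt_zsmul (c : ℤ) (a : Lat N) : latPt (c • a) = (c : ℝ) • latPt a := by
  ext i; simp [latPt]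

theorem latPt_sum {ι : Type*} (s : Finset ι) (f : ι → Lat N) :
    latPt (∑ i ∈ s, f i) = ∑ i ∈ s, latPt (f i) := by
  classical
  induction s using Finset.induction_on with
  | empty => simp [latPt_zero]
  | insert a s ha ih => rw [Finset.sum_insert ha, Finset.sum_insert ha, latPt_add, ih]

/-- The affine function `1 + ⟨u, ·⟩`, the height over the hyperplane `⟨u, ·⟩ = -1`. -/
noncomputable def ht (u : Lat N) (x : Vec N) : ℝ := 1 + inner ℝ (latPt u) x

/-- The height of a lattice point, as a natural number. -/
def latHt (u z : Lat N) : ℕ := (1 + u ⬝ᵥ z).toNat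

theorem continuous_ht (u : Lat N) : Continuous (ht u) := by
  unfold ht; fun_prop

theorem ht_zero (u : Lat N) : ht u 0 = 1 := by simp [ht]

theorem ht_add_smul (u : Lat N) (x y : Vec N) (c : ℝ) :
    ht u (x + c • y) = ht u x + c * inner ℝ (latPt u) y := by
  simp [ht, inner_add_right, inner_smul_right]; ring

theorem ht_sum {ι : Type*} (s : Finset ι) (u : Lat N) (w : ι → ℝ) (f : ι → Vec N)
    (hw : ∑ i ∈ s, w i = 1) : ht u (∑ i ∈ s, w i • f i) = ∑ i ∈ s, w i * ht u (f i) := by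
  simp only [ht, inner_sum, inner_smul_right, mul_add, mul_one, Finset.sum_add_distrib, hw]

theorem ht_combo (u : Lat N) (x y : Vec N) {a b : ℝ} (h : a + b = 1) :
    ht u (a • x + b • y) = a * ht u x + b * ht u y := by
  simp only [ht, inner_add_right, inner_smul_right]
  linear_combination (-1 : ℝ) * h

theorem ht_latPt (u z : Lat N) : ht u (latPt z) = ((1 + u ⬝ᵥ z : ℤ) : ℝ) := by
  rw [ht, inner_latPt]; push_cast; ring

namespace CYData

variable (D : CYData N)

theorem convex_P : Convex ℝ D.P := by
  rw [← D.hull]; exact convex_convexHull ℝ _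

theorem isCompact_P : IsCompact D.P := by
  rw [← D.hull]
  exact Set.Finite.isCompact_convexHull ℝ ((Finset.finite_toSet D.A).image latPt)

theorem isClosed_P : IsClosed D.P := D.isCompact_P.isClosed

theorem zero_mem_interior : (0 : Vec N) ∈ interior D.P := D.reflexive.2.1

theorem zero_mem_P : (0 : Vec N) ∈ D.P := interior_subset D.zero_mem_interior

theorem latPt_mem {z : Lat N} (hz : z ∈ D.A) : latPt z ∈ D.P := by
  rw [← D.hull]; exact subset_convexHull ℝ _ ⟨z, hz, rfl⟩

/-- Lattice points whose convex hull is the polar body; among them are the facet normals. -/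
noncomputable def normals : Finset (Lat N) := D.reflexive.2.2.choose

theorem polar_eq : polarBody D.P = convexHull ℝ (latPt '' (D.normals : Set (Lat N))) :=
  D.reflexive.2.2.choose_spec

/-- This is the bipolar theorem. A functional separating x from P is positive somewhere by less than
c on P, and its multiple by -1/c is a point of the polar body; the inequality at x is inherited from
the finitely many generators by their convex hull. -/
theorem mem_P_iff {x : Vec N} : x ∈ D.P ↔ ∀ u ∈ D.normals, 0 ≤ ht u x := by
  constructor
  · intro hx u hu
    have : latPt u ∈ polarBody D.P := by
      rw [D.polar_eq]; exact subset_convexHull ℝ _ ⟨u, hu, rfl⟩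
    have := this x hx
    unfold ht; linarith
  · intro h
    by_contra hx
    obtain ⟨f, c, hf, hc⟩ := geometric_hahn_banach_closed_point D.convex_P D.isClosed_P hx
    have hc0 : 0 < c := by simpa using hf 0 D.zero_mem_P
    set v : Vec N := (InnerProductSpace.toDual ℝ (Vec N)).symm f with hv
    have hfv : ∀ y, f y = inner ℝ v y := fun y => by
      rw [hv, InnerProductSpace.toDual_symm_apply]
    have hmem : (-c⁻¹) • v ∈ polarBody D.P := by
      intro m hm
      have := (hf m hm).le
      rw [hfv] at this
      rw [inner_smul_left]
      have h2 : c⁻¹ * inner ℝ v m ≤ c⁻¹ * c := by gcongr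
      rw [inv_mul_cancel₀ hc0.ne'] at h2
      simp only [conj_trivial]; linarith
    have hsub : convexHull ℝ (latPt '' (D.normals : Set (Lat N))) ⊆ {w | -1 ≤ inner ℝ w x} := by
      refine convexHull_min ?_ ?_
      · rintro _ ⟨u, hu, rfl⟩
        have := h u hu
        unfold ht at this
        simp only [mem_ofPred_eq]; linarith
      · intro a ha b hb s t hs ht' hst
        simp only [mem_ofPred_eq, inner_add_left, inner_smul_left, conj_trivial] at *
        nlinarith
    have := hsub (D.polar_eq ▸ hmem)
    simp only [mem_ofPred_eq, inner_smul_left, conj_trivial, ← hfv] at this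
    have h2 : c⁻¹ * c < c⁻¹ * f x := by gcongr
    rw [inv_mul_cancel₀ hc0.ne'] at h2
    linarith

theorem ht_nonneg {x : Vec N} (hx : x ∈ D.P) {u : Lat N} (hu : u ∈ D.normals) : 0 ≤ ht u x :=
  D.mem_P_iff.1 hx u hu

theorem latHt_eq {u z : Lat N} (hu : u ∈ D.normals) (hz : z ∈ D.A) :
    (latHt u z : ℝ) = ht u (latPt z) := by
  have h := D.ht_nonneg (D.latPt_mem hz) hu
  rw [ht_latPt] at h ⊢
  have h' : (0 : ℤ) ≤ 1 + u ⬝ᵥ z := by exact_mod_cast h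
  have : ((latHt u z : ℕ) : ℤ) = 1 + u ⬝ᵥ z := Int.toNat_of_nonneg h'
  exact_mod_cast congrArg (Int.cast : ℤ → ℝ) this

/-- Directions that do not decrease the vanishing heights stay in `P` for a while. -/
theorem exists_add_smul_mem {q z : Vec N} (hq : q ∈ D.P)
    (hz : ∀ u ∈ D.normals, ht u q = 0 → 0 ≤ inner ℝ (latPt u) z) :
    ∃ δ > 0, q + (δ : ℝ) • z ∈ D.P := by
  have key : ∀ᶠ δ : ℝ in 𝓝[>] 0, ∀ u ∈ D.normals, 0 ≤ ht u (q + δ • z) := by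
    rw [Filter.eventually_all_finset]
    intro u hu
    rcases (D.ht_nonneg hq hu).eq_or_lt with h | h
    · filter_upwards [self_mem_nhdsWithin] with δ hδ
      rw [ht_add_smul, ← h, zero_add]
      exact mul_nonneg (le_of_lt hδ) (hz u hu h.symm)
    · have hc : Continuous fun δ : ℝ => ht u (q + δ • z) :=
        (continuous_ht u).comp (by fun_prop)
      have := hc.tendsto 0
      simp only [zero_smul, add_zero] at this
      filter_upwards [(this.eventually (lt_mem_nhds h)).filter_mono nhdsWithin_le_nhds] with δ hδ
      exact hδ.le
  obtain ⟨δ, hδ, hpos⟩ := (key.and self_mem_nhdsWithin).exists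
  exact ⟨δ, hpos, D.mem_P_iff.2 hδ⟩

theorem mem_interior_iff {x : Vec N} :
    x ∈ interior D.P ↔ ∀ u ∈ D.normals, 0 < ht u x := by
  constructor
  · intro hx u hu
    rcases (D.ht_nonneg (interior_subset hx) hu).eq_or_lt with h | h
    swap
    · exact h
    exfalso
    -- The generators of the polar body need not be vertices, and 0 is not excluded; but its height
    -- is constantly 1. A nonzero u gives the direction -u, which leaves P at once.
    have hu0 : latPt u ≠ 0 := by
      intro h0
      simp [ht, h0] at h
    have hc : Continuous fun δ : ℝ => x + δ • (-latPt u) := by fun_prop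
    have ht' := hc.tendsto 0
    simp only [zero_smul, add_zero] at ht'
    have := (ht'.eventually (mem_interior_iff_mem_nhds.1 hx)).filter_mono
      (nhdsWithin_le_nhds (s := Ioi 0))
    obtain ⟨δ, hδ, hpos⟩ := (this.and self_mem_nhdsWithin).exists
    have h1 := D.ht_nonneg hδ hu
    rw [ht_add_smul, ← h, inner_neg_right, real_inner_self_eq_norm_sq] at h1
    have : 0 < δ * ‖latPt u‖ ^ 2 := mul_pos hpos (pow_pos (norm_pos_iff.2 hu0) 2)
    linarith
  · intro h
    have ho : IsOpen (⋂ u ∈ D.normals, {y | 0 < ht u y}) :=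
      isOpen_biInter_finset fun u _ => isOpen_lt continuous_const (continuous_ht u)
    refine interior_maximal ?_ ho (by simpa using h)
    intro y hy
    simp only [mem_iInter, mem_ofPred_eq] at hy
    exact D.mem_P_iff.2 fun u hu => (hy u hu).le

theorem mem_frontier_iff {x : Vec N} :
    x ∈ frontier D.P ↔ x ∈ D.P ∧ ∃ u ∈ D.normals, ht u x = 0 := by
  rw [D.isClosed_P.frontier_eq, mem_sdiff, D.mem_interior_iff]
  refine and_congr_right fun hx => ?_
  push Not
  refine exists_congr fun u => and_congr_right fun hu => ?_
  have := D.ht_nonneg hx hu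
  constructor <;> intro h <;> linarith

theorem frontier_subset_P : frontier D.P ⊆ D.P := D.isClosed_P.frontier_subset

theorem closure_interior : closure (interior D.P) = D.P := by
  rw [D.convex_P.closure_interior_eq_closure_of_nonempty_interior ⟨0, D.zero_mem_interior⟩,
    D.isClosed_P.closure_eq]

/-! ### Faces -/

/-- A point of the convex hull of `S` at which no more heights vanish than on all of `S`. -/
theorem exists_generic {S : Set (Vec N)} (hS : S.Nonempty) (hSP : S ⊆ D.P) :
    ∃ q ∈ convexHull ℝ S, ∀ u ∈ D.normals, ht u q = 0 → ∀ v ∈ S, ht u v = 0 := by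
  classical
  have hsub : convexHull ℝ S ⊆ D.P := convexHull_min hSP D.convex_P
  suffices H : ∀ U ⊆ D.normals, ∃ q ∈ convexHull ℝ S, ∀ u ∈ U, ht u q = 0 → ∀ v ∈ S, ht u v = 0 from
    H _ subset_rfl
  intro U
  induction U using Finset.induction_on with
  | empty => intro _; obtain ⟨q, hq⟩ := hS; exact ⟨q, subset_convexHull ℝ _ hq, by simp⟩
  | insert u U hu ih =>
    intro hU
    obtain ⟨q, hq, hqU⟩ := ih ((Finset.subset_insert _ _).trans hU)
    by_cases h : ∀ v ∈ S, ht u v = 0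
    · refine ⟨q, hq, fun u' hu' h0 => ?_⟩
      rcases Finset.mem_insert.1 hu' with rfl | hu'
      · exact h
      · exact hqU u' hu' h0
    · push Not at h
      obtain ⟨v, hv, hv0⟩ := h
      have hvc := subset_convexHull ℝ _ hv
      refine ⟨(1/2 : ℝ) • q + (1/2 : ℝ) • v, convex_convexHull ℝ S hq hvc (by norm_num)
        (by norm_num) (by norm_num), fun u' hu' h0 => ?_⟩
      rw [ht_combo u' q v (by norm_num)] at h0
      have h1 := D.ht_nonneg (hsub hq) (hU hu')
      have h2 := D.ht_nonneg (hsub hvc) (hU hu')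
      rcases Finset.mem_insert.1 hu' with rfl | hu'
      · exact absurd (by linarith) hv0
      · exact hqU u' hu' (by linarith)

/-- The sum of the heights over U is nonnegative on P and vanishes at q, so minus the sum of these
normals is a functional whose maximum on P is attained exactly where all of them are tight. -/
theorem isFace_of_tight {U : Set (Lat N)} {q : Vec N} (hq : q ∈ D.P)
    (hqU : ∀ u ∈ D.normals, u ∈ U → ht u q = 0) :
    IsFace D.P {x | x ∈ D.P ∧ ∀ u ∈ D.normals, u ∈ U → ht u x = 0} := by
  classical
  refine ⟨⟨q, hq, hqU⟩, fun _ => ?_⟩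
  refine ⟨-innerSL ℝ (∑ u ∈ D.normals.filter (· ∈ U), latPt u), ?_⟩
  have key : ∀ x : Vec N, (-innerSL ℝ (∑ u ∈ D.normals.filter (· ∈ U), latPt u) : Vec N →L[ℝ] ℝ) x =
      (D.normals.filter (· ∈ U)).card - ∑ u ∈ D.normals.filter (· ∈ U), ht u x := by
    intro x
    simp [ht, Finset.sum_add_distrib]
  ext x
  simp only [mem_ofPred_eq, key]
  refine and_congr_right fun hx => ?_
  have hnn : ∀ y ∈ D.P, 0 ≤ ∑ u ∈ D.normals.filter (· ∈ U), ht u y := fun y hy =>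
    Finset.sum_nonneg fun u hu => D.ht_nonneg hy (Finset.mem_filter.1 hu).1
  constructor
  · intro h y hy
    have : ∑ u ∈ D.normals.filter (· ∈ U), ht u x = 0 :=
      Finset.sum_eq_zero fun u hu => h u (Finset.mem_filter.1 hu).1 (Finset.mem_filter.1 hu).2
    have := hnn y hy
    linarith
  · intro h u hu huU
    have h1 := h q hq
    have h2 : ∑ u ∈ D.normals.filter (· ∈ U), ht u q = 0 :=
      Finset.sum_eq_zero fun u hu => hqU u (Finset.mem_filter.1 hu).1 (Finset.mem_filter.1 hu).2
    have h3 : ∑ u ∈ D.normals.filter (· ∈ U), ht u x = 0 := le_antisymm (by linarith) (hnn x hx)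
    exact (Finset.sum_eq_zero_iff_of_nonneg fun u hu =>
      D.ht_nonneg hx (Finset.mem_filter.1 hu).1).1 h3 u (Finset.mem_filter.2 ⟨hu, huU⟩)

/-- A face contains every point of `P` at which the heights vanishing on the face vanish. -/
theorem mem_of_isFace {F : Set (Vec N)} (hF : IsFace D.P F) {q x : Vec N} (hq : q ∈ F)
    (hx : x ∈ D.P) (h : ∀ u ∈ D.normals, ht u q = 0 → ht u x = 0) : x ∈ F := by
  obtain ⟨l, hl⟩ := hF.2 hF.1
  have hqP : q ∈ D.P := hF.2.subset hq
  obtain ⟨δ, hδ, hmem⟩ := D.exists_add_smul_mem (z := q - x) hqP (by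
    intro u hu h0
    have h1 := h u hu h0
    unfold ht at h0 h1
    rw [inner_sub_right]; linarith)
  rw [hl] at hq ⊢
  refine ⟨hx, fun y hy => (hq.2 y hy).trans ?_⟩
  have := hq.2 _ hmem
  simp only [map_add, map_smul, map_sub, smul_eq_mul] at this
  nlinarith

/-- Faces become sets of tight normals. The common zeros of the heights vanishing on S form a face;
conversely, any face containing S contains a generic point of the hull of S, and this point already
forces all such common zeros into the face. -/
theorem mem_minFace_iff {S : Set (Vec N)} (hS : S.Nonempty) (hSP : S ⊆ D.P) {x : Vec N} :
    x ∈ minFace D.P S ↔ x ∈ D.P ∧ ∀ u ∈ D.normals, (∀ v ∈ S, ht u v = 0) → ht u x = 0 := by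
  constructor
  · intro h
    obtain ⟨q, hq⟩ := hS
    have := D.isFace_of_tight (U := {u | ∀ v ∈ S, ht u v = 0}) (hSP hq) (fun u _ hu => hu q hq)
    exact h _ ⟨this, fun v hv => ⟨hSP hv, fun u _ hu => hu v hv⟩⟩
  · rintro ⟨hx, h⟩ F ⟨hF, hSF⟩
    obtain ⟨q, hq, hqS⟩ := D.exists_generic hS hSP
    have hqF : q ∈ F := convexHull_min hSF (hF.2.convex D.convex_P) hq
    exact D.mem_of_isFace hF hqF hx fun u hu h0 => h u hu (hqS u hu h0)

theorem mem_minFace_singleton {q x : Vec N} (hq : q ∈ D.P) :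
    x ∈ minFace D.P {q} ↔ x ∈ D.P ∧ ∀ u ∈ D.normals, ht u q = 0 → ht u x = 0 := by
  rw [D.mem_minFace_iff (singleton_nonempty q) (singleton_subset_iff.2 hq)]
  simp

theorem isFace_minFace {S : Set (Vec N)} (hS : S.Nonempty) (hSP : S ⊆ D.P) :
    IsFace D.P (minFace D.P S) := by
  have : minFace D.P S = {x | x ∈ D.P ∧ ∀ u ∈ D.normals, u ∈ {u | ∀ v ∈ S, ht u v = 0} → ht u x = 0} := by
    ext x; exact D.mem_minFace_iff hS hSP
  obtain ⟨q, hq⟩ := hS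
  rw [this]
  exact D.isFace_of_tight (hSP hq) fun u _ hu => hu q hq

theorem self_mem_minFace (q : Vec N) : q ∈ minFace D.P {q} := fun _ hF => hF.2 rfl

theorem minFace_subset_minFace_iff {q q' : Vec N} (hq : q ∈ D.P) (hq' : q' ∈ D.P) :
    minFace D.P {q} ⊆ minFace D.P {q'} ↔ ∀ u ∈ D.normals, ht u q' = 0 → ht u q = 0 := by
  constructor
  · intro h
    exact ((D.mem_minFace_singleton hq').1 (h (D.self_mem_minFace q))).2
  · intro h x hx
    rw [D.mem_minFace_singleton hq] at hx
    exact (D.mem_minFace_singleton hq').2 ⟨hx.1, fun u hu h0 => hx.2 u hu (h u hu h0)⟩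

theorem mem_chart_iff {q m : Vec N} (hq : q ∈ D.P) :
    m ∈ chart D.P (minFace D.P {q}) ↔
      m ∈ D.P ∧ ∀ u ∈ D.normals, ht u m = 0 → ht u q = 0 :=
  and_congr_right fun hm => D.minFace_subset_minFace_iff hq hm

/-- The point q is in the relative interior of its minimal face, so a direction annihilated by the
tight normals can be followed for a short time inside that face. -/
theorem mem_vectorSpan_minFace_iff {q z : Vec N} (hq : q ∈ D.P) :
    z ∈ vectorSpan ℝ (minFace D.P {q}) ↔
      ∀ u ∈ D.normals, ht u q = 0 → inner ℝ (latPt u) z = 0 := by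
  constructor
  · intro hz u hu h0
    have : vectorSpan ℝ (minFace D.P {q}) ≤ LinearMap.ker (innerSL ℝ (latPt u) : Vec N →L[ℝ] ℝ).toLinearMap := by
      refine Submodule.span_le.2 ?_
      rintro _ ⟨a, ha, b, hb, rfl⟩
      have h1 := ((D.mem_minFace_singleton hq).1 ha).2 u hu h0
      have h2 := ((D.mem_minFace_singleton hq).1 hb).2 u hu h0
      unfold ht at h1 h2
      simp only [vsub_eq_sub, SetLike.mem_coe, LinearMap.mem_ker, ContinuousLinearMap.coe_coe,
        innerSL_apply_apply, inner_sub_right]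
      linarith
    simpa using this hz
  · intro h
    obtain ⟨δ, hδ, hmem⟩ := D.exists_add_smul_mem hq fun u hu h0 => (h u hu h0).ge
    have h1 : q + δ • z ∈ minFace D.P {q} :=
      (D.mem_minFace_singleton hq).2 ⟨hmem, fun u hu h0 => by
        rw [ht_add_smul, h0, h u hu h0]; simp⟩
    have h2 := vsub_mem_vectorSpan ℝ h1 (D.self_mem_minFace q)
    simp only [vsub_eq_sub, add_sub_cancel_left] at h2
    have := Submodule.smul_mem _ δ⁻¹ h2
    rwa [smul_smul, inv_mul_cancel₀ hδ.ne', one_smul] at this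

/-- If a convex combination of points of `A` lies over a facet, so do the points occurring. -/
theorem ht_eq_zero_of_sum {u : Lat N} (hu : u ∈ D.normals) {ι : Type*} {s : Finset ι}
    {w : ι → ℝ} {f : ι → Vec N} (hf : ∀ i ∈ s, f i ∈ D.P) (hw0 : ∀ i ∈ s, 0 ≤ w i)
    (hw : ∑ i ∈ s, w i = 1) (h : ht u (∑ i ∈ s, w i • f i) = 0) {i : ι} (hi : i ∈ s)
    (hpos : 0 < w i) : ht u (f i) = 0 := by
  rw [ht_sum s u w f hw, Finset.sum_eq_zero_iff_of_nonneg fun i hi =>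
    mul_nonneg (hw0 i hi) (D.ht_nonneg (hf i hi) hu)] at h
  exact (mul_eq_zero.1 (h i hi)).resolve_left hpos.ne'

end CYData

/-! ### Vertices of a nonsingular polytope -/

/-- A family of `N` generators of `ℤ^N` has a dual basis. -/
theorem exists_dual {N : ℕ} (e : Fin N → Lat N) (h : AddSubgroup.closure (range e) = ⊤) :
    ∃ f : Fin N → Lat N, (∀ i j, f i ⬝ᵥ e j = if i = j then 1 else 0) ∧
      ∀ z, z = ∑ i, (f i ⬝ᵥ z) • e i := by
  have h1 : ∀ k : Fin N, ∃ c : Fin N → ℤ, ∑ i, c i • e i = Pi.single k 1 := by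
    intro k
    have : (Pi.single k 1 : Lat N) ∈ Submodule.span ℤ (range e) := by
      rw [← Submodule.mem_toAddSubgroup, Submodule.span_int_eq_addSubgroupClosure, h]
      trivial
    exact (Submodule.mem_span_range_iff_exists_fun ℤ).1 this
  choose C hC using h1
  set M : Matrix (Fin N) (Fin N) ℤ := Matrix.of e with hM
  have hCM : Matrix.of C * M = 1 := by
    ext k j
    have := congrFun (hC k) j
    simp only [Finset.sum_apply, Pi.smul_apply, smul_eq_mul] at this
    simp [Matrix.mul_apply, hM, this, Matrix.one_apply, Pi.single_apply, eq_comm]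
  have hMC : M * Matrix.of C = 1 := mul_eq_one_comm.1 hCM
  refine ⟨fun i k => C k i, fun i j => ?_, fun z => ?_⟩
  · have := congrFun (congrFun hMC j) i
    simp only [Matrix.mul_apply, hM, Matrix.of_apply, Matrix.one_apply] at this
    simp only [dotProduct, eq_comm (a := i)]
    rw [← this]
    exact Finset.sum_congr rfl fun _ _ => mul_comm _ _
  · have hz : z = ∑ k, z k • (Pi.single k 1 : Lat N) := by
      funext j
      simp [Finset.sum_apply, Pi.single_apply]
    conv_lhs => rw [hz]
    simp only [← hC, Finset.smul_sum, dotProduct, Finset.sum_smul, smul_smul]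
    rw [Finset.sum_comm]
    exact Finset.sum_congr rfl fun i _ => Finset.sum_congr rfl fun k _ => by rw [mul_comm]

namespace CYData

variable {N : ℕ} (D : CYData N)

/-- Basis vectors along the edges at the vertex `p`, the dual basis (which consists of the normals
of the facets through `p`), and points of `A` on the edges. -/
structure VertexChart (p : Lat N) where
  e : Fin N → Lat N
  f : Fin N → Lat N
  a : Fin N → Lat N
  κ : Fin N → ℕ
  p_mem : p ∈ D.A
  f_mem : ∀ i, f i ∈ D.normals
  dual : ∀ i j, f i ⬝ᵥ e j = if i = j then 1 else 0
  expand : ∀ z, z = ∑ i, (f i ⬝ᵥ z) • e i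
  f_p : ∀ i, f i ⬝ᵥ p = -1
  tight : ∀ u ∈ D.normals, ht u (latPt p) = 0 → ∃ i, u = f i
  κ_pos : ∀ i, 0 < κ i
  a_mem : ∀ i, a i ∈ D.A
  a_eq : ∀ i, a i = p + (κ i : ℤ) • e i

/-- Moving from p along such a z keeps all tight heights tight, hence stays in the face, which is a
single point. -/
theorem eq_zero_of_tight {p : Vec N} (hp : IsFace D.P {p}) {z : Vec N}
    (hz : ∀ u ∈ D.normals, ht u p = 0 → inner ℝ (latPt u) z = 0) : z = 0 := by
  have hpP : p ∈ D.P := hp.2.subset rfl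
  obtain ⟨δ, hδ, hmem⟩ := D.exists_add_smul_mem hpP fun u hu h0 => (hz u hu h0).ge
  have : p + δ • z ∈ ({p} : Set (Vec N)) := D.mem_of_isFace hp rfl hmem fun u hu h0 => by
    rw [ht_add_smul, h0, hz u hu h0]; simp
  simpa [hδ.ne'] using this

/-- An edge at a vertex is contained in a ray. -/
theorem edge_subset_ray {p : Vec N} (hp : IsFace D.P {p}) {E : Set (Vec N)}
    (hE : E ∈ edgesAt D.P p) :
    ∃ d : Vec N, vectorSpan ℝ E = Submodule.span ℝ {d} ∧ ∀ x ∈ E, ∃ c : ℝ, 0 ≤ c ∧ x = p + c • d := by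
  obtain ⟨hEf, hdim, hpE⟩ := hE
  obtain ⟨v, hspan⟩ : ∃ v : Vec N, vectorSpan ℝ E = Submodule.span ℝ {v} := by
    obtain ⟨v, -, hv⟩ := finrank_eq_one_iff'.1 hdim
    refine ⟨v, le_antisymm (fun w hw => ?_) ?_⟩
    · obtain ⟨c, hc⟩ := hv ⟨w, hw⟩
      exact Submodule.mem_span_singleton.2 ⟨c, by simpa using congrArg Subtype.val hc⟩
    · rw [Submodule.span_singleton_le_iff_mem]; exact v.2
  have hc : ∀ x ∈ E, ∃ c : ℝ, x = p + c • v := by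
    intro x hx
    have : x - p ∈ vectorSpan ℝ E := vsub_mem_vectorSpan ℝ hx hpE
    rw [hspan] at this
    obtain ⟨c, hc⟩ := Submodule.mem_span_singleton.1 this
    exact ⟨c, by rw [hc]; abel⟩
  have hEP : E ⊆ D.P := hEf.2.subset
  by_cases hpos : ∀ x ∈ E, ∃ c : ℝ, 0 ≤ c ∧ x = p + c • v
  · exact ⟨v, hspan, hpos⟩
  by_cases hneg : ∀ x ∈ E, ∃ c : ℝ, c ≤ 0 ∧ x = p + c • v
  · refine ⟨-v, ?_, fun x hx => ?_⟩
    · rw [hspan, ← Submodule.span_neg, neg_singleton]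
    · obtain ⟨c, hc, h⟩ := hneg x hx
      exact ⟨-c, by linarith, by simpa using h⟩
  exfalso
  push Not at hpos hneg
  obtain ⟨x, hx, hx'⟩ := hpos
  obtain ⟨y, hy, hy'⟩ := hneg
  obtain ⟨c, rfl⟩ := hc x hx
  obtain ⟨c', rfl⟩ := hc y hy
  have h1 : c < 0 := by
    by_contra h; exact hx' c (not_lt.1 h) rfl
  have h2 : 0 < c' := by
    by_contra h; exact hy' c' (not_lt.1 h) rfl
  -- With points of E on both sides of p, the functional exposing p must be constant along the line,
  -- and these points would be maximizers too.
  obtain ⟨l, hl⟩ := hp.2 hp.1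
  have hlp : p ∈ ({p} : Set (Vec N)) := rfl
  rw [hl] at hlp
  have h3 := hlp.2 _ (hEP hx)
  have h4 := hlp.2 _ (hEP hy)
  simp only [map_add, map_smul, smul_eq_mul] at h3 h4
  have h5 : l v = 0 := by nlinarith
  have : p + c • v ∈ ({p} : Set (Vec N)) := by
    rw [hl]
    refine ⟨hEP hx, fun z hz => ?_⟩
    simpa [h5] using hlp.2 z hz
  exact hx' 0 le_rfl (by simpa using this)

/-- The lattice points on an edge line are the multiples of one lattice vector, which points
along the edge. -/
theorem exists_edge_generator {p : Vec N} (hp : IsFace D.P {p}) {E : Set (Vec N)}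
    (hE : E ∈ edgesAt D.P p) :
    ∃ e : Lat N, (∀ z : Lat N, latPt z ∈ vectorSpan ℝ E → ∃ n : ℤ, z = n • e) ∧
      (latPt e ≠ 0 → ∀ x ∈ E, ∃ c : ℝ, 0 ≤ c ∧ x = p + c • latPt e) ∧
      (latPt e ≠ 0 → vectorSpan ℝ E = Submodule.span ℝ {latPt e}) := by
  obtain ⟨d, hd, hray⟩ := D.edge_subset_ray hp hE
  have hd0 : d ≠ 0 := by
    rintro rfl
    have := hE.2.1
    rw [polyDim, hd, Submodule.span_zero_singleton, finrank_bot] at this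
    exact zero_ne_one this
  obtain ⟨k, hk⟩ : ∃ k, d k ≠ 0 := by
    by_contra h; push Not at h
    exact hd0 (by ext i; simpa using h i)
  let G : AddSubgroup (Lat N) :=
    { carrier := {z | latPt z ∈ vectorSpan ℝ E}
      add_mem' := fun {a b} ha hb => by
        change latPt (a + b) ∈ vectorSpan ℝ E
        rw [latPt_add]; exact Submodule.add_mem _ ha hb
      zero_mem' := by
        change latPt (0 : Lat N) ∈ vectorSpan ℝ E
        rw [latPt_zero]; exact Submodule.zero_mem _
      neg_mem' := fun {a} ha => by
        change latPt (-a) ∈ vectorSpan ℝ E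
        rw [latPt_neg]; exact Submodule.neg_mem _ ha }
  have hG : ∀ z, z ∈ G ↔ latPt z ∈ vectorSpan ℝ E := fun z => Iff.rfl
  -- A coordinate in which the edge direction does not vanish embeds the group of lattice vectors
  -- along the edge into ℤ, so the group is cyclic. The sign of the generator is fixed at the end.
  let φ : G →+ ℤ := (Pi.evalAddMonoidHom (fun _ : Fin N => ℤ) k).comp G.subtype
  have hφ : Function.Injective φ := by
    rw [injective_iff_map_eq_zero]
    rintro ⟨z, hz⟩ h0
    have h1 : z k = 0 := h0
    rw [hG, hd] at hz
    obtain ⟨c, hc⟩ := Submodule.mem_span_singleton.1 hz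
    have h2 : c * d k = z k := by simpa [latPt] using congrArg (fun v : Vec N => v k) hc
    have h3 : c = 0 := by
      rw [h1] at h2; simpa [hk] using h2
    rw [h3, zero_smul, ← latPt_zero] at hc
    exact Subtype.ext (latPt_injective hc.symm)
  have : IsAddCyclic G := isAddCyclic_of_injective φ hφ
  obtain ⟨⟨g, hg⟩, hgen⟩ := IsAddCyclic.exists_generator (α := G)
  have hgen' : ∀ z : Lat N, latPt z ∈ vectorSpan ℝ E → ∃ n : ℤ, z = n • g := by
    intro z hz
    obtain ⟨n, hn⟩ := hgen ⟨z, hz⟩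
    exact ⟨n, (congrArg Subtype.val hn).symm⟩
  rw [hG, hd] at hg
  obtain ⟨c, hc⟩ := Submodule.mem_span_singleton.1 hg
  have key : ∀ e : Lat N, ∀ b : ℝ, 0 ≤ b → b • d = latPt e → latPt e ≠ 0 →
      (∀ x ∈ E, ∃ c : ℝ, 0 ≤ c ∧ x = p + c • latPt e) ∧
        vectorSpan ℝ E = Submodule.span ℝ {latPt e} := by
    intro e b hb hbe he
    have hb0 : b ≠ 0 := by rintro rfl; exact he (by rw [← hbe, zero_smul])
    refine ⟨fun x hx => ?_, ?_⟩
    · obtain ⟨c, hc, rfl⟩ := hray x hx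
      refine ⟨c / b, by positivity, ?_⟩
      rw [← hbe, smul_smul, div_mul_cancel₀ _ hb0]
    · rw [hd, ← hbe, Submodule.span_singleton_smul_eq (IsUnit.mk0 b hb0)]
  rcases le_total 0 c with hc0 | hc0
  · exact ⟨g, hgen', fun he => (key g c hc0 hc he).1, fun he => (key g c hc0 hc he).2⟩
  · have hc' : (-c) • d = latPt (-g) := by rw [neg_smul, hc, latPt_neg]
    refine ⟨-g, fun z hz => ?_, fun he => (key (-g) (-c) (by linarith) hc' he).1,
      fun he => (key (-g) (-c) (by linarith) hc' he).2⟩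
    obtain ⟨n, hn⟩ := hgen' z hz
    exact ⟨-n, by simpa using hn⟩

/-- The part of the tangent cone at `p` of total height one. -/
def coneSlice (p : Vec N) : Set (Vec N) :=
  {z | (∀ u ∈ D.normals, ht u p = 0 → 0 ≤ inner ℝ (latPt u) z) ∧
    inner ℝ (∑ u ∈ D.normals with ht u p = 0, latPt u) z = 1}

theorem convex_coneSlice (p : Vec N) : Convex ℝ (D.coneSlice p) := by
  intro x hx y hy a b ha hb hab
  refine ⟨fun u hu h0 => ?_, ?_⟩
  · rw [inner_add_right, inner_smul_right, inner_smul_right]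
    have := hx.1 u hu h0
    have := hy.1 u hu h0
    positivity
  · rw [inner_add_right, inner_smul_right, inner_smul_right, hx.2, hy.2]; linarith

/-- At a vertex the sum ℓ of the tight normals is positive on every nonzero vector of the tangent
cone, since otherwise all tight normals would vanish on that vector. Its minimum over the unit
vectors of the cone bounds the norm on the slice. -/
theorem isCompact_coneSlice {p : Vec N} (hp : IsFace D.P {p}) : IsCompact (D.coneSlice p) := by
  set ℓ := ∑ u ∈ D.normals with ht u p = 0, latPt u with hℓ
  set K : Set (Vec N) := {z | ∀ u ∈ D.normals, ht u p = 0 → 0 ≤ inner ℝ (latPt u) z} with hK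
  have hKc : IsClosed K := by
    simp only [hK, ofPred_forall]
    exact isClosed_iInter fun u => isClosed_iInter fun _ => isClosed_iInter fun _ =>
      isClosed_le continuous_const (by fun_prop)
  have hℓpos : ∀ z ∈ K, z ≠ 0 → 0 < inner ℝ ℓ z := by
    intro z hz hz0
    have hnn : ∀ u ∈ D.normals.filter (fun u => ht u p = 0), 0 ≤ inner ℝ (latPt u) z :=
      fun u hu => hz u (Finset.mem_filter.1 hu).1 (Finset.mem_filter.1 hu).2
    have hsum : inner ℝ ℓ z = ∑ u ∈ D.normals with ht u p = 0, inner ℝ (latPt u) z := by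
      rw [hℓ, sum_inner]
    rw [hsum]
    refine lt_of_le_of_ne (Finset.sum_nonneg hnn) fun h0 => hz0 ?_
    refine D.eq_zero_of_tight hp fun u hu h1 => ?_
    exact (Finset.sum_eq_zero_iff_of_nonneg hnn).1 h0.symm u (Finset.mem_filter.2 ⟨hu, h1⟩)
  have hclosed : IsClosed (D.coneSlice p) := by
    have : D.coneSlice p = K ∩ {z | inner ℝ ℓ z = 1} := rfl
    rw [this]
    exact hKc.inter (isClosed_eq (by fun_prop) continuous_const)
  refine Metric.isCompact_of_isClosed_isBounded hclosed ?_
  have hcomp : IsCompact (K ∩ Metric.sphere (0 : Vec N) 1) :=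
    (isCompact_sphere _ _).inter_left hKc
  have hscale : ∀ z ∈ D.coneSlice p, z ≠ 0 ∧ ‖z‖⁻¹ • z ∈ K ∩ Metric.sphere (0 : Vec N) 1 := by
    intro z hz
    have hz0 : z ≠ 0 := by
      rintro rfl
      have := hz.2
      simp at this
    refine ⟨hz0, fun u hu h0 => ?_, ?_⟩
    · rw [inner_smul_right]
      exact mul_nonneg (by positivity) (hz.1 u hu h0)
    · rw [mem_sphere_zero_iff_norm, norm_smul, norm_inv, norm_norm,
        inv_mul_cancel₀ (norm_ne_zero_iff.2 hz0)]
  rcases (K ∩ Metric.sphere (0 : Vec N) 1).eq_empty_or_nonempty with he | hne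
  · have : D.coneSlice p = ∅ := by
      refine eq_empty_of_forall_notMem fun z hz => ?_
      have := (hscale z hz).2
      rw [he] at this
      exact this
    rw [this]; exact Bornology.isBounded_empty
  · obtain ⟨z0, hz0, hmin⟩ := hcomp.exists_isMinOn hne
      (f := fun z => inner ℝ ℓ z) (by fun_prop)
    have hz0' : z0 ≠ 0 := by
      rintro rfl
      simpa using hz0.2
    have hc := hℓpos z0 hz0.1 hz0'
    refine (Metric.isBounded_closedBall (x := (0 : Vec N)) (r := (inner ℝ ℓ z0)⁻¹)).subset ?_
    intro z hz
    obtain ⟨hzne, hzK⟩ := hscale z hz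
    have h1 : inner ℝ ℓ z0 ≤ inner ℝ ℓ (‖z‖⁻¹ • z) := hmin hzK
    rw [inner_smul_right, hz.2, mul_one] at h1
    rw [mem_closedBall_zero_iff]
    exact (le_inv_comm₀ hc (norm_pos_iff.2 hzne)).1 h1

/-- Extreme rays of the tangent cone come from edges. -/
theorem exists_edge_of_mem_extremePoints {p : Vec N} (hp : IsFace D.P {p}) {z : Vec N}
    (hz : z ∈ (D.coneSlice p).extremePoints ℝ) :
    ∃ E ∈ edgesAt D.P p, ∃ δ > 0, p + (δ : ℝ) • z ∈ E := by
  have hpP : p ∈ D.P := hp.2.subset rfl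
  have hzQ : z ∈ D.coneSlice p := hz.1
  have hz0 : z ≠ 0 := by
    rintro rfl
    have := hzQ.2
    simp at this
  set T : Set (Lat N) := {u | ht u p = 0 ∧ inner ℝ (latPt u) z = 0} with hT
  set F : Set (Vec N) := {x | x ∈ D.P ∧ ∀ u ∈ D.normals, u ∈ T → ht u x = 0} with hF
  have hFace : IsFace D.P F := D.isFace_of_tight hpP fun u _ hu => hu.1
  have hpF : p ∈ F := ⟨hpP, fun u _ hu => hu.1⟩
  obtain ⟨δ, hδ, hmem⟩ := D.exists_add_smul_mem hpP hzQ.1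
  have hδF : p + δ • z ∈ F := ⟨hmem, fun u _ hu => by rw [ht_add_smul, hu.1, hu.2]; simp⟩
  refine ⟨F, ⟨hFace, ?_, hpF⟩, δ, hδ, hδF⟩
  have hspan : vectorSpan ℝ F = Submodule.span ℝ {z} := by
    apply le_antisymm
    · rw [vectorSpan_eq_span_vsub_set_right ℝ hpF, Submodule.span_le]
      rintro _ ⟨x, hx, rfl⟩
      set ℓ := ∑ u ∈ D.normals with ht u p = 0, latPt u with hℓ
      -- The part of x - p of total height zero. The tight normals that vanish on z vanish on y as
      -- well, so z ± s y stay in the slice for small s, and extremality of z gives y = 0: the face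
      -- is one-dimensional.
      set y := (x - p) - inner ℝ ℓ (x - p) • z with hy
      have hyT : ∀ u ∈ D.normals, ht u p = 0 → inner ℝ (latPt u) z = 0 →
          inner ℝ (latPt u) y = 0 := by
        intro u hu h0 h1
        have h2 := hx.2 u hu ⟨h0, h1⟩
        unfold ht at h0 h2
        rw [hy, inner_sub_right, inner_smul_right, h1, inner_sub_right]
        linarith
      have hyℓ : inner ℝ ℓ y = 0 := by
        rw [hy, inner_sub_right, inner_smul_right, hzQ.2]; ring
      have key : ∀ y' : Vec N, (∀ u ∈ D.normals, ht u p = 0 → inner ℝ (latPt u) z = 0 →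
          inner ℝ (latPt u) y' = 0) → ∀ᶠ s : ℝ in 𝓝[>] 0, ∀ u ∈ D.normals, ht u p = 0 →
            0 ≤ inner ℝ (latPt u) (z + s • y') := by
        intro y' hy'
        rw [Filter.eventually_all_finset]
        intro u hu
        by_cases h0 : ht u p = 0
        swap
        · exact Filter.Eventually.of_forall fun _ h => absurd h h0
        rcases (hzQ.1 u hu h0).eq_or_lt with h | h
        · refine Filter.Eventually.of_forall fun s _ => ?_
          rw [inner_add_right, inner_smul_right, ← h, hy' u hu h0 h.symm]; simp
        · have hc : Continuous fun s : ℝ => inner ℝ (latPt u) (z + s • y') := by fun_prop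
          have := hc.tendsto 0
          simp only [zero_smul, add_zero] at this
          filter_upwards [(this.eventually (lt_mem_nhds h)).filter_mono nhdsWithin_le_nhds]
            with s hs _ using hs.le
      obtain ⟨s, ⟨h1, h2⟩, hs⟩ := (((key y hyT).and (key (-y) fun u hu h0 h1 => by
        rw [inner_neg_right, hyT u hu h0 h1, neg_zero])).and self_mem_nhdsWithin).exists
      have hs : 0 < s := hs
      have hq1 : z + s • y ∈ D.coneSlice p := ⟨h1, by
        rw [inner_add_right, inner_smul_right, hyℓ, hzQ.2]; simp⟩
      have hq2 : z + s • (-y) ∈ D.coneSlice p := ⟨h2, by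
        rw [inner_add_right, inner_smul_right, inner_neg_right, hyℓ, hzQ.2]; simp⟩
      have hseg : z ∈ openSegment ℝ (z + s • y) (z + s • (-y)) :=
        ⟨1/2, 1/2, by norm_num, by norm_num, by norm_num, by module⟩
      have hz1 := hz.2 hq1 hq2 hseg
      have hy0 : y = 0 := by simpa [hs.ne'] using hz1
      rw [hy, sub_eq_zero] at hy0
      exact Submodule.mem_span_singleton.2 ⟨_, hy0.symm⟩
    · rw [Submodule.span_singleton_le_iff_mem]
      have h1 := vsub_mem_vectorSpan ℝ hδF hpF
      simp only [vsub_eq_sub, add_sub_cancel_left] at h1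
      have := Submodule.smul_mem _ δ⁻¹ h1
      rwa [smul_smul, inv_mul_cancel₀ hδ.ne', one_smul] at this
  rw [polyDim, hspan, finrank_span_singleton hz0]

/-- The tangent cone at a vertex is generated by the edges. -/
theorem nonneg_of_nonneg_edges {p : Vec N} (hp : IsFace D.P {p}) (g : Vec N)
    (hg : ∀ E ∈ edgesAt D.P p, ∀ x ∈ E, 0 ≤ inner ℝ g (x - p)) {z : Vec N}
    (hz : ∀ u ∈ D.normals, ht u p = 0 → 0 ≤ inner ℝ (latPt u) z) : 0 ≤ inner ℝ g z := by
  set ℓ := ∑ u ∈ D.normals with ht u p = 0, latPt u with hℓ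
  have hsub : D.coneSlice p ⊆ {y | 0 ≤ inner ℝ g y} := by
    -- Krein–Milman reduces the inequality to extreme points of the slice, which lie along edges.
    -- The general vector of the cone is zero or a positive multiple of one in the slice.
    rw [← closure_convexHull_extremePoints (D.isCompact_coneSlice hp) (D.convex_coneSlice p)]
    refine closure_minimal (convexHull_min ?_ ?_)
      (isClosed_le continuous_const (by fun_prop))
    · intro y hy
      obtain ⟨E, hE, δ, hδ, hmem⟩ := D.exists_edge_of_mem_extremePoints hp hy
      have := hg E hE _ hmem
      rw [add_sub_cancel_left, inner_smul_right] at this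
      exact nonneg_of_mul_nonneg_right this hδ
    · intro a ha b hb s t hs ht' _
      simp only [mem_ofPred_eq, inner_add_right, inner_smul_right] at *
      positivity
  have hnn : ∀ u ∈ D.normals.filter (fun u => ht u p = 0), 0 ≤ inner ℝ (latPt u) z :=
    fun u hu => hz u (Finset.mem_filter.1 hu).1 (Finset.mem_filter.1 hu).2
  have hsum : inner ℝ ℓ z = ∑ u ∈ D.normals with ht u p = 0, inner ℝ (latPt u) z := by
    rw [hℓ, sum_inner]
  rcases (Finset.sum_nonneg hnn).eq_or_lt with h | h
  · have : z = 0 := D.eq_zero_of_tight hp fun u hu h1 =>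
      (Finset.sum_eq_zero_iff_of_nonneg hnn).1 h.symm u (Finset.mem_filter.2 ⟨hu, h1⟩)
    simp [this]
  · rw [← hsum] at h
    have hmem : (inner ℝ ℓ z)⁻¹ • z ∈ D.coneSlice p := by
      refine ⟨fun u hu h0 => ?_, ?_⟩
      · rw [inner_smul_right]
        exact mul_nonneg (by positivity) (hz u hu h0)
      · rw [inner_smul_right, ← hℓ, inv_mul_cancel₀ h.ne']
    have := hsub hmem
    simp only [mem_ofPred_eq, inner_smul_right] at this
    exact nonneg_of_mul_nonneg_right this (by positivity)

theorem latPt_mem_vectorSpan_edge {p z : Lat N} {E : Set (Vec N)} (hE : E ∈ edgesAt D.P (latPt p))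
    (hz : latPt (p + z) ∈ E) : latPt z ∈ vectorSpan ℝ E := by
  have := vsub_mem_vectorSpan ℝ hz hE.2.2
  rwa [vsub_eq_sub, latPt_add, add_sub_cancel_left] at this

/-- The N edge generators span ℤ^N and so have an integral dual basis. Because the tangent cone is
generated by the edges, each dual vector is a multiple of a tight normal; because tight normals take
the value -1 at p, the multiple is 1. This is where reflexivity and nonsingularity together give
unimodular charts. -/
theorem exists_vertexChart (hN : 1 ≤ N) {p : Lat N} (hp : IsFace D.P {latPt p}) (hpA : p ∈ D.A) :
    Nonempty (D.VertexChart p) := by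
  classical
  obtain ⟨hcard, hgen⟩ := D.nonsingular p hp
  have hpP : latPt p ∈ D.P := hp.2.subset rfl
  have hfin : (edgesAt D.P (latPt p)).Finite := by
    refine finite_of_ncard_ne_zero ?_
    omega
  have : Finite (edgesAt D.P (latPt p)) := hfin
  let ι : edgesAt D.P (latPt p) ≃ Fin N :=
    Finite.equivFinOfCardEq ((Nat.card_coe_set_eq _).trans hcard)
  choose e' he'gen he'ray he'span using fun E : edgesAt D.P (latPt p) =>
    D.exists_edge_generator hp E.2
  set e : Fin N → Lat N := fun i => e' (ι.symm i) with he
  have hclos : AddSubgroup.closure (range e) = ⊤ := by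
    rw [eq_top_iff, ← hgen, AddSubgroup.closure_le]
    rintro z ⟨E, hE, hz⟩
    obtain ⟨n, rfl⟩ := he'gen ⟨E, hE⟩ z (D.latPt_mem_vectorSpan_edge hE hz)
    have : e' ⟨E, hE⟩ ∈ range e := ⟨ι ⟨E, hE⟩, by simp [he]⟩
    exact AddSubgroup.zsmul_mem _ (AddSubgroup.subset_closure this) n
  obtain ⟨f, hdual, hexp⟩ := exists_dual e hclos
  have he0 : ∀ i, latPt (e i) ≠ 0 := by
    intro i h
    rw [← latPt_zero] at h
    have h1 := hdual i i
    rw [latPt_injective h] at h1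
    simp at h1
  have hray : ∀ i, ∀ x ∈ (ι.symm i : Set (Vec N)), ∃ c : ℝ, 0 ≤ c ∧ x = latPt p + c • latPt (e i) :=
    fun i => he'ray (ι.symm i) (he0 i)
  have hspan : ∀ i, vectorSpan ℝ (ι.symm i : Set (Vec N)) = Submodule.span ℝ {latPt (e i)} :=
    fun i => he'span (ι.symm i) (he0 i)
  -- points of `A` on the edges
  have ha : ∀ i, ∃ a ∈ D.A, ∃ k : ℕ, 0 < k ∧ a = p + (k : ℤ) • e i := by
    intro i
    have hE := (ι.symm i).2
    set E : Set (Vec N) := (ι.symm i : Set (Vec N)) with hEdef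
    obtain ⟨x, hx, hxp⟩ : ∃ x ∈ E, x ≠ latPt p := by
      by_contra h
      push Not at h
      have : E = {latPt p} := Subset.antisymm h (singleton_subset_iff.2 hE.2.2)
      have h2 := hE.2.1
      rw [this, polyDim, vectorSpan_singleton] at h2
      simp at h2
    have hxP : x ∈ D.P := hE.1.2.subset hx
    rw [← D.hull] at hxP
    by_contra hno
    push Not at hno
    -- If A met the edge only in p, a second point x of the edge, written as a convex combination of
    -- points of A, would use only points of A on the edge, and so equal p.
    have hAE : ∀ a ∈ D.A, latPt a ∈ E → a = p := by
      intro a ha haE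
      have h1 : latPt (p + (a - p)) ∈ E := by rwa [add_sub_cancel]
      obtain ⟨n, hn⟩ := he'gen (ι.symm i) (a - p) (D.latPt_mem_vectorSpan_edge hE h1)
      obtain ⟨c, hc, hc'⟩ := hray i _ haE
      have h2 : c = n := by
        have h3 : latPt (a - p) = c • latPt (e i) := by rw [latPt_sub, hc']; abel
        rw [hn, show e' (ι.symm i) = e i from rfl, latPt_zsmul] at h3
        exact (smul_left_injective ℝ (he0 i) h3).symm
      have hn0 : 0 ≤ n := by rw [h2] at hc; exact_mod_cast hc
      lift n to ℕ using hn0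
      rcases Nat.eq_zero_or_pos n with rfl | hpos
      · simpa [sub_eq_zero] using hn
      · exact absurd (by rw [← show e' (ι.symm i) = e i from rfl, ← hn]; abel) (hno a ha n hpos)
    obtain ⟨κ, _, w, g, hw0, hw1, hgA, hsum⟩ := mem_convexHull_iff_exists_fintype.1 hxP
    have hgp : ∀ j, 0 < w j → g j = latPt p := by
      intro j hj
      obtain ⟨a, haA, ha⟩ := hgA j
      rw [← ha]
      congr 1
      refine hAE a haA (D.mem_of_isFace hE.1 hx (D.latPt_mem haA) fun u hu h0 => ?_)
      rw [ha]
      refine D.ht_eq_zero_of_sum hu (s := Finset.univ) (w := w) (f := g) ?_ (fun j _ => hw0 j) hw1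
        (by rw [hsum]; exact h0) (Finset.mem_univ j) hj
      intro j _
      obtain ⟨b, hb, hb'⟩ := hgA j
      rw [← hb']; exact D.latPt_mem hb
    apply hxp
    rw [← hsum, ← one_smul ℝ (latPt p), ← hw1, Finset.sum_smul]
    refine Finset.sum_congr rfl fun j _ => ?_
    rcases (hw0 j).eq_or_lt with h | h
    · rw [← h]; simp
    · rw [hgp j h]
  choose a haA κ hκ haeq using ha
  have hue : ∀ u ∈ D.normals, ht u (latPt p) = 0 → ∀ i, 0 ≤ u ⬝ᵥ e i := by
    intro u hu h0 i
    have h1 := D.ht_nonneg (D.latPt_mem (haA i)) hu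
    rw [haeq, ht_latPt] at h1
    rw [ht_latPt] at h0
    have h1' : (0 : ℤ) ≤ 1 + u ⬝ᵥ (p + (κ i : ℤ) • e i) := by exact_mod_cast h1
    have h0' : 1 + u ⬝ᵥ p = 0 := by exact_mod_cast h0
    rw [dotProduct_add, dotProduct_smul, smul_eq_mul] at h1'
    have h2 : (0 : ℤ) ≤ κ i * (u ⬝ᵥ e i) := by linarith
    exact nonneg_of_mul_nonneg_right h2 (by exact_mod_cast hκ i)
  have hexpu : ∀ u : Lat N, u = ∑ i, (u ⬝ᵥ e i) • f i := by
    intro u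
    have key : ∀ z, u ⬝ᵥ z = (∑ i, (u ⬝ᵥ e i) • f i) ⬝ᵥ z := by
      intro z
      conv_lhs => rw [hexp z]
      rw [dotProduct_sum, sum_dotProduct]
      refine Finset.sum_congr rfl fun i _ => ?_
      rw [dotProduct_smul, smul_dotProduct, smul_eq_mul, smul_eq_mul, mul_comm]
    funext k
    simpa using key (Pi.single k 1)
  -- the dual basis consists of normals
  have hf : ∀ i, f i ∈ D.normals ∧ ht (f i) (latPt p) = 0 := by
    intro i
    -- M is so large that a tight normal negative on z = M ∑_{k≠i} e_k - e_i must vanish on all e_k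
    -- with k ≠ i. Since f_i takes the value -1 on z, the vector z is outside the tangent cone and
    -- such a normal exists.
    obtain ⟨M, hM0, hM⟩ : ∃ M : ℤ, 0 < M ∧ ∀ u ∈ D.normals, u ⬝ᵥ e i < M := by
      obtain ⟨M, hM⟩ := (D.normals.image fun u => u ⬝ᵥ e i).bddAbove
      refine ⟨max M 0 + 1, by positivity, fun u hu => ?_⟩
      have := hM (Finset.mem_coe.2 (Finset.mem_image_of_mem _ hu))
      have := le_max_left M 0
      omega
    set z : Lat N := (M • ∑ k ∈ Finset.univ.erase i, e k) - e i with hz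
    have hfz : inner ℝ (latPt (f i)) (latPt z) = -1 := by
      rw [inner_latPt, hz, dotProduct_sub, dotProduct_smul, dotProduct_sum, hdual i i,
        Finset.sum_eq_zero fun k hk => by rw [hdual, if_neg (Finset.ne_of_mem_erase hk).symm]]
      simp
    have hnot : ¬ ∀ u ∈ D.normals, ht u (latPt p) = 0 → 0 ≤ inner ℝ (latPt u) (latPt z) := by
      intro hcon
      have := D.nonneg_of_nonneg_edges hp (latPt (f i)) (fun E hE x hx => by
        obtain ⟨c, hc, hxc⟩ := hray (ι ⟨E, hE⟩) x (by simpa using hx)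
        rw [hxc, add_sub_cancel_left, inner_smul_right, inner_latPt, hdual]
        split_ifs <;> simp [hc]) hcon
      rw [hfz] at this
      norm_num at this
    push Not at hnot
    obtain ⟨u, hu, h0, hneg⟩ := hnot
    rw [inner_latPt, hz, dotProduct_sub, dotProduct_smul, dotProduct_sum, smul_eq_mul] at hneg
    have hneg' : M * ∑ k ∈ Finset.univ.erase i, u ⬝ᵥ e k - u ⬝ᵥ e i < 0 := by exact_mod_cast hneg
    have hnn : ∀ k ∈ Finset.univ.erase i, 0 ≤ u ⬝ᵥ e k := fun k _ => hue u hu h0 k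
    have hs0 : ∑ k ∈ Finset.univ.erase i, u ⬝ᵥ e k = 0 := by
      have h1 := Finset.sum_nonneg hnn
      have h2 := hM u hu
      nlinarith
    have hz' := (Finset.sum_eq_zero_iff_of_nonneg hnn).1 hs0
    have hui : u = (u ⬝ᵥ e i) • f i := by
      conv_lhs => rw [hexpu u]
      refine Finset.sum_eq_single i (fun k _ hk => ?_) (by simp)
      rw [hz' k (Finset.mem_erase.2 ⟨hk, Finset.mem_univ _⟩), zero_smul]
    have hup : u ⬝ᵥ p = -1 := by
      rw [ht_latPt] at h0
      have : 1 + u ⬝ᵥ p = 0 := by exact_mod_cast h0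
      linarith
    -- Evaluating u = (u·e_i) f_i at p shows that u·e_i divides -1 in ℤ; it is nonnegative, hence 1.
    have hu1 : u ⬝ᵥ e i = 1 := by
      have h1 := hue u hu h0 i
      have h2 : (u ⬝ᵥ e i) * (f i ⬝ᵥ p) = -1 := by
        rw [← smul_eq_mul, ← smul_dotProduct, ← hui, hup]
      have h3 : IsUnit (u ⬝ᵥ e i) :=
        IsUnit.of_mul_eq_one (-(f i ⬝ᵥ p)) (by rw [mul_neg, h2, neg_neg])
      rcases Int.isUnit_iff.1 h3 with h | h <;> omega
    rw [hu1, one_smul] at hui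
    exact hui ▸ ⟨hu, h0⟩
  have hfp : ∀ i, f i ⬝ᵥ p = -1 := by
    intro i
    have h0 := (hf i).2
    rw [ht_latPt] at h0
    have : 1 + f i ⬝ᵥ p = 0 := by exact_mod_cast h0
    linarith
  refine ⟨⟨e, f, a, κ, hpA, fun i => (hf i).1, hdual, hexp, hfp, fun u hu h0 => ?_, hκ, haA, haeq⟩⟩
  have hup : u ⬝ᵥ p = -1 := by
    rw [ht_latPt] at h0
    have : 1 + u ⬝ᵥ p = 0 := by exact_mod_cast h0
    linarith
  -- Since every f_i is -1 at p, so is p = -∑ e_i; a tight normal therefore has nonnegative integer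
  -- values on the e_i with sum 1, and is one of the f_i.
  have hsum : ∑ i, u ⬝ᵥ e i = 1 := by
    have h1 : u ⬝ᵥ p = -∑ i, u ⬝ᵥ e i := by
      conv_lhs => rw [hexp p]
      simp [dotProduct_sum, hfp]
    linarith
  obtain ⟨i, -, hi⟩ := Finset.exists_ne_zero_of_sum_ne_zero (s := Finset.univ)
    (f := fun i => u ⬝ᵥ e i) (by rw [hsum]; exact one_ne_zero)
  have hi1 : 1 ≤ u ⬝ᵥ e i := by
    have := hue u hu h0 i
    have hi : u ⬝ᵥ e i ≠ 0 := hi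
    omega
  have hsplit := Finset.add_sum_erase Finset.univ (fun i => u ⬝ᵥ e i) (Finset.mem_univ i)
  rw [hsum] at hsplit
  have hnn : ∀ k ∈ Finset.univ.erase i, 0 ≤ u ⬝ᵥ e k := fun k _ => hue u hu h0 k
  have hs := Finset.sum_nonneg hnn
  have hs0 : ∑ k ∈ Finset.univ.erase i, u ⬝ᵥ e k = 0 := by linarith
  have hz' := (Finset.sum_eq_zero_iff_of_nonneg hnn).1 hs0
  refine ⟨i, ?_⟩
  conv_lhs => rw [hexpu u]
  rw [Finset.sum_eq_single i (fun k _ hk => by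
    rw [hz' k (Finset.mem_erase.2 ⟨hk, Finset.mem_univ _⟩), zero_smul]) (by simp)]
  rw [show u ⬝ᵥ e i = 1 by linarith, one_smul]

/-- Every face contains a vertex with an adapted chart. -/
theorem exists_vertexChart_of_mem (hN : 1 ≤ N) {q : Vec N} (hq : q ∈ D.P) :
    ∃ p : Lat N, Nonempty (D.VertexChart p) ∧
      ∀ u ∈ D.normals, ht u q = 0 → ht u (latPt p) = 0 := by
  set F := minFace D.P {q} with hF
  have hFace : IsFace D.P F := D.isFace_minFace (singleton_nonempty q) (singleton_subset_iff.2 hq)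
  have hFc : IsCompact F := hFace.2.isCompact D.isCompact_P
  obtain ⟨x, hx⟩ := hFc.extremePoints_nonempty hFace.1
  -- Extreme points of a face are extreme in P, and extreme points of the hull of A belong to A;
  -- this produces a vertex that is a lattice point of A.
  have hxP : x ∈ D.P.extremePoints ℝ := by
    have := hFace.2.isExtreme.extremePoints_eq
    rw [this] at hx
    exact hx.2
  obtain ⟨p, hpA, rfl⟩ : x ∈ latPt '' (D.A : Set (Lat N)) := by
    have := hxP
    rw [← D.hull] at this
    exact extremePoints_convexHull_subset this
  have hpF : IsFace D.P {latPt p} := by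
    have h1 := D.isFace_of_tight (U := {u | ht u (latPt p) = 0}) hxP.1 fun u _ hu => hu
    convert h1 using 1
    refine Subset.antisymm (singleton_subset_iff.2 ⟨hxP.1, fun u _ hu => hu⟩) ?_
    rintro y ⟨hy, hy0⟩
    obtain ⟨δ, hδ, hmem⟩ := D.exists_add_smul_mem (z := latPt p - y) hxP.1 fun u hu h0 => by
      have h1 := hy0 u hu h0
      unfold ht at h0 h1
      rw [inner_sub_right]; linarith
    have hseg : latPt p ∈ openSegment ℝ y (latPt p + δ • (latPt p - y)) := by
      refine ⟨δ / (1 + δ), 1 / (1 + δ), by positivity, by positivity, by field_simp; ring, ?_⟩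
      have : (1 + δ) ≠ 0 := by positivity
      rw [← sub_eq_zero]
      match_scalars <;> field_simp <;> ring
    exact hxP.2 hy hmem hseg
  exact ⟨p, D.exists_vertexChart hN hpF hpA, ((D.mem_minFace_singleton hq).1 hx.1).2⟩

end CYData

/-! ### Weights of the moment map -/

namespace CYData

variable {N : ℕ} (D : CYData N)

/-- The logarithm of the term of the moment map belonging to `ω`, in the logarithmic
coordinates `ξ`; the parameter `L` is `log |t|`. -/
noncomputable def expo (L : ℝ) (ξ : Vec N) (ω : Lat N) : ℝ :=
  L * D.lam ω + inner ℝ (latPt ω) ξ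

/-- The denominator of the moment map. -/
noncomputable def part (L : ℝ) (ξ : Vec N) : ℝ := ∑ ω : D.A, Real.exp (D.expo L ξ ω)

/-- The weights of the points of `A` in the moment map. -/
noncomputable def wt (L : ℝ) (ξ : Vec N) (ω : D.A) : ℝ :=
  Real.exp (D.expo L ξ ω) / D.part L ξ

/-- The combination of the points of `A` with given weights. -/
noncomputable def bary (w : D.A → ℝ) : Vec N := ∑ ω, w ω • latPt (ω : Lat N)

theorem continuous_bary : Continuous D.bary := by
  unfold bary; fun_prop

theorem bary_add (a b : D.A → ℝ) : D.bary (a + b) = D.bary a + D.bary b := by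
  simp [bary, add_smul, Finset.sum_add_distrib]

theorem bary_smul (c : ℝ) (a : D.A → ℝ) : D.bary (c • a) = c • D.bary a := by
  simp [bary, Finset.smul_sum, smul_smul]

theorem bary_sub (a b : D.A → ℝ) : D.bary (a - b) = D.bary a - D.bary b := by
  simp [bary, sub_smul, Finset.sum_sub_distrib]

theorem bary_single [DecidableEq D.A] (ω : D.A) (c : ℝ) :
    D.bary (Pi.single ω c) = c • latPt (ω : Lat N) := by
  rw [bary, Finset.sum_eq_single ω] <;> simp +contextual

theorem inner_bary (w : D.A → ℝ) (z : Vec N) :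
    inner ℝ (D.bary w) z = ∑ ω, w ω * inner ℝ (latPt (ω : Lat N)) z := by
  simp [bary, sum_inner, inner_smul_left]

theorem ht_bary (u : Lat N) {w : D.A → ℝ} (hw : w ∈ stdSimplex ℝ D.A) :
    ht u (D.bary w) = ∑ ω, w ω * ht u (latPt (ω : Lat N)) := ht_sum _ _ _ _ hw.2

theorem bary_mem_P {w : D.A → ℝ} (hw : w ∈ stdSimplex ℝ D.A) : D.bary w ∈ D.P :=
  D.convex_P.sum_mem (fun ω _ => hw.1 ω) hw.2 fun ω _ => D.latPt_mem ω.2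

theorem exists_bary_eq {m : Vec N} (hm : m ∈ D.P) : ∃ w ∈ stdSimplex ℝ D.A, D.bary w = m := by
  classical
  have hconv : Convex ℝ (D.bary '' stdSimplex ℝ D.A) := by
    rintro _ ⟨a, ha, rfl⟩ _ ⟨b, hb, rfl⟩ s t hs ht hst
    exact ⟨s • a + t • b, convex_stdSimplex ℝ _ ha hb hs ht hst, by
      rw [bary_add, bary_smul, bary_smul]⟩
  have hsub : latPt '' (D.A : Set (Lat N)) ⊆ D.bary '' stdSimplex ℝ D.A := by
    rintro _ ⟨ω, hω, rfl⟩
    exact ⟨Pi.single ⟨ω, hω⟩ 1, single_mem_stdSimplex ℝ _, by rw [bary_single, one_smul]⟩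
  rw [← D.hull] at hm
  exact convexHull_min hsub hconv hm

theorem part_pos (L : ℝ) (ξ : Vec N) : 0 < D.part L ξ :=
  Finset.sum_pos (fun _ _ => Real.exp_pos _) ⟨⟨0, D.zero_mem⟩, Finset.mem_univ _⟩

theorem wt_pos (L : ℝ) (ξ : Vec N) (ω : D.A) : 0 < D.wt L ξ ω :=
  div_pos (Real.exp_pos _) (D.part_pos L ξ)

theorem wt_mem (L : ℝ) (ξ : Vec N) : D.wt L ξ ∈ stdSimplex ℝ D.A := by
  refine ⟨fun ω => (D.wt_pos L ξ ω).le, ?_⟩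
  simp only [wt, ← Finset.sum_div]
  exact div_self (D.part_pos L ξ).ne'

theorem log_wt (L : ℝ) (ξ : Vec N) (ω : D.A) :
    Real.log (D.wt L ξ ω) = D.expo L ξ ω - Real.log (D.part L ξ) := by
  rw [wt, Real.log_div (Real.exp_pos _).ne' (D.part_pos L ξ).ne', Real.log_exp]

theorem expo_le_log_part (L : ℝ) (ξ : Vec N) {ω : Lat N} (hω : ω ∈ D.A) :
    D.expo L ξ ω ≤ Real.log (D.part L ξ) := by
  rw [Real.le_log_iff_exp_le (D.part_pos L ξ)]
  exact Finset.single_le_sum (f := fun ω : D.A => Real.exp (D.expo L ξ ω))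
    (fun _ _ => (Real.exp_pos _).le) (Finset.mem_univ (⟨ω, hω⟩ : D.A))

theorem continuous_part (L : ℝ) : Continuous (D.part L) := by
  unfold part expo; fun_prop

theorem continuous_log_part (L : ℝ) : Continuous fun ξ => Real.log (D.part L ξ) :=
  (D.continuous_part L).log fun ξ => (D.part_pos L ξ).ne'

/-- The moment map is the gradient of the logarithm of the partition function. Both surjectivity
onto the interior and the existence of tips of normal cones use this through minimization. -/
theorem hasDerivAt_log_part (L : ℝ) (ξ z : Vec N) :
    HasDerivAt (fun s : ℝ => Real.log (D.part L (ξ + s • z))) (inner ℝ (D.bary (D.wt L ξ)) z) 0 := by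
  have h1 : ∀ ω : D.A, HasDerivAt (fun s : ℝ => Real.exp (D.expo L (ξ + s • z) ω))
      (Real.exp (D.expo L ξ ω) * inner ℝ (latPt (ω : Lat N)) z) 0 := by
    intro ω
    have h2 : HasDerivAt (fun s : ℝ => D.expo L (ξ + s • z) ω) (inner ℝ (latPt (ω : Lat N)) z) 0 := by
      have : (fun s : ℝ => D.expo L (ξ + s • z) ω) =
          fun s : ℝ => D.expo L ξ ω + s * inner ℝ (latPt (ω : Lat N)) z := by
        funext s; simp [expo, inner_add_right, inner_smul_right]; ring
      rw [this]
      simpa using ((hasDerivAt_id (0 : ℝ)).mul_const (inner ℝ (latPt (ω : Lat N)) z)).const_add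
        (D.expo L ξ ω)
    simpa using h2.exp
  have h3 : HasDerivAt (fun s : ℝ => D.part L (ξ + s • z))
      (∑ ω : D.A, Real.exp (D.expo L ξ ω) * inner ℝ (latPt (ω : Lat N)) z) 0 := by
    unfold part
    exact HasDerivAt.fun_sum fun ω _ => h1 ω
  have h4 := h3.log (by simpa using (D.part_pos L ξ).ne')
  convert h4 using 1
  rw [inner_bary, Finset.sum_div]
  simp only [zero_smul, add_zero, wt]
  exact Finset.sum_congr rfl fun ω _ => by ring

theorem sub_mul_log_sub_log_nonneg {a b : ℝ} (ha : 0 < a) (hb : 0 < b) :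
    0 ≤ (a - b) * (Real.log a - Real.log b) := by
  rcases le_total a b with h | h
  · exact mul_nonneg_of_nonpos_of_nonpos (sub_nonpos.2 h) (sub_nonpos.2 (Real.log_le_log ha h))
  · exact mul_nonneg (sub_nonneg.2 h) (sub_nonneg.2 (Real.log_le_log hb h))

theorem eq_of_sub_mul_log_sub_log {a b : ℝ} (ha : 0 < a) (hb : 0 < b)
    (h : (a - b) * (Real.log a - Real.log b) = 0) : a = b := by
  rcases mul_eq_zero.1 h with h | h
  · exact sub_eq_zero.1 h
  · exact Real.log_injOn_pos ha hb (sub_eq_zero.1 h)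

theorem eq_zero_of_inner_latPt_eq_zero {d : Vec N}
    (h : ∀ ω ∈ D.A, inner ℝ (latPt ω) d = 0) : d = 0 := by
  obtain ⟨δ, hδ, hmem⟩ := D.exists_add_smul_mem (q := 0) (z := d) D.zero_mem_P
    fun u _ h0 => by rw [ht_zero] at h0; norm_num at h0
  obtain ⟨w, -, hw⟩ := D.exists_bary_eq hmem
  have h1 : inner ℝ (D.bary w) d = 0 := by
    rw [inner_bary]; exact Finset.sum_eq_zero fun ω _ => by rw [h ω ω.2, mul_zero]
  rw [hw, zero_add, inner_smul_left] at h1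
  simpa [hδ.ne'] using h1

/-- The moment map is strictly monotone. -/
theorem inner_sub_bary_wt_pos (L : ℝ) {ξ ξ' : Vec N} (h : ξ ≠ ξ') :
    0 < inner ℝ (D.bary (D.wt L ξ) - D.bary (D.wt L ξ')) (ξ - ξ') := by
  have key : inner ℝ (D.bary (D.wt L ξ) - D.bary (D.wt L ξ')) (ξ - ξ') =
      ∑ ω, (D.wt L ξ ω - D.wt L ξ' ω) * (Real.log (D.wt L ξ ω) - Real.log (D.wt L ξ' ω)) := by
    rw [← bary_sub, inner_bary]
    have h1 : ∑ ω, (D.wt L ξ ω - D.wt L ξ' ω) = 0 := by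
      rw [Finset.sum_sub_distrib, (D.wt_mem L ξ).2, (D.wt_mem L ξ').2, sub_self]
    -- The partition functions contribute a constant to the difference of logarithms, and a constant
    -- is killed because both weight vectors sum to 1.
    rw [← add_zero (Finset.sum _ _),
      ← mul_zero (Real.log (D.part L ξ') - Real.log (D.part L ξ)), ← h1, Finset.mul_sum,
      ← Finset.sum_add_distrib]
    refine Finset.sum_congr rfl fun ω _ => ?_
    rw [log_wt, log_wt, expo, expo, inner_sub_right, Pi.sub_apply]; ring
  rw [key]
  have hnn : ∀ ω ∈ Finset.univ, 0 ≤ (D.wt L ξ ω - D.wt L ξ' ω) *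
      (Real.log (D.wt L ξ ω) - Real.log (D.wt L ξ' ω)) := fun ω _ =>
    sub_mul_log_sub_log_nonneg (D.wt_pos L ξ ω) (D.wt_pos L ξ' ω)
  refine lt_of_le_of_ne (Finset.sum_nonneg hnn) fun h0 => h ?_
  have heq : ∀ ω, D.wt L ξ ω = D.wt L ξ' ω := fun ω =>
    eq_of_sub_mul_log_sub_log (D.wt_pos L ξ ω) (D.wt_pos L ξ' ω)
      ((Finset.sum_eq_zero_iff_of_nonneg hnn).1 h0.symm ω (Finset.mem_univ _))
  have hexp : ∀ ω : D.A, D.expo L ξ ω - Real.log (D.part L ξ) =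
      D.expo L ξ' ω - Real.log (D.part L ξ') := fun ω => by
    rw [← log_wt, ← log_wt, heq]
  have h0' := hexp ⟨0, D.zero_mem⟩
  simp only [expo, latPt_zero, inner_zero_left] at h0'
  refine sub_eq_zero.1 (D.eq_zero_of_inner_latPt_eq_zero fun ω hω => ?_)
  have := hexp ⟨ω, hω⟩
  simp only [expo] at this
  rw [inner_sub_right]; linarith

theorem wt_injective (L : ℝ) {ξ ξ' : Vec N} (h : D.bary (D.wt L ξ) = D.bary (D.wt L ξ')) :
    ξ = ξ' := by
  by_contra hne
  have := D.inner_sub_bary_wt_pos L hne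
  rw [h, sub_self, inner_zero_left] at this
  exact lt_irrefl _ this

/-- Coercivity: m moved a little in the direction of ξ is still a convex combination of points of A,
so at least one of them is as far out in that direction. -/
theorem exists_inner_ge {m : Vec N} (hm : m ∈ interior D.P) :
    ∃ η > 0, ∀ ξ, ∃ ω ∈ D.A, inner ℝ m ξ + (η : ℝ) * ‖ξ‖ ≤ inner ℝ (latPt ω) ξ := by
  obtain ⟨η, hη, hball⟩ := Metric.isOpen_iff.1 isOpen_interior m hm
  refine ⟨η / 2, by positivity, fun ξ => ?_⟩
  have hmem : m + (η / 2 * ‖ξ‖⁻¹) • ξ ∈ D.P := by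
    refine interior_subset (hball ?_)
    rw [mem_ball_iff_norm, add_sub_cancel_left, norm_smul, norm_mul, norm_inv, norm_norm, mul_assoc]
    have h1 : ‖ξ‖⁻¹ * ‖ξ‖ ≤ 1 := inv_mul_le_one
    rw [Real.norm_of_nonneg (by positivity)]
    nlinarith
  obtain ⟨w, hw, hwm⟩ := D.exists_bary_eq hmem
  by_contra hcon
  push Not at hcon
  have h1 : inner ℝ (D.bary w) ξ < inner ℝ m ξ + η / 2 * ‖ξ‖ := by
    rw [inner_bary, ← one_mul (inner ℝ m ξ + η / 2 * ‖ξ‖), ← hw.2, Finset.sum_mul]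
    obtain ⟨i, hi⟩ : ∃ i, 0 < w i := by
      by_contra h
      push Not at h
      have : ∑ i, w i = 0 := Finset.sum_eq_zero fun i _ => le_antisymm (h i) (hw.1 i)
      rw [hw.2] at this
      exact one_ne_zero this
    exact Finset.sum_lt_sum (fun ω _ => mul_le_mul_of_nonneg_left (hcon ω ω.2).le (hw.1 ω))
      ⟨i, Finset.mem_univ _, mul_lt_mul_of_pos_left (hcon i i.2) hi⟩
  rw [hwm, inner_add_left, inner_smul_left, real_inner_self_eq_norm_sq] at h1
  simp only [conj_trivial] at h1
  have h2 : η / 2 * ‖ξ‖⁻¹ * ‖ξ‖ ^ 2 = η / 2 * ‖ξ‖ := by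
    rcases eq_or_ne ‖ξ‖ 0 with h | h
    · simp [h]
    · field_simp
  linarith

/-- Interior points are values of the moment map. -/
theorem exists_bary_wt_eq (L : ℝ) {m : Vec N} (hm : m ∈ interior D.P) :
    ∃ ξ, D.bary (D.wt L ξ) = m := by
  obtain ⟨η, hη, hω⟩ := D.exists_inner_ge hm
  obtain ⟨C, hC⟩ := (D.A.image fun ω => -(L * (D.lam ω : ℝ))).bddAbove
  have hC : ∀ ω ∈ D.A, -C ≤ L * (D.lam ω : ℝ) := fun ω hω => by
    have := hC (Finset.mem_coe.2 (Finset.mem_image_of_mem _ hω))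
    linarith
  have hlow : ∀ ξ, -C + η * ‖ξ‖ ≤ Real.log (D.part L ξ) - inner ℝ m ξ := by
    intro ξ
    obtain ⟨ω, hωA, h⟩ := hω ξ
    have h1 := D.expo_le_log_part L ξ hωA
    have h2 := hC ω hωA
    rw [expo] at h1
    linarith
  have hcont : Continuous fun ξ => Real.log (D.part L ξ) - inner ℝ m ξ :=
    (D.continuous_log_part L).sub (by fun_prop)
  have htend : Filter.Tendsto (fun ξ => Real.log (D.part L ξ) - inner ℝ m ξ)
      (Filter.cocompact _) Filter.atTop := by
    refine Filter.tendsto_atTop_mono hlow ?_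
    exact Filter.tendsto_atTop_add_const_left _ _
      ((tendsto_norm_cocompact_atTop).const_mul_atTop hη)
  obtain ⟨ξ, hξ⟩ := hcont.exists_forall_le htend
  refine ⟨ξ, ?_⟩
  have hd : ∀ z, inner ℝ (D.bary (D.wt L ξ) - m) z = 0 := by
    intro z
    have h1 : HasDerivAt (fun s : ℝ => Real.log (D.part L (ξ + s • z)) - inner ℝ m (ξ + s • z))
        (inner ℝ (D.bary (D.wt L ξ) - m) z) 0 := by
      rw [inner_sub_left]
      refine (D.hasDerivAt_log_part L ξ z).sub ?_
      have : (fun s : ℝ => inner ℝ m (ξ + s • z)) = fun s : ℝ => inner ℝ m ξ + s * inner ℝ m z := by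
        funext s; rw [inner_add_right, inner_smul_right]
      rw [this]
      simpa using ((hasDerivAt_id (0 : ℝ)).mul_const (inner ℝ m z)).const_add (inner ℝ m ξ)
    refine IsLocalMin.hasDerivAt_eq_zero (Filter.Eventually.of_forall fun s => ?_) h1
    simpa using hξ (ξ + s • z)
  have := hd (D.bary (D.wt L ξ) - m)
  exact sub_eq_zero.1 (inner_self_eq_zero.1 this)

/-! ### Compactified moment map: weights of boundary points -/

/-- The closure of the weights of the moment map: the nonnegative part of the toric variety. -/
def toric (L : ℝ) : Set (D.A → ℝ) := closure (range (D.wt L))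

theorem toric_subset (L : ℝ) : D.toric L ⊆ stdSimplex ℝ D.A :=
  closure_minimal (range_subset_iff.2 fun ξ => D.wt_mem L ξ) (isClosed_stdSimplex ℝ _)

theorem isCompact_toric (L : ℝ) : IsCompact (D.toric L) :=
  (isCompact_stdSimplex ℝ D.A).of_isClosed_subset isClosed_closure (D.toric_subset L)

/-- The binomial relations between the weights. -/
theorem toric_rel {L : ℝ} {w : D.A → ℝ} (hw : w ∈ D.toric L) {a b : D.A → ℝ}
    (ha : ∀ ω, 0 ≤ a ω) (hb : ∀ ω, 0 ≤ b ω) (hsum : ∑ ω, a ω = ∑ ω, b ω)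
    (hbary : D.bary a = D.bary b) :
    ∏ ω, (w ω * Real.exp (-(L * D.lam ω))) ^ a ω = ∏ ω, (w ω * Real.exp (-(L * D.lam ω))) ^ b ω := by
  have hcont : ∀ c : D.A → ℝ, (∀ ω, 0 ≤ c ω) →
      Continuous fun w : D.A → ℝ => ∏ ω, (w ω * Real.exp (-(L * D.lam ω))) ^ c ω := fun c hc =>
    continuous_finsetProd _ fun ω _ => (Real.continuous_rpow_const (hc ω)).comp (by fun_prop)
  have hval : ∀ ξ, ∀ c : D.A → ℝ, ∏ ω, (D.wt L ξ ω * Real.exp (-(L * D.lam ω))) ^ c ω =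
      Real.exp (inner ℝ (D.bary c) ξ - (∑ ω, c ω) * Real.log (D.part L ξ)) := by
    intro ξ c
    rw [inner_bary, Finset.sum_mul, ← Finset.sum_sub_distrib, Real.exp_sum]
    refine Finset.prod_congr rfl fun ω _ => ?_
    have h1 : D.wt L ξ ω * Real.exp (-(L * D.lam ω)) =
        Real.exp (inner ℝ (latPt (ω : Lat N)) ξ - Real.log (D.part L ξ)) := by
      rw [← Real.exp_log (D.wt_pos L ξ ω), ← Real.exp_add, log_wt, expo]
      congr 1; ring
    rw [h1, ← Real.exp_mul]
    congr 1; ring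
  refine closure_minimal ?_ (isClosed_eq (hcont a ha) (hcont b hb)) hw
  rintro _ ⟨ξ, rfl⟩
  simp only [mem_ofPred_eq]
  rw [hval, hval, hsum, hbary]

/-- The support of w consists of all points of A on the minimal face of its mean. To see that ω on
this face has positive weight, move from the mean slightly away from ω to a point with weights b.
Then (1 + δ) w and b + δ·ω have equal totals and equal means, and the binomial relation equates a
positive product to one containing a positive power of w ω. -/
theorem toric_pos_iff {L : ℝ} {w : D.A → ℝ} (hw : w ∈ D.toric L) (ω : D.A) :
    0 < w ω ↔ ∀ u ∈ D.normals, ht u (D.bary w) = 0 → ht u (latPt (ω : Lat N)) = 0 := by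
  classical
  have hws := D.toric_subset L hw
  constructor
  · intro h u hu h0
    exact D.ht_eq_zero_of_sum hu (s := Finset.univ) (w := w)
      (f := fun ω : D.A => latPt (ω : Lat N)) (fun ω _ => D.latPt_mem ω.2) (fun ω _ => hws.1 ω)
      hws.2 h0 (Finset.mem_univ ω) h
  · intro h
    obtain ⟨δ, hδ, hmem⟩ := D.exists_add_smul_mem (z := D.bary w - latPt (ω : Lat N))
      (D.bary_mem_P hws) fun u hu h0 => by
        have h1 := h u hu h0
        unfold ht at h0 h1
        rw [inner_sub_right]; linarith
    obtain ⟨b, hb, hbm⟩ := D.exists_bary_eq hmem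
    have hs1 : ∑ ω', ((1 + δ) • w) ω' = ∑ ω', (b + Pi.single ω δ : D.A → ℝ) ω' := by
      simp only [Pi.smul_apply, smul_eq_mul, ← Finset.mul_sum, hws.2, Pi.add_apply,
        Finset.sum_add_distrib, hb.2, Finset.sum_pi_single', Finset.mem_univ, if_true, mul_one]
    have hs2 : D.bary ((1 + δ) • w) = D.bary (b + Pi.single ω δ) := by
      rw [bary_smul, bary_add, bary_single, hbm]; module
    have hsingle : ∀ ω', 0 ≤ (Pi.single ω δ : D.A → ℝ) ω' := fun ω' => by
      rw [Pi.single_apply]; split_ifs <;> simp [hδ.le]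
    have ha0 : ∀ ω', 0 ≤ ((1 + δ) • w) ω' := fun ω' => by
      rw [Pi.smul_apply, smul_eq_mul]; exact mul_nonneg (by positivity) (hws.1 ω')
    have hb0 : ∀ ω', 0 ≤ (b + Pi.single ω δ : D.A → ℝ) ω' := fun ω' => by
      rw [Pi.add_apply]; exact add_nonneg (hb.1 ω') (hsingle ω')
    have hrel := D.toric_rel hw ha0 hb0 hs1 hs2
    -- Zero weights carry the exponent zero here, and 0 ^ 0 = 1.
    have hpos : 0 < ∏ ω', (w ω' * Real.exp (-(L * D.lam ω'))) ^ ((1 + δ) • w) ω' := by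
      refine Finset.prod_pos fun ω' _ => ?_
      rcases (hws.1 ω').eq_or_lt with h0 | h0
      · simp [← h0]
      · exact Real.rpow_pos_of_pos (mul_pos h0 (Real.exp_pos _)) _
    rw [hrel] at hpos
    have hne := Finset.prod_ne_zero_iff.1 hpos.ne' ω (Finset.mem_univ _)
    refine lt_of_le_of_ne (hws.1 ω) fun h0 => hne ?_
    rw [← h0, zero_mul, Real.zero_rpow]
    have := hb.1 ω
    simp only [Pi.add_apply, Pi.single_eq_same]
    positivity

/-- This carries strict monotonicity to the boundary. The exponents in the binomial relations may be
real, so w and w' themselves are used as exponents; evaluating that relation at w and at w' and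
taking logarithms gives ∑ (w - w')(log w - log w') = 0. Equal means give equal supports, so the
terms with zero weight drop out. -/
theorem bary_injOn_toric (L : ℝ) : InjOn D.bary (D.toric L) := by
  intro w hw w' hw' h
  have hws := D.toric_subset L hw
  have hws' := D.toric_subset L hw'
  have hsupp : ∀ ω, 0 < w ω ↔ 0 < w' ω := fun ω => by
    rw [D.toric_pos_iff hw, D.toric_pos_iff hw', h]
  have hlog : ∀ v ∈ D.toric L, (∀ ω, 0 < w ω ↔ 0 < v ω) → ∀ c : D.A → ℝ,
      (∀ ω, 0 < c ω ↔ 0 < v ω) → (∀ ω, 0 ≤ c ω) →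
      Real.log (∏ ω, (v ω * Real.exp (-(L * D.lam ω))) ^ c ω) =
        ∑ ω, c ω * (Real.log (v ω) - L * D.lam ω) := by
    intro v hv _ c hc hc0
    have hv0 := (D.toric_subset L hv).1
    rw [Real.log_prod]
    · refine Finset.sum_congr rfl fun ω _ => ?_
      rcases (hv0 ω).eq_or_lt with h0 | h0
      · have : c ω = 0 := le_antisymm (not_lt.1 fun h1 => by
          rw [hc, ← h0] at h1; exact lt_irrefl _ h1) (hc0 ω)
        simp [this]
      · rw [Real.log_rpow (mul_pos h0 (Real.exp_pos _)), Real.log_mul h0.ne' (Real.exp_pos _).ne',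
          Real.log_exp]
        ring
    · intro ω _
      rcases (hv0 ω).eq_or_lt with h0 | h0
      · have : c ω = 0 := le_antisymm (not_lt.1 fun h1 => by
          rw [hc, ← h0] at h1; exact lt_irrefl _ h1) (hc0 ω)
        simp [this]
      · exact (Real.rpow_pos_of_pos (mul_pos h0 (Real.exp_pos _)) _).ne'
  have hsum : ∑ ω, w ω = ∑ ω, w' ω := by rw [hws.2, hws'.2]
  have h1 := congrArg Real.log (D.toric_rel hw hws.1 hws'.1 hsum h)
  have h2 := congrArg Real.log (D.toric_rel hw' hws.1 hws'.1 hsum h)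
  rw [hlog w hw (fun _ => Iff.rfl) w (fun _ => Iff.rfl) hws.1,
    hlog w hw (fun _ => Iff.rfl) w' (fun ω => (hsupp ω).symm) hws'.1] at h1
  rw [hlog w' hw' hsupp w hsupp hws.1, hlog w' hw' hsupp w' (fun _ => Iff.rfl) hws'.1] at h2
  have h3 : ∑ ω, (w ω - w' ω) * (Real.log (w ω) - Real.log (w' ω)) = 0 := by
    have : ∑ ω, (w ω - w' ω) * (Real.log (w ω) - Real.log (w' ω)) =
        (∑ ω, w ω * (Real.log (w ω) - L * D.lam ω) - ∑ ω, w' ω * (Real.log (w ω) - L * D.lam ω)) -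
        (∑ ω, w ω * (Real.log (w' ω) - L * D.lam ω) -
          ∑ ω, w' ω * (Real.log (w' ω) - L * D.lam ω)) := by
      simp only [← Finset.sum_sub_distrib]
      exact Finset.sum_congr rfl fun ω _ => by ring
    rw [this, h1, h2]; simp
  have hnn : ∀ ω ∈ Finset.univ, 0 ≤ (w ω - w' ω) * (Real.log (w ω) - Real.log (w' ω)) := by
    intro ω _
    rcases (hws.1 ω).eq_or_lt with h0 | h0
    · have : w' ω = 0 := le_antisymm (not_lt.1 fun h1 => by
        rw [← hsupp, ← h0] at h1; exact lt_irrefl _ h1) (hws'.1 ω)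
      simp [this, ← h0]
    · exact sub_mul_log_sub_log_nonneg h0 ((hsupp ω).1 h0)
  funext ω
  rcases (hws.1 ω).eq_or_lt with h0 | h0
  · have : w' ω = 0 := le_antisymm (not_lt.1 fun h1 => by
      rw [← hsupp, ← h0] at h1; exact lt_irrefl _ h1) (hws'.1 ω)
    rw [this, h0]
  · exact eq_of_sub_mul_log_sub_log h0 ((hsupp ω).1 h0)
      ((Finset.sum_eq_zero_iff_of_nonneg hnn).1 h3 ω (Finset.mem_univ _))

theorem bary_image_toric (L : ℝ) : D.bary '' D.toric L = D.P := by
  refine Subset.antisymm ?_ ?_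
  · rintro _ ⟨w, hw, rfl⟩
    exact D.bary_mem_P (D.toric_subset L hw)
  · rw [← D.closure_interior]
    refine closure_minimal (fun m hm => ?_)
      ((D.isCompact_toric L).image D.continuous_bary).isClosed
    obtain ⟨ξ, rfl⟩ := D.exists_bary_wt_eq L hm
    exact ⟨_, subset_closure ⟨ξ, rfl⟩, rfl⟩

/-- The weights of a point of `P`. -/
noncomputable def weights (L : ℝ) : Vec N → D.A → ℝ := Function.invFunOn D.bary (D.toric L)

theorem weights_mem_toric (L : ℝ) {m : Vec N} (hm : m ∈ D.P) : D.weights L m ∈ D.toric L := by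
  rw [← D.bary_image_toric L] at hm
  exact Function.invFunOn_mem hm

theorem weights_mem (L : ℝ) {m : Vec N} (hm : m ∈ D.P) : D.weights L m ∈ stdSimplex ℝ D.A :=
  D.toric_subset L (D.weights_mem_toric L hm)

theorem bary_weights (L : ℝ) {m : Vec N} (hm : m ∈ D.P) : D.bary (D.weights L m) = m := by
  rw [← D.bary_image_toric L] at hm
  exact Function.invFunOn_eq hm

theorem weights_bary {L : ℝ} {w : D.A → ℝ} (hw : w ∈ D.toric L) :
    D.weights L (D.bary w) = w :=
  D.bary_injOn_toric L (D.weights_mem_toric L (D.bary_mem_P (D.toric_subset L hw))) hw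
    (D.bary_weights L (D.bary_mem_P (D.toric_subset L hw)))

theorem weights_bary_wt (L : ℝ) (ξ : Vec N) : D.weights L (D.bary (D.wt L ξ)) = D.wt L ξ :=
  D.weights_bary (subset_closure ⟨ξ, rfl⟩)

theorem weights_pos_iff (L : ℝ) {m : Vec N} (hm : m ∈ D.P) (ω : D.A) :
    0 < D.weights L m ω ↔ ∀ u ∈ D.normals, ht u m = 0 → ht u (latPt (ω : Lat N)) = 0 := by
  rw [D.toric_pos_iff (D.weights_mem_toric L hm), D.bary_weights L hm]

/-- The inverse of a continuous bijection from a compact set is continuous: preimages of closed sets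
are images of compact ones. -/
theorem continuousOn_weights (L : ℝ) : ContinuousOn (D.weights L) D.P := by
  rw [← D.bary_image_toric L]
  rw [continuousOn_iff_isClosed]
  intro t ht
  refine ⟨D.bary '' (D.toric L ∩ t),
    (((D.isCompact_toric L).inter_right ht).image D.continuous_bary).isClosed, ?_⟩
  ext m
  constructor
  · rintro ⟨hmt, w, hw, rfl⟩
    rw [mem_preimage, D.weights_bary hw] at hmt
    exact ⟨⟨w, ⟨hw, hmt⟩, rfl⟩, w, hw, rfl⟩
  · rintro ⟨⟨w, ⟨hw, hwt⟩, rfl⟩, -⟩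
    refine ⟨?_, w, hw, rfl⟩
    rwa [mem_preimage, D.weights_bary hw]

theorem bary_wt_mem_interior (L : ℝ) (ξ : Vec N) : D.bary (D.wt L ξ) ∈ interior D.P := by
  rw [D.mem_interior_iff]
  intro u hu
  rw [D.ht_bary u (D.wt_mem L ξ)]
  refine Finset.sum_pos' (fun ω _ => mul_nonneg (D.wt_pos L ξ ω).le
    (D.ht_nonneg (D.latPt_mem ω.2) hu)) ⟨⟨0, D.zero_mem⟩, Finset.mem_univ _, ?_⟩
  rw [latPt_zero, ht_zero, mul_one]
  exact D.wt_pos L ξ _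

end CYData

/-! ### Moving along the normal cones -/

namespace CYData

variable {N : ℕ} (D : CYData N)

/-- Multiply the weight of `ω` by `∏ y_u ^ (height of ω over the facet u)`. -/
noncomputable def twist (y : D.normals → ℝ) (w : D.A → ℝ) (ω : D.A) : ℝ :=
  w ω * ∏ u : D.normals, y u ^ latHt (u : Lat N) (ω : Lat N)

/-- The normalized twisted weights. -/
noncomputable def twistN (y : D.normals → ℝ) (w : D.A → ℝ) (ω : D.A) : ℝ :=
  D.twist y w ω / ∑ ω', D.twist y w ω'

/-- The point with weights twisted by `y` compared to those of `x.1`. -/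
noncomputable def push (L : ℝ) (x : Vec N × (D.normals → ℝ)) : Vec N :=
  D.bary (D.twistN x.2 (D.weights L x.1))

/-- The pairs consisting of a point of `∂(ε P)` and factors `y_u ∈ [0, 1]` that are different
from `1` only for the normals `u` of facets through this point. -/
def pairs (ε : ℝ) : Set (Vec N × (D.normals → ℝ)) :=
  {x | x.1 ∈ frontier (ε • D.P) ∧ (∀ u, x.2 u ∈ Icc (0 : ℝ) 1) ∧
    ∀ u : D.normals, x.2 u = 1 ∨ ht (u : Lat N) (ε⁻¹ • x.1) = 0}

theorem mem_frontier_smul_iff {ε : ℝ} (hε : 0 < ε) {s : Vec N} :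
    s ∈ frontier (ε • D.P) ↔ ε⁻¹ • s ∈ frontier D.P := by
  rw [frontier, closure_smul₀' hε.ne', interior_smul₀ hε.ne', ← smul_set_sdiff₀ hε.ne',
    Set.mem_smul_set_iff_inv_smul_mem₀ hε.ne', frontier]

theorem frontier_smul_subset {ε : ℝ} : frontier (ε • D.P) ⊆ ε • D.P :=
  (D.isCompact_P.smul ε).isClosed.frontier_subset

theorem twist_nonneg {y : D.normals → ℝ} (hy : ∀ u, 0 ≤ y u) {w : D.A → ℝ} (hw : ∀ ω, 0 ≤ w ω)
    (ω : D.A) : 0 ≤ D.twist y w ω :=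
  mul_nonneg (hw ω) (Finset.prod_nonneg fun u _ => pow_nonneg (hy u) _)

theorem exists_support (L : ℝ) {q : Vec N} (hq : q ∈ D.P) :
    ∃ ω : D.A, 0 < D.weights L q ω := by
  by_contra h
  push Not at h
  have hw := D.weights_mem L hq
  have : ∑ ω, D.weights L q ω = 0 := Finset.sum_eq_zero fun ω _ => le_antisymm (h ω) (hw.1 ω)
  rw [hw.2] at this
  exact one_ne_zero this

theorem latHt_eq_zero_iff {u z : Lat N} (hu : u ∈ D.normals) (hz : z ∈ D.A) :
    latHt u z = 0 ↔ ht u (latPt z) = 0 := by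
  rw [← D.latHt_eq hu hz]; exact Nat.cast_eq_zero.symm

theorem twist_pos {y : D.normals → ℝ} (hy : ∀ u, 0 ≤ y u) {w : D.A → ℝ} {ω : D.A} (hw : 0 < w ω)
    (h : ∀ u : D.normals, y u = 0 → ht (u : Lat N) (latPt (ω : Lat N)) = 0) :
    0 < D.twist y w ω := by
  refine mul_pos hw (Finset.prod_pos fun u _ => ?_)
  rcases (hy u).eq_or_lt with h0 | h0
  · rw [(D.latHt_eq_zero_iff u.2 ω.2).2 (h u h0.symm), pow_zero]; exact one_pos
  · exact pow_pos h0 _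

theorem twist_sum_pos {y : D.normals → ℝ} (hy : ∀ u, 0 ≤ y u) {w : D.A → ℝ} (hw : ∀ ω, 0 < w ω)
    {q : Vec N} (hq : q ∈ D.P) (hyq : ∀ u : D.normals, y u = 0 → ht (u : Lat N) q = 0) :
    0 < ∑ ω, D.twist y w ω := by
  obtain ⟨ω, hω⟩ := D.exists_support 0 hq
  refine Finset.sum_pos' (fun ω _ => D.twist_nonneg hy (fun ω => (hw ω).le) ω)
    ⟨ω, Finset.mem_univ _, D.twist_pos hy (hw ω) fun u hu => ?_⟩
  exact (D.weights_pos_iff 0 hq ω).1 hω u u.2 (hyq u hu)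

/-- In logarithmic coordinates a positive twist is a translation along the normals. The summand 1 in
the height multiplies all weights by the same factor, which the normalization removes. -/
theorem twistN_wt (L : ℝ) (ξ : Vec N) {y : D.normals → ℝ} (hy : ∀ u, 0 < y u) :
    D.twistN y (D.wt L ξ) =
      D.wt L (ξ + ∑ u : D.normals, Real.log (y u) • latPt (u : Lat N)) := by
  set ξ' := ξ + ∑ u : D.normals, Real.log (y u) • latPt (u : Lat N) with hξ'
  set K := Real.exp (∑ u, Real.log (y u)) * D.part L ξ' / D.part L ξ with hK
  have hKpos : 0 < K :=
    div_pos (mul_pos (Real.exp_pos _) (D.part_pos _ _)) (D.part_pos _ _)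
  have key : ∀ ω, D.twist y (D.wt L ξ) ω = K * D.wt L ξ' ω := by
    intro ω
    have h1 : ∏ u : D.normals, y u ^ latHt (u : Lat N) (ω : Lat N) =
        Real.exp (∑ u : D.normals, Real.log (y u) * (1 + inner ℝ (latPt (u : Lat N)) (latPt (ω : Lat N)))) := by
      rw [Real.exp_sum]
      refine Finset.prod_congr rfl fun u _ => ?_
      rw [← ht, ← D.latHt_eq u.2 ω.2, mul_comm, Real.exp_nat_mul, Real.exp_log (hy u)]
    have h2 : D.expo L ξ' ω = D.expo L ξ ω +
        ∑ u : D.normals, Real.log (y u) * inner ℝ (latPt (u : Lat N)) (latPt (ω : Lat N)) := by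
      rw [hξ', expo, expo, inner_add_right, inner_sum]
      simp only [inner_smul_right, real_inner_comm]
      ring
    rw [twist, h1, wt, wt, hK, h2]
    simp only [mul_add, mul_one, Finset.sum_add_distrib, Real.exp_add]
    have := (D.part_pos L ξ).ne'
    have := (D.part_pos L ξ').ne'
    field_simp
  funext ω
  have hsum : ∑ ω', D.twist y (D.wt L ξ) ω' = K := by
    simp only [key, ← Finset.mul_sum, (D.wt_mem L ξ').2, mul_one]
  rw [twistN, hsum, key, mul_div_cancel_left₀ _ hKpos.ne']

theorem exists_wt_eq_weights (L : ℝ) {m : Vec N} (hm : m ∈ interior D.P) :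
    ∃ ξ, D.bary (D.wt L ξ) = m ∧ D.weights L m = D.wt L ξ := by
  obtain ⟨ξ, rfl⟩ := D.exists_bary_wt_eq L hm
  exact ⟨ξ, rfl, D.weights_bary_wt L ξ⟩

theorem weights_pos (L : ℝ) {m : Vec N} (hm : m ∈ interior D.P) (ω : D.A) :
    0 < D.weights L m ω := by
  obtain ⟨ξ, -, h⟩ := D.exists_wt_eq_weights L hm
  rw [h]; exact D.wt_pos L ξ ω

/-- A twist with zero factors is the limit of the twists by max(y, δ), which are translations. The
point q keeps the denominator away from zero: the points of A on its minimal face have height 0 over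
every facet whose factor vanishes. -/
theorem twistN_mem_toric (L : ℝ) {m : Vec N} (hm : m ∈ interior D.P) {y : D.normals → ℝ}
    (hy : ∀ u, 0 ≤ y u) {q : Vec N} (hq : q ∈ D.P)
    (hyq : ∀ u : D.normals, y u = 0 → ht (u : Lat N) q = 0) :
    D.twistN y (D.weights L m) ∈ D.toric L := by
  obtain ⟨ξ, -, hw⟩ := D.exists_wt_eq_weights L hm
  rw [hw]
  have hpos := D.twist_sum_pos hy (D.wt_pos L ξ) hq hyq
  have hc : ∀ ω, Continuous fun δ : ℝ => D.twist (fun u => max (y u) δ) (D.wt L ξ) ω := by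
    intro ω; unfold twist; fun_prop
  have hmax : (fun u => max (y u) 0) = y := funext fun u => max_eq_left (hy u)
  have htend : Filter.Tendsto (fun δ : ℝ => D.twistN (fun u => max (y u) δ) (D.wt L ξ)) (𝓝[>] 0)
      (𝓝 (D.twistN y (D.wt L ξ))) := by
    rw [tendsto_pi_nhds]
    intro ω
    have h1 := (hc ω).tendsto 0
    have h2 := (continuous_finsetSum Finset.univ fun ω _ => hc ω).tendsto 0
    rw [hmax] at h1 h2
    exact (h1.div h2 hpos.ne').mono_left nhdsWithin_le_nhds
  refine mem_closure_of_tendsto htend ?_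
  filter_upwards [self_mem_nhdsWithin] with δ hδ
  rw [D.twistN_wt L ξ fun u => lt_max_of_lt_right hδ]
  exact ⟨_, rfl⟩

/-- The potential whose minimum over nonnegative `c` gives the tip of the normal cone. -/
noncomputable def potential (ε L : ℝ) (ξ : Vec N) (c : D.normals → ℝ) : ℝ :=
  Real.log (D.part L (ξ + ∑ u : D.normals, c u • latPt (u : Lat N))) + ε * ∑ u, c u

theorem continuous_potential (ε L : ℝ) (ξ : Vec N) : Continuous (D.potential ε L ξ) :=
  ((D.continuous_log_part L).comp (by fun_prop)).add (by fun_prop)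

section Pairs

variable {ε : ℝ} (hε : 0 < ε) (hεP : ε • D.P ⊆ interior D.P)

include hε

theorem pairs_fst_mem {x : Vec N × (D.normals → ℝ)} (hx : x ∈ D.pairs ε) : ε⁻¹ • x.1 ∈ D.P :=
  D.frontier_subset_P ((D.mem_frontier_smul_iff hε).1 hx.1)

omit hε in
theorem isCompact_pairs : IsCompact (D.pairs ε) := by
  have hK : IsCompact ((ε • D.P) ×ˢ (Set.univ.pi fun _ : D.normals => Icc (0 : ℝ) 1)) :=
    (D.isCompact_P.smul ε).prod (isCompact_univ_pi fun _ => isCompact_Icc)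
  refine hK.of_isClosed_subset ?_ fun x hx => ⟨D.frontier_smul_subset hx.1, fun u _ => hx.2.1 u⟩
  have h1 : IsClosed {x : Vec N × (D.normals → ℝ) | ∀ u, x.2 u ∈ Icc (0 : ℝ) 1} := by
    simp only [ofPred_forall]
    exact isClosed_iInter fun u => isClosed_Icc.preimage (by fun_prop)
  have h2 : IsClosed {x : Vec N × (D.normals → ℝ) |
      ∀ u : D.normals, x.2 u = 1 ∨ ht (u : Lat N) (ε⁻¹ • x.1) = 0} := by
    simp only [ofPred_forall]
    refine isClosed_iInter fun u => IsClosed.union ?_ ?_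
    · exact isClosed_eq (by fun_prop) continuous_const
    · exact isClosed_eq ((continuous_ht _).comp (by fun_prop)) continuous_const
  exact (isClosed_frontier.preimage continuous_fst).inter (h1.inter h2)

omit hε in
theorem pairs_tight {x : Vec N × (D.normals → ℝ)} (hx : x ∈ D.pairs ε) (u : D.normals)
    (h : x.2 u ≠ 1) : ht (u : Lat N) (ε⁻¹ • x.1) = 0 := (hx.2.2 u).resolve_left h

omit hε in
theorem pairs_prod_eq_one {x : Vec N × (D.normals → ℝ)} (hx : x ∈ D.pairs ε) {ω : D.A}
    (hω : ∀ u ∈ D.normals, ht u (ε⁻¹ • x.1) = 0 → ht u (latPt (ω : Lat N)) = 0) :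
    ∏ u : D.normals, x.2 u ^ latHt (u : Lat N) (ω : Lat N) = 1 := by
  refine Finset.prod_eq_one fun u _ => ?_
  rcases hx.2.2 u with h | h
  · rw [h, one_pow]
  · rw [(D.latHt_eq_zero_iff u.2 ω.2).2 (hω u u.2 h), pow_zero]

include hεP

omit hε in
theorem pairs_fst_mem_interior {x : Vec N × (D.normals → ℝ)} (hx : x ∈ D.pairs ε) :
    x.1 ∈ interior D.P := hεP (D.frontier_smul_subset hx.1)

theorem pairs_sum_pos (L : ℝ) {x : Vec N × (D.normals → ℝ)} (hx : x ∈ D.pairs ε) :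
    0 < ∑ ω, D.twist x.2 (D.weights L x.1) ω :=
  D.twist_sum_pos (fun u => (hx.2.1 u).1) (D.weights_pos L (D.pairs_fst_mem_interior hεP hx))
    (D.pairs_fst_mem hε hx) fun u hu => D.pairs_tight hx u (by rw [hu]; exact zero_ne_one)

theorem pairs_twistN_mem (L : ℝ) {x : Vec N × (D.normals → ℝ)} (hx : x ∈ D.pairs ε) :
    D.twistN x.2 (D.weights L x.1) ∈ D.toric L :=
  D.twistN_mem_toric L (D.pairs_fst_mem_interior hεP hx) (fun u => (hx.2.1 u).1)
    (D.pairs_fst_mem hε hx) fun u hu => D.pairs_tight hx u (by rw [hu]; exact zero_ne_one)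

theorem push_mem_P (L : ℝ) {x : Vec N × (D.normals → ℝ)} (hx : x ∈ D.pairs ε) :
    D.push L x ∈ D.P := D.bary_mem_P (D.toric_subset L (D.pairs_twistN_mem hε hεP L hx))

theorem weights_push (L : ℝ) {x : Vec N × (D.normals → ℝ)} (hx : x ∈ D.pairs ε) :
    D.weights L (D.push L x) = D.twistN x.2 (D.weights L x.1) :=
  D.weights_bary (D.pairs_twistN_mem hε hεP L hx)

theorem continuousOn_push (L : ℝ) : ContinuousOn (D.push L) (D.pairs ε) := by
  have h1 : ∀ ω, ContinuousOn (fun x : Vec N × (D.normals → ℝ) =>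
      D.twist x.2 (D.weights L x.1) ω) (D.pairs ε) := by
    intro ω
    unfold twist
    refine ContinuousOn.mul ?_ (Continuous.continuousOn (by fun_prop))
    have := (D.continuousOn_weights L).comp continuousOn_fst
      (fun x hx => interior_subset (D.pairs_fst_mem_interior hεP hx))
    exact continuousOn_pi.1 this ω
  have h2 : ContinuousOn (fun x : Vec N × (D.normals → ℝ) =>
      D.twistN x.2 (D.weights L x.1)) (D.pairs ε) := by
    refine continuousOn_pi.2 fun ω => ?_
    exact (h1 ω).div (continuousOn_finsetSum _ fun ω _ => h1 ω)
      fun x hx => (D.pairs_sum_pos hε hεP L hx).ne'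
  exact D.continuous_bary.comp_continuousOn h2

/-- The points of `A` on the face through `x.1 / ε` keep positive weight. -/
theorem twistN_pos_of_face (L : ℝ) {x : Vec N × (D.normals → ℝ)} (hx : x ∈ D.pairs ε) {ω : D.A}
    (hω : ∀ u ∈ D.normals, ht u (ε⁻¹ • x.1) = 0 → ht u (latPt (ω : Lat N)) = 0) :
    0 < D.twistN x.2 (D.weights L x.1) ω := by
  refine div_pos ?_ (D.pairs_sum_pos hε hεP L hx)
  rw [twist, D.pairs_prod_eq_one hx hω, mul_one]
  exact D.weights_pos L (D.pairs_fst_mem_interior hεP hx) ω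

/-- The origin has height 1 over all facets, so its weight stays positive unless a factor vanishes,
and a point of the boundary gives it no weight. If y_u = 0, only points of height 0 over u keep
weight. -/
theorem push_mem_frontier_iff (L : ℝ) {x : Vec N × (D.normals → ℝ)} (hx : x ∈ D.pairs ε) :
    D.push L x ∈ frontier D.P ↔ ∃ u, x.2 u = 0 := by
  have hy : ∀ u, 0 ≤ x.2 u := fun u => (hx.2.1 u).1
  have hmem := D.toric_subset L (D.pairs_twistN_mem hε hεP L hx)
  constructor
  · intro h
    by_contra hcon
    push Not at hcon
    obtain ⟨u, hu, h0⟩ := (D.mem_frontier_iff.1 h).2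
    have hpos : 0 < D.twistN x.2 (D.weights L x.1) ⟨0, D.zero_mem⟩ :=
      div_pos (D.twist_pos hy (D.weights_pos L (D.pairs_fst_mem_interior hεP hx) _)
        fun u hu => absurd hu (hcon u)) (D.pairs_sum_pos hε hεP L hx)
    have := D.ht_eq_zero_of_sum hu (s := Finset.univ) (f := fun ω : D.A => latPt (ω : Lat N))
      (fun ω _ => D.latPt_mem ω.2) (fun ω _ => hmem.1 ω) hmem.2 h0 (Finset.mem_univ _) hpos
    rw [latPt_zero, ht_zero] at this
    exact one_ne_zero this
  · rintro ⟨u, hu⟩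
    refine D.mem_frontier_iff.2 ⟨D.push_mem_P hε hεP L hx, u, u.2, ?_⟩
    rw [push, D.ht_bary _ hmem]
    refine Finset.sum_eq_zero fun ω _ => ?_
    by_cases h0 : latHt (u : Lat N) (ω : Lat N) = 0
    · rw [(D.latHt_eq_zero_iff u.2 ω.2).1 h0, mul_zero]
    · rw [twistN, twist, Finset.prod_eq_zero (Finset.mem_univ u) (by rw [hu, zero_pow h0])]
      simp

/-- The faces through a point of the normal cone contain the face of its tip. -/
theorem push_tight (L : ℝ) {x : Vec N × (D.normals → ℝ)} (hx : x ∈ D.pairs ε) {u : Lat N}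
    (hu : u ∈ D.normals) (h : ht u (D.push L x) = 0) : ht u (ε⁻¹ • x.1) = 0 := by
  have hmem := D.toric_subset L (D.pairs_twistN_mem hε hεP L hx)
  have hq := D.pairs_fst_mem hε hx
  rw [← D.bary_weights L hq, D.ht_bary _ (D.weights_mem L hq)]
  refine Finset.sum_eq_zero fun ω _ => ?_
  rcases ((D.weights_mem L hq).1 ω).eq_or_lt with h0 | h0
  · rw [← h0, zero_mul]
  · rw [D.ht_eq_zero_of_sum hu (s := Finset.univ) (f := fun ω : D.A => latPt (ω : Lat N))
      (fun ω _ => D.latPt_mem ω.2) (fun ω _ => hmem.1 ω) hmem.2 h (Finset.mem_univ ω)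
      (D.twistN_pos_of_face hε hεP L hx ((D.weights_pos_iff L hq ω).1 h0)), mul_zero]

omit hε hεP in
theorem log_twistN {L : ℝ} {ξ : Vec N} {x : Vec N × (D.normals → ℝ)}
    (hw : D.weights L x.1 = D.wt L ξ) {ω : D.A}
    (hpos : 0 < D.twistN x.2 (D.weights L x.1) ω) :
    Real.log (D.twistN x.2 (D.weights L x.1) ω) = Real.log (D.wt L ξ ω) +
      ∑ u : D.normals, ht (u : Lat N) (latPt (ω : Lat N)) * Real.log (x.2 u) -
        Real.log (∑ ω', D.twist x.2 (D.weights L x.1) ω') := by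
  have h0 : D.twist x.2 (D.weights L x.1) ω ≠ 0 := fun h => by
    rw [twistN, h, zero_div] at hpos; exact lt_irrefl _ hpos
  have h1 : ∑ ω', D.twist x.2 (D.weights L x.1) ω' ≠ 0 := fun h => by
    rw [twistN, h, div_zero] at hpos; exact lt_irrefl _ hpos
  rw [twistN, Real.log_div h0 h1]
  rw [twist] at h0 ⊢
  rw [Real.log_mul (left_ne_zero_of_mul h0) (right_ne_zero_of_mul h0), hw,
    Real.log_prod (fun u hu => Finset.prod_ne_zero_iff.1 (right_ne_zero_of_mul h0) u hu)]
  congr 2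
  exact Finset.sum_congr rfl fun u _ => by rw [Real.log_pow, D.latHt_eq u.2 ω.2]

/-- For an interior common point, ξ - ξ' is the combination of the normals u with coefficients log
y'_u - log y_u. Pairing it with q - q', where q and q' are the tips divided by ε, leaves ht_u(q) log
y'_u + ht_u(q') log y_u, as the other terms vanish by complementary slackness. The result is
nonpositive, against the strict monotonicity of the moment map. Working with weights instead of ξ
covers boundary points too. -/
theorem push_fst_eq (L : ℝ) {x x' : Vec N × (D.normals → ℝ)} (hx : x ∈ D.pairs ε)
    (hx' : x' ∈ D.pairs ε) (h : D.push L x = D.push L x') : x.1 = x'.1 := by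
  obtain ⟨ξ, hξ, hw⟩ := D.exists_wt_eq_weights L (D.pairs_fst_mem_interior hεP hx)
  obtain ⟨ξ', hξ', hw'⟩ := D.exists_wt_eq_weights L (D.pairs_fst_mem_interior hεP hx')
  have hW : D.twistN x.2 (D.weights L x.1) = D.twistN x'.2 (D.weights L x'.1) := by
    rw [← D.weights_push hε hεP L hx, ← D.weights_push hε hεP L hx', h]
  have hq := D.pairs_fst_mem hε hx
  have hq' := D.pairs_fst_mem hε hx'
  set α := D.weights L (ε⁻¹ • x.1) with hα
  set β := D.weights L (ε⁻¹ • x'.1) with hβ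
  have hαs := D.weights_mem L hq
  have hβs := D.weights_mem L hq'
  set Z := Real.log (∑ ω', D.twist x.2 (D.weights L x.1) ω')
  set Z' := Real.log (∑ ω', D.twist x'.2 (D.weights L x'.1) ω')
  have hlog : ∀ ω, 0 < D.twistN x.2 (D.weights L x.1) ω →
      Real.log (D.wt L ξ ω) - Real.log (D.wt L ξ' ω) =
        ∑ u : D.normals, ht (u : Lat N) (latPt (ω : Lat N)) *
          (Real.log (x'.2 u) - Real.log (x.2 u)) + (Z - Z') := by
    intro ω hpos
    have h1 := D.log_twistN hw hpos
    have h2 := D.log_twistN hw' (hW ▸ hpos)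
    rw [hW, h2] at h1
    simp only [mul_sub, Finset.sum_sub_distrib]
    linarith
  have hdiff : ∑ ω, (α ω - β ω) = 0 := by
    rw [Finset.sum_sub_distrib, hαs.2, hβs.2, sub_self]
  have e1 : ∑ ω, (α ω - β ω) * (Real.log (D.wt L ξ ω) - Real.log (D.wt L ξ' ω)) =
      inner ℝ (ε⁻¹ • x.1 - ε⁻¹ • x'.1) (ξ - ξ') := by
    rw [← D.bary_weights L hq, ← D.bary_weights L hq', ← bary_sub, inner_bary, ← sub_eq_zero,
      ← Finset.sum_sub_distrib, ← mul_zero (Real.log (D.part L ξ') - Real.log (D.part L ξ)),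
      ← hdiff, Finset.mul_sum]
    refine Finset.sum_congr rfl fun ω _ => ?_
    rw [log_wt, log_wt, expo, expo, inner_sub_right, Pi.sub_apply]; ring
  have e2 : ∑ ω, (α ω - β ω) * (Real.log (D.wt L ξ ω) - Real.log (D.wt L ξ' ω)) =
      ∑ u : D.normals, (ht (u : Lat N) (ε⁻¹ • x.1) - ht (u : Lat N) (ε⁻¹ • x'.1)) *
        (Real.log (x'.2 u) - Real.log (x.2 u)) := by
    have hterm : ∀ ω, (α ω - β ω) * (Real.log (D.wt L ξ ω) - Real.log (D.wt L ξ' ω)) =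
        (α ω - β ω) * (∑ u : D.normals, ht (u : Lat N) (latPt (ω : Lat N)) *
          (Real.log (x'.2 u) - Real.log (x.2 u)) + (Z - Z')) := by
      intro ω
      by_cases hpos : 0 < D.twistN x.2 (D.weights L x.1) ω
      · rw [hlog ω hpos]
      · have hα0 : α ω = 0 := le_antisymm (not_lt.1 fun h0 => hpos
          (D.twistN_pos_of_face hε hεP L hx ((D.weights_pos_iff L hq ω).1 h0))) (hαs.1 ω)
        have hβ0 : β ω = 0 := le_antisymm (not_lt.1 fun h0 => hpos (hW ▸
          (D.twistN_pos_of_face hε hεP L hx' ((D.weights_pos_iff L hq' ω).1 h0)))) (hβs.1 ω)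
        rw [hα0, hβ0]; simp
    simp only [hterm, mul_add, Finset.sum_add_distrib, ← Finset.sum_mul, hdiff, zero_mul, add_zero,
      Finset.mul_sum]
    rw [Finset.sum_comm]
    refine Finset.sum_congr rfl fun u _ => ?_
    conv_rhs => rw [← D.bary_weights L hq, ← D.bary_weights L hq', D.ht_bary _ hαs,
      D.ht_bary _ hβs, ← Finset.sum_sub_distrib, Finset.sum_mul]
    exact Finset.sum_congr rfl fun ω _ => by ring
  have hle : inner ℝ (ε⁻¹ • x.1 - ε⁻¹ • x'.1) (ξ - ξ') ≤ 0 := by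
    rw [← e1, e2]
    refine Finset.sum_nonpos fun u _ => ?_
    have h1 : ht (u : Lat N) (ε⁻¹ • x.1) * Real.log (x.2 u) = 0 := by
      rcases hx.2.2 u with h | h <;> simp [h]
    have h2 : ht (u : Lat N) (ε⁻¹ • x'.1) * Real.log (x'.2 u) = 0 := by
      rcases hx'.2.2 u with h | h <;> simp [h]
    have h3 := mul_nonpos_of_nonneg_of_nonpos (D.ht_nonneg hq u.2)
      (Real.log_nonpos (hx'.2.1 u).1 (hx'.2.1 u).2)
    have h4 := mul_nonpos_of_nonneg_of_nonpos (D.ht_nonneg hq' u.2)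
      (Real.log_nonpos (hx.2.1 u).1 (hx.2.1 u).2)
    linarith
  by_contra hne
  have hξne : ξ ≠ ξ' := fun he => hne (by rw [← hξ, ← hξ', he])
  have hpos := D.inner_sub_bary_wt_pos L hξne
  rw [hξ, hξ'] at hpos
  rw [← smul_sub, inner_smul_left] at hle
  have : 0 < ε⁻¹ * inner ℝ (x.1 - x'.1) (ξ - ξ') := mul_pos (by positivity) hpos
  simp only [conj_trivial] at hle
  linarith

omit hε hεP in
theorem VertexChart.latHt_f_a {p : Lat N} (C : D.VertexChart p) (i j : Fin N) :
    latHt (C.f j) (C.a i) = if j = i then C.κ i else 0 := by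
  have h : 1 + C.f j ⬝ᵥ C.a i = if j = i then (C.κ i : ℤ) else 0 := by
    rw [C.a_eq, dotProduct_add, dotProduct_smul, C.dual, C.f_p, smul_eq_mul]
    split_ifs <;> ring
  rw [latHt, h]
  split_ifs
  · exact Int.toNat_natCast _
  · rfl

omit hε hεP in
theorem pairs_prod_a {p : Lat N} (C : D.VertexChart p) {x : Vec N × (D.normals → ℝ)}
    (hx : x ∈ D.pairs ε)
    (hp : ∀ u ∈ D.normals, ht u (ε⁻¹ • x.1) = 0 → ht u (latPt p) = 0) {u : D.normals} {i : Fin N}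
    (hi : (u : Lat N) = C.f i) :
    ∏ u' : D.normals, x.2 u' ^ latHt (u' : Lat N) (C.a i) = x.2 u ^ (C.κ i) := by
  rw [Finset.prod_eq_single u]
  · rw [hi, C.latHt_f_a, if_pos rfl]
  · intro v _ hvu
    rcases hx.2.2 v with h | h
    · rw [h, one_pow]
    · obtain ⟨j, hj⟩ := C.tight v v.2 (hp v v.2 h)
      have hij : j ≠ i := by
        rintro rfl; exact hvu (Subtype.ext (hj.trans hi.symm))
      rw [hj, C.latHt_f_a, if_neg hij, pow_zero]
  · intro h; exact absurd (Finset.mem_univ _) h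

omit hε hεP in
theorem exists_prod_div_eq {y y' : D.normals → ℝ} {w : D.A → ℝ} (hw : ∀ ω, 0 < w ω)
    (h : D.twistN y w = D.twistN y' w) (h' : 0 < ∑ ω', D.twist y' w ω') :
    ∃ Z Z' : ℝ, 0 < Z' ∧ ∀ ω : D.A, (∏ u : D.normals, y u ^ latHt (u : Lat N) (ω : Lat N)) / Z =
      (∏ u : D.normals, y' u ^ latHt (u : Lat N) (ω : Lat N)) / Z' := by
  refine ⟨∑ ω', D.twist y w ω', ∑ ω', D.twist y' w ω', h', fun ω => ?_⟩
  have := congrFun h ω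
  unfold twistN at this
  rw [twist.eq_def D y w ω, twist.eq_def D y' w ω, mul_div_assoc, mul_div_assoc] at this
  exact mul_left_cancel₀ (hw ω).ne' this

/-- Once the tips agree, a vertex p on the face of the tip is untouched by the twists and equates
the normalizing constants. The edge point a_i, of height κ_i over its facet and 0 over the other
facets through p, then recovers y_u from y_u^κ_i. -/
theorem injOn_push (hN : 1 ≤ N) (L : ℝ) : InjOn (D.push L) (D.pairs ε) := by
  intro x hx x' hx' h
  have h1 := D.push_fst_eq hε hεP L hx hx' h
  refine Prod.ext h1 (funext fun u => ?_)
  have hq := D.pairs_fst_mem hε hx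
  obtain ⟨p, ⟨C⟩, hp⟩ := D.exists_vertexChart_of_mem hN hq
  have hW : D.twistN x.2 (D.weights L x.1) = D.twistN x'.2 (D.weights L x'.1) := by
    rw [← D.weights_push hε hεP L hx, h, D.weights_push hε hεP L hx']
  have hwpos := D.weights_pos L (D.pairs_fst_mem_interior hεP hx)
  have hZ' := D.pairs_sum_pos hε hεP L hx'
  rw [← h1] at hW hZ'
  obtain ⟨Z, Z', hZ'0, hprod⟩ := D.exists_prod_div_eq hwpos hW hZ'
  have hpr : ∀ u ∈ D.normals, ht u (ε⁻¹ • x'.1) = 0 → ht u (latPt p) = 0 := by rwa [← h1]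
  have hZ := hprod ⟨p, C.p_mem⟩
  rw [D.pairs_prod_eq_one hx (ω := ⟨p, C.p_mem⟩) hp,
    D.pairs_prod_eq_one hx' (ω := ⟨p, C.p_mem⟩) hpr] at hZ
  by_cases ht0 : ht (u : Lat N) (ε⁻¹ • x.1) = 0
  · obtain ⟨i, hi⟩ := C.tight u u.2 (hp u u.2 ht0)
    have h2 := hprod ⟨C.a i, C.a_mem i⟩
    rw [D.pairs_prod_a C hx hp hi, D.pairs_prod_a C hx' hpr hi, div_eq_mul_one_div, hZ,
      ← div_eq_mul_one_div] at h2
    have h3 := (div_left_inj' hZ'0.ne').1 h2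
    exact (pow_left_inj₀ (hx.2.1 u).1 (hx'.2.1 u).1 (C.κ_pos i).ne').1 h3
  · rw [(hx.2.2 u).resolve_right ht0, (hx'.2.2 u).resolve_right (by rwa [← h1])]

/-! ### Surjectivity: tips of normal cones by convex minimization -/

omit hε hεP in
-- Replacing c by |c| removes the constraint. The term of the origin bounds log Z below by L λ(0)
-- independently of c, so the linear penalty makes the function coercive.
theorem exists_isMin_potential (hε : 0 < ε) (L : ℝ) (ξ : Vec N) :
    ∃ c : D.normals → ℝ, (∀ u, 0 ≤ c u) ∧ ∀ c' : D.normals → ℝ, (∀ u, 0 ≤ c' u) →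
      D.potential ε L ξ c ≤ D.potential ε L ξ c' := by
  have habs : Continuous fun c : D.normals → ℝ => fun u => |c u| := by fun_prop
  have hlow : ∀ c : D.normals → ℝ, L * D.lam 0 + ε * ‖c‖ ≤ D.potential ε L ξ fun u => |c u| := by
    intro c
    have h1 := D.expo_le_log_part L (ξ + ∑ u : D.normals, |c u| • latPt (u : Lat N)) D.zero_mem
    rw [expo, latPt_zero, inner_zero_left, add_zero] at h1
    have h2 : ‖c‖ ≤ ∑ u, |c u| := by
      refine (pi_norm_le_iff_of_nonneg (Finset.sum_nonneg fun _ _ => abs_nonneg _)).2 fun u => ?_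
      exact Finset.single_le_sum (f := fun u => |c u|) (fun _ _ => abs_nonneg _) (Finset.mem_univ u)
    exact add_le_add h1 (mul_le_mul_of_nonneg_left h2 hε.le)
  have htend : Filter.Tendsto (fun c : D.normals → ℝ => D.potential ε L ξ fun u => |c u|)
      (Filter.cocompact _) Filter.atTop := by
    refine Filter.tendsto_atTop_mono hlow ?_
    exact Filter.tendsto_atTop_add_const_left _ _
      ((tendsto_norm_cocompact_atTop).const_mul_atTop hε)
  obtain ⟨c₀, hc₀⟩ := ((D.continuous_potential ε L ξ).comp habs).exists_forall_le htend
  refine ⟨fun u => |c₀ u|, fun u => abs_nonneg _, fun c' hc' => ?_⟩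
  have h1 := hc₀ c'
  have h2 : (fun u => |c' u|) = c' := funext fun u => abs_of_nonneg (hc' u)
  simp only [Function.comp_apply, h2] at h1
  exact h1

omit hε hεP in
theorem hasDerivAt_potential (L : ℝ) (ξ : Vec N) (c : D.normals → ℝ) [DecidableEq D.normals]
    (u : D.normals) :
    HasDerivAt (fun s : ℝ => D.potential ε L ξ (c + Pi.single u s))
      (inner ℝ (D.bary (D.wt L (ξ + ∑ u : D.normals, c u • latPt (u : Lat N))))
        (latPt (u : Lat N)) + ε) 0 := by
  set ξ' := ξ + ∑ u : D.normals, c u • latPt (u : Lat N) with hξ'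
  have h1 : (fun s : ℝ => D.potential ε L ξ (c + Pi.single u s)) = fun s : ℝ =>
      Real.log (D.part L (ξ' + s • latPt (u : Lat N))) + (ε * ∑ v, c v + ε * s) := by
    funext s
    have h2 : ∑ v : D.normals, (c + Pi.single u s : D.normals → ℝ) v • latPt (v : Lat N) =
        ∑ v : D.normals, c v • latPt (v : Lat N) + s • latPt (u : Lat N) := by
      simp only [Pi.add_apply, add_smul, Finset.sum_add_distrib]
      congr 1
      rw [Finset.sum_eq_single u] <;> simp +contextual
    have h3 : ∑ v : D.normals, (c + Pi.single u s : D.normals → ℝ) v = ∑ v, c v + s := by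
      simp only [Pi.add_apply, Finset.sum_add_distrib, Finset.sum_pi_single', Finset.mem_univ,
        if_true]
    rw [potential, h2, h3, hξ', mul_add, add_assoc ξ]
  rw [h1]
  refine (D.hasDerivAt_log_part L ξ' _).add ?_
  simpa using ((hasDerivAt_id (0 : ℝ)).const_mul ε).const_add (ε * ∑ v, c v)

omit hε hεP in
-- Stationarity translates into geometry: for the moment image m' of the translated point, the
-- inequality says ⟨m', u⟩ ≥ -ε, that is m' ∈ ε P, and the equality says that only facets through
-- m'/ε have c_u > 0. At c_u = 0 only a one-sided derivative is available.
theorem kkt_potential (L : ℝ) (ξ : Vec N) {c : D.normals → ℝ} (hc0 : ∀ u, 0 ≤ c u)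
    (hmin : ∀ c' : D.normals → ℝ, (∀ u, 0 ≤ c' u) →
      D.potential ε L ξ c ≤ D.potential ε L ξ c') (u : D.normals) :
    0 ≤ inner ℝ (D.bary (D.wt L (ξ + ∑ u : D.normals, c u • latPt (u : Lat N))))
        (latPt (u : Lat N)) + ε ∧
    (0 < c u → inner ℝ (D.bary (D.wt L (ξ + ∑ u : D.normals, c u • latPt (u : Lat N))))
        (latPt (u : Lat N)) + ε = 0) := by
  classical
  have hd := D.hasDerivAt_potential (ε := ε) L ξ c u
  have hz : c + Pi.single u (0 : ℝ) = c := by rw [Pi.single_zero, add_zero]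
  constructor
  · have h1 := (hasDerivAt_iff_tendsto_slope_zero.1 hd).mono_left
      (nhdsWithin_mono (0 : ℝ) (fun s (hs : s ∈ Ioi (0 : ℝ)) => (ne_of_gt hs : s ≠ 0)))
    refine ge_of_tendsto h1 ?_
    filter_upwards [self_mem_nhdsWithin] with s hs
    have hs : 0 < s := hs
    rw [zero_add, smul_eq_mul, hz]
    refine mul_nonneg (by positivity) (sub_nonneg.2 (hmin _ fun v => ?_))
    have := hc0 v
    rw [Pi.add_apply, Pi.single_apply]; split_ifs <;> linarith
  · intro hu
    refine IsLocalMin.hasDerivAt_eq_zero ?_ hd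
    filter_upwards [Ioi_mem_nhds (neg_lt_zero.2 hu)] with s hs
    rw [hz]
    refine hmin _ fun v => ?_
    have := hc0 v
    have hs : -c u < s := hs
    rw [Pi.add_apply, Pi.single_apply]
    split_ifs with h
    · rw [h]; linarith
    · linarith

omit hεP in
/-- Interior points outside of `ε P` lie in a normal cone. -/
theorem exists_push_eq_of_interior (L : ℝ) {m : Vec N} (hm : m ∈ interior D.P)
    (hmε : m ∉ ε • D.P) : ∃ x ∈ D.pairs ε, D.push L x = m := by
  obtain ⟨ξ, hξ⟩ := D.exists_bary_wt_eq L hm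
  obtain ⟨c, hc0, hmin⟩ := D.exists_isMin_potential hε L ξ
  have hkkt := D.kkt_potential L ξ hc0 hmin
  set ξ' := ξ + ∑ u : D.normals, c u • latPt (u : Lat N) with hξ'
  set m' := D.bary (D.wt L ξ') with hm'
  have hht : ∀ u : D.normals, ht (u : Lat N) (ε⁻¹ • m') =
      ε⁻¹ * (inner ℝ m' (latPt (u : Lat N)) + ε) := by
    intro u
    rw [ht, inner_smul_right, real_inner_comm, mul_add, inv_mul_cancel₀ hε.ne']; ring
  have hqP : ε⁻¹ • m' ∈ D.P := D.mem_P_iff.2 fun u hu => by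
    rw [hht ⟨u, hu⟩]; exact mul_nonneg (by positivity) (hkkt _).1
  -- If the minimizer were c = 0, then m itself would satisfy the inequalities of ε P.
  obtain ⟨u₀, hu₀⟩ : ∃ u, 0 < c u := by
    by_contra hcon
    push Not at hcon
    have h1 : ξ' = ξ := by
      rw [hξ', Finset.sum_eq_zero fun u _ => by rw [le_antisymm (hcon u) (hc0 u), zero_smul],
        add_zero]
    apply hmε
    rw [Set.mem_smul_set_iff_inv_smul_mem₀ hε.ne', ← hξ, ← h1]
    exact hqP
  have hqf : ε⁻¹ • m' ∈ frontier D.P :=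
    D.mem_frontier_iff.2 ⟨hqP, u₀, u₀.2, by rw [hht, (hkkt u₀).2 hu₀, mul_zero]⟩
  -- The factors exp(-c_u) undo the translation from ξ to ξ', and they lie in (0, 1] because c ≥ 0.
  refine ⟨(m', fun u => Real.exp (-c u)), ⟨(D.mem_frontier_smul_iff hε).2 hqf, fun u =>
    ⟨(Real.exp_pos _).le, Real.exp_le_one_iff.2 (neg_nonpos.2 (hc0 u))⟩, fun u => ?_⟩, ?_⟩
  · rcases (hc0 u).eq_or_lt with h | h
    · left; simp [← h]
    · right
      change ht (u : Lat N) (ε⁻¹ • m') = 0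
      rw [hht, (hkkt u).2 h, mul_zero]
  · change D.bary (D.twistN _ (D.weights L m')) = m
    rw [hm', D.weights_bary_wt, D.twistN_wt L ξ' fun u => Real.exp_pos _]
    simp only [Real.log_exp]
    rw [← hξ]
    congr 2
    rw [hξ', add_assoc, ← Finset.sum_add_distrib]
    simp

theorem exists_push_eq (L : ℝ) {m : Vec N} (hm : m ∈ D.P) (hmε : m ∉ ε • D.P) :
    ∃ x ∈ D.pairs ε, D.push L x = m := by
  have hcomp : IsClosed (D.push L '' D.pairs ε) :=
    ((D.isCompact_pairs).image_of_continuousOn (D.continuousOn_push hε hεP L)).isClosed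
  have hopen : IsOpen (ε • D.P)ᶜ := (D.isCompact_P.smul ε).isClosed.isOpen_compl
  have hmem : m ∈ closure (interior D.P ∩ (ε • D.P)ᶜ) := by
    rw [← D.closure_interior] at hm
    rw [inter_comm]
    exact hopen.inter_closure ⟨hmε, hm⟩
  refine closure_minimal ?_ hcomp hmem
  rintro m' ⟨hm', hm'ε⟩
  exact D.exists_push_eq_of_interior hε L hm' hm'ε

end Pairs

end CYData

/-! ### The functions `|x^v|` on `P` -/

namespace CYData

variable {N : ℕ} (D : CYData N)

theorem exp_int_mul (n : ℤ) (x : ℝ) : Real.exp (n * x) = Real.exp x ^ n := by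
  rw [mul_comm, Real.exp_mul, Real.rpow_intCast]

theorem norm_monom_exp (ξ : Vec N) (v : Lat N) :
    ‖monom (fun i => ((Real.exp (ξ i) : ℝ) : ℂ)) v‖ = Real.exp (inner ℝ (latPt v) ξ) := by
  rw [monom, norm_prod, PiLp.inner_apply, Real.exp_sum]
  refine Finset.prod_congr rfl fun i _ => ?_
  rw [norm_zpow, Complex.norm_real, Real.norm_of_nonneg (Real.exp_pos _).le, ← exp_int_mul]
  congr 1
  simp [latPt, mul_comm]

theorem norm_zpow_lam {t : ℂ} (ht : t ≠ 0) (n : ℤ) :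
    ‖t ^ n‖ = Real.exp (Real.log ‖t‖ * n) := by
  rw [norm_zpow, mul_comm, exp_int_mul, Real.exp_log (norm_pos_iff.2 ht)]

theorem moment_exp {t : ℂ} (ht : t ≠ 0) (ξ : Vec N) :
    D.moment t (fun i => ((Real.exp (ξ i) : ℝ) : ℂ)) = D.bary (D.wt (Real.log ‖t‖) ξ) := by
  have h1 : ∀ ω : Lat N, ‖t ^ D.lam ω‖ * ‖monom (fun i => ((Real.exp (ξ i) : ℝ) : ℂ)) ω‖ =
      Real.exp (D.expo (Real.log ‖t‖) ξ ω) := by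
    intro ω
    rw [norm_zpow_lam ht, norm_monom_exp, ← Real.exp_add, expo]
  simp only [moment, h1, bary, wt, part]
  rw [← Finset.sum_coe_sort D.A fun ω => Real.exp (D.expo (Real.log ‖t‖) ξ ω),
    ← Finset.sum_coe_sort D.A fun ω => Real.exp (D.expo (Real.log ‖t‖) ξ ω) • latPt ω,
    Finset.smul_sum]
  exact Finset.sum_congr rfl fun ω _ => by rw [smul_smul, div_eq_inv_mul]

theorem posPoint_bary_wt {t : ℂ} (ht : t ≠ 0) (ξ : Vec N) :
    D.posPoint t (D.bary (D.wt (Real.log ‖t‖) ξ)) = fun i => Real.exp (ξ i) := by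
  have hinj : InjOn (fun x : Fin N → ℝ => D.moment t (fun i => (x i : ℂ))) {x | ∀ i, 0 < x i} := by
    intro x hx y hy hxy
    have hlog : ∀ z : Fin N → ℝ, (∀ i, 0 < z i) → (fun i => (z i : ℂ)) =
        fun i => ((Real.exp ((WithLp.toLp 2 fun i => Real.log (z i) : Vec N) i) : ℝ) : ℂ) := by
      intro z hz
      funext i
      simp [Real.exp_log (hz i)]
    simp only at hxy
    rw [hlog x hx, hlog y hy, D.moment_exp ht, D.moment_exp ht] at hxy
    have := D.wt_injective _ hxy
    funext i
    have h2 := congrArg (fun v : Vec N => v i) this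
    exact Real.log_injOn_pos (hx i) (hy i) h2
  rw [← D.moment_exp ht]
  exact hinj.leftInvOn_invFunOn (show (fun i => Real.exp (ξ i)) ∈ {x : Fin N → ℝ | ∀ i, 0 < x i} from
    fun i => Real.exp_pos _)

namespace VertexChart

variable {D}
variable {p : Lat N} (C : D.VertexChart p)

/-- The coordinate `|x^{e_i}|`, expressed by weights. -/
noncomputable def zeta (L : ℝ) (m : Vec N) (i : Fin N) : ℝ :=
  (D.weights L m ⟨C.a i, C.a_mem i⟩ / D.weights L m ⟨p, C.p_mem⟩ *
    Real.exp (-(L * (D.lam (C.a i) - D.lam p)))) ^ ((C.κ i : ℝ)⁻¹)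

theorem zeta_bary_wt (L : ℝ) (ξ : Vec N) (i : Fin N) :
    C.zeta L (D.bary (D.wt L ξ)) i = Real.exp (inner ℝ (latPt (C.e i)) ξ) := by
  have hκ : (C.κ i : ℝ) ≠ 0 := by exact_mod_cast (C.κ_pos i).ne'
  have h1 : D.expo L ξ (C.a i) = D.expo L ξ p + C.κ i * inner ℝ (latPt (C.e i)) ξ +
      L * (D.lam (C.a i) - D.lam p) := by
    rw [expo, expo, C.a_eq i, latPt_add, latPt_zsmul, inner_add_left, inner_smul_left]
    simp only [Int.cast_natCast, conj_trivial]; ring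
  rw [zeta, D.weights_bary_wt, wt, wt, div_div_div_cancel_right₀ (D.part_pos L ξ).ne',
    ← Real.exp_sub, ← Real.exp_add, h1, ← Real.exp_mul]
  congr 1
  field_simp
  ring

theorem exp_inner_eq_prod (ξ : Vec N) (v : Lat N) :
    Real.exp (inner ℝ (latPt v) ξ) =
      ∏ i, Real.exp (inner ℝ (latPt (C.e i)) ξ) ^ (C.f i ⬝ᵥ v) := by
  conv_lhs => rw [C.expand v, latPt_sum, sum_inner, Real.exp_sum]
  refine Finset.prod_congr rfl fun i _ => ?_
  rw [latPt_zsmul, inner_smul_left, conj_trivial, exp_int_mul]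

/-- The vertex `p` lies on all faces through `m`. -/
def Near (_C : D.VertexChart p) (m : Vec N) : Prop := m ∈ D.P ∧ ∀ u ∈ D.normals, ht u m = 0 → ht u (latPt p) = 0

theorem ht_f_a (i j : Fin N) : ht (C.f j) (latPt (C.a i)) = if j = i then (C.κ i : ℝ) else 0 := by
  rw [← D.latHt_eq (C.f_mem j) (C.a_mem i), C.latHt_f_a]
  split_ifs <;> simp

variable {C} {m : Vec N}

theorem Near.weight_pos (hm : C.Near m) (L : ℝ) : 0 < D.weights L m ⟨p, C.p_mem⟩ :=
  (D.weights_pos_iff L hm.1 _).2 hm.2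

theorem Near.weight_a_pos_iff (hm : C.Near m) (L : ℝ) (i : Fin N) :
    0 < D.weights L m ⟨C.a i, C.a_mem i⟩ ↔ ht (C.f i) m ≠ 0 := by
  rw [D.weights_pos_iff L hm.1]
  constructor
  · intro h h0
    have := h _ (C.f_mem i) h0
    rw [C.ht_f_a, if_pos rfl] at this
    exact (C.κ_pos i).ne' (by exact_mod_cast this)
  · intro h u hu h0
    obtain ⟨j, rfl⟩ := C.tight u hu (hm.2 u hu h0)
    rw [C.ht_f_a, if_neg]
    rintro rfl
    exact h h0

theorem Near.zeta_nonneg (hm : C.Near m) (L : ℝ) (i : Fin N) : 0 ≤ C.zeta L m i :=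
  Real.rpow_nonneg (mul_nonneg (div_nonneg ((D.weights_mem L hm.1).1 _)
    ((D.weights_mem L hm.1).1 _)) (Real.exp_pos _).le) _

theorem Near.zeta_pos (hm : C.Near m) (L : ℝ) {i : Fin N} (hi : ht (C.f i) m ≠ 0) :
    0 < C.zeta L m i :=
  Real.rpow_pos_of_pos (mul_pos (div_pos ((hm.weight_a_pos_iff L i).2 hi) (hm.weight_pos L))
    (Real.exp_pos _)) _

theorem Near.continuousWithinAt_zeta (hm : C.Near m) (L : ℝ) (i : Fin N) :
    ContinuousWithinAt (fun m => C.zeta L m i) D.P m := by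
  have hw : ∀ ω, ContinuousWithinAt (fun m => D.weights L m ω) D.P m := fun ω =>
    continuousWithinAt_pi.1 (D.continuousOn_weights L m hm.1) ω
  unfold zeta
  refine ContinuousWithinAt.rpow_const ?_ (Or.inr (by positivity))
  exact ((hw _).div (hw _) (hm.weight_pos L).ne').mul continuousWithinAt_const

theorem near_of_mem_interior (hm : m ∈ interior D.P) : C.Near m :=
  ⟨interior_subset hm, fun u hu h0 => absurd h0 (D.mem_interior_iff.1 hm u hu).ne'⟩

theorem Near.neBot (hm : C.Near m) : (𝓝[interior D.P] m).NeBot := by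
  rw [← mem_closure_iff_nhdsWithin_neBot, D.closure_interior]; exact hm.1

/-- The monomials are extended to boundary points by the expected formula. -/
theorem Near.absMonom_eq (hm : C.Near m) {t : ℂ} (ht0 : t ≠ 0) {v : Lat N}
    (hv : ∀ i, ht (C.f i) m = 0 → 0 ≤ C.f i ⬝ᵥ v) :
    D.absMonom t v m = ∏ i, C.zeta (Real.log ‖t‖) m i ^ (C.f i ⬝ᵥ v) := by
  refine extendFrom_eq (by rw [D.closure_interior]; exact hm.1) ?_
  have h1 : Filter.Tendsto (fun m' => ∏ i, C.zeta (Real.log ‖t‖) m' i ^ (C.f i ⬝ᵥ v))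
      (𝓝[interior D.P] m) (𝓝 (∏ i, C.zeta (Real.log ‖t‖) m i ^ (C.f i ⬝ᵥ v))) := by
    refine tendsto_finsetProd _ fun i _ => ?_
    refine Filter.Tendsto.zpow₀ ((hm.continuousWithinAt_zeta _ i).mono interior_subset) _ ?_
    by_cases h : ht (C.f i) m = 0
    · exact Or.inr (hv i h)
    · exact Or.inl (hm.zeta_pos _ h).ne'
  refine h1.congr' ?_
  filter_upwards [self_mem_nhdsWithin] with m' hm'
  obtain ⟨ξ, rfl⟩ := D.exists_bary_wt_eq (Real.log ‖t‖) hm'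
  rw [D.posPoint_bary_wt ht0, norm_monom_exp, C.exp_inner_eq_prod]
  exact Finset.prod_congr rfl fun i _ => by rw [C.zeta_bary_wt]

/-- The affine chart at the vertex p: relative to the weight of p, all weights are monomials in the
zeta coordinates with natural exponents, the heights over the facets through p. The identity holds
in the interior and passes to the limit. -/
theorem Near.weights_eq (hm : C.Near m) (L : ℝ) (ω : D.A) :
    D.weights L m ω = D.weights L m ⟨p, C.p_mem⟩ * (Real.exp (L * (D.lam ω - D.lam p)) *
      ∏ i, C.zeta L m i ^ latHt (C.f i) (ω : Lat N)) := by
  have := hm.neBot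
  have hw : ∀ ω, Filter.Tendsto (fun m => D.weights L m ω) (𝓝[interior D.P] m)
      (𝓝 (D.weights L m ω)) := fun ω =>
    (continuousWithinAt_pi.1 (D.continuousOn_weights L m hm.1) ω).mono interior_subset
  have hz : ∀ i, Filter.Tendsto (fun m => C.zeta L m i) (𝓝[interior D.P] m)
      (𝓝 (C.zeta L m i)) := fun i => (hm.continuousWithinAt_zeta L i).mono interior_subset
  refine tendsto_nhds_unique_of_eventuallyEq (hw ω) ((hw _).mul (tendsto_const_nhds.mul
    (tendsto_finsetProd _ fun i _ => (hz i).pow _))) ?_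
  filter_upwards [self_mem_nhdsWithin] with m' hm'
  obtain ⟨ξ, rfl⟩ := D.exists_bary_wt_eq L hm'
  have h1 : ∏ i, C.zeta L (D.bary (D.wt L ξ)) i ^ latHt (C.f i) (ω : Lat N) =
      Real.exp (inner ℝ (latPt ((ω : Lat N) - p)) ξ) := by
    rw [C.exp_inner_eq_prod]
    refine Finset.prod_congr rfl fun i _ => ?_
    rw [C.zeta_bary_wt, ← zpow_natCast]
    congr 1
    have h2 := D.latHt_eq (C.f_mem i) ω.2
    rw [ht_latPt] at h2
    have h3 : ((latHt (C.f i) (ω : Lat N) : ℕ) : ℤ) = 1 + C.f i ⬝ᵥ (ω : Lat N) := by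
      exact_mod_cast h2
    rw [h3, dotProduct_sub, C.f_p]; ring
  rw [h1, D.weights_bary_wt, wt, wt, ← Real.exp_add, div_mul_eq_mul_div, ← Real.exp_add]
  congr 2
  rw [expo, expo, latPt_sub, inner_sub_left]; ring

/-- The chart determines the weights up to the weight of p, and that is fixed by the total being 1.
-/
theorem Near.eq_of_zeta_eq (hm : C.Near m) {m' : Vec N} (hm' : C.Near m') {L : ℝ}
    (h : ∀ i, C.zeta L m i = C.zeta L m' i) : m = m' := by
  rw [← D.bary_weights L hm.1, ← D.bary_weights L hm'.1]
  set c : D.A → ℝ := fun ω => Real.exp (L * (D.lam ω - D.lam p)) *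
      ∏ i, C.zeta L m i ^ latHt (C.f i) (ω : Lat N) with hc
  have h1 : ∀ ω, D.weights L m ω = D.weights L m ⟨p, C.p_mem⟩ * c ω := hm.weights_eq L
  have h2 : ∀ ω, D.weights L m' ω = D.weights L m' ⟨p, C.p_mem⟩ * c ω := fun ω => by
    rw [hm'.weights_eq L ω, hc]; simp only [h]
  have s1 : D.weights L m ⟨p, C.p_mem⟩ * ∑ ω, c ω = 1 := by
    rw [Finset.mul_sum, ← (D.weights_mem L hm.1).2]
    exact Finset.sum_congr rfl fun ω _ => (h1 ω).symm
  have s2 : D.weights L m' ⟨p, C.p_mem⟩ * ∑ ω, c ω = 1 := by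
    rw [Finset.mul_sum, ← (D.weights_mem L hm'.1).2]
    exact Finset.sum_congr rfl fun ω _ => (h2 ω).symm
  have h3 : D.weights L m ⟨p, C.p_mem⟩ = D.weights L m' ⟨p, C.p_mem⟩ :=
    mul_right_cancel₀ (right_ne_zero_of_mul_eq_one s1) (s1.trans s2.symm)
  congr 1
  funext ω
  rw [h1, h2, h3]

section Pairs

variable {ε : ℝ} (hε : 0 < ε) (hεP : ε • D.P ⊆ interior D.P)
include hε hεP

theorem near_push (L : ℝ) {x : Vec N × (D.normals → ℝ)} (hx : x ∈ D.pairs ε)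
    (hp : C.Near (ε⁻¹ • x.1)) : C.Near (D.push L x) :=
  ⟨D.push_mem_P hε hεP L hx, fun u hu h0 => hp.2 u hu (D.push_tight hε hεP L hx hu h0)⟩

/-- The twist multiplies the weight of a_i by y^κ_i and leaves that of p alone; the κ_i-th root in
the definition of zeta returns y. -/
theorem zeta_push (L : ℝ) {x : Vec N × (D.normals → ℝ)} (hx : x ∈ D.pairs ε)
    (hp : C.Near (ε⁻¹ • x.1)) (i : Fin N) :
    C.zeta L (D.push L x) i = C.zeta L x.1 i * x.2 ⟨C.f i, C.f_mem i⟩ := by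
  have hκ : C.κ i ≠ 0 := (C.κ_pos i).ne'
  have hy : 0 ≤ x.2 ⟨C.f i, C.f_mem i⟩ := (hx.2.1 _).1
  have hs := (D.pairs_sum_pos hε hεP L hx).ne'
  have h0 := D.weights_mem L (interior_subset (D.pairs_fst_mem_interior hεP hx))
  rw [zeta, D.weights_push hε hεP L hx, twistN, twistN, div_div_div_cancel_right₀ hs, twist, twist,
    D.pairs_prod_a C hx hp.2 (u := ⟨C.f i, C.f_mem i⟩) rfl,
    D.pairs_prod_eq_one hx (ω := ⟨p, C.p_mem⟩) hp.2, mul_one, zeta]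
  set A := D.weights L x.1 ⟨C.a i, C.a_mem i⟩
  set B := D.weights L x.1 ⟨p, C.p_mem⟩
  set E := Real.exp (-(L * (D.lam (C.a i) - D.lam p)))
  set Y := x.2 ⟨C.f i, C.f_mem i⟩
  rw [show A * Y ^ C.κ i / B * E = (A / B * E) * Y ^ C.κ i by ring,
    Real.mul_rpow (mul_nonneg (div_nonneg (h0.1 _) (h0.1 _)) (Real.exp_pos _).le)
      (pow_nonneg hy _), Real.pow_rpow_inv_natCast hy hκ]

theorem absMonom_push {t : ℂ} (ht0 : t ≠ 0) {x : Vec N × (D.normals → ℝ)} (hx : x ∈ D.pairs ε)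
    (hp : C.Near (ε⁻¹ • x.1)) {v : Lat N}
    (hv : ∀ i, ht (C.f i) (ε⁻¹ • x.1) = 0 → 0 ≤ C.f i ⬝ᵥ v) :
    D.absMonom t v (D.push (Real.log ‖t‖) x) = D.absMonom t v x.1 *
      ∏ i, x.2 ⟨C.f i, C.f_mem i⟩ ^ (C.f i ⬝ᵥ v) := by
  have hint := D.pairs_fst_mem_interior hεP hx
  rw [(near_push hε hεP _ hx hp).absMonom_eq ht0 fun i h0 => hv i
      (D.push_tight hε hεP _ hx (C.f_mem i) h0),
    (near_of_mem_interior (C := C) hint).absMonom_eq ht0 fun i h0 => absurd h0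
      (D.mem_interior_iff.1 hint _ (C.f_mem i)).ne', ← Finset.prod_mul_distrib]
  refine Finset.prod_congr rfl fun i _ => ?_
  rw [zeta_push hε hεP _ hx hp, mul_zpow]

end Pairs

end VertexChart

theorem absMonom_pos_of_interior (hN : 1 ≤ N) {t : ℂ} (ht0 : t ≠ 0) {m : Vec N}
    (hm : m ∈ interior D.P) (v : Lat N) : 0 < D.absMonom t v m := by
  obtain ⟨p, ⟨C⟩, -⟩ := D.exists_vertexChart_of_mem hN (interior_subset hm)
  have hC : C.Near m := VertexChart.near_of_mem_interior hm
  have hne : ∀ i, ht (C.f i) m ≠ 0 := fun i => (D.mem_interior_iff.1 hm _ (C.f_mem i)).ne'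
  rw [hC.absMonom_eq ht0 fun i h0 => absurd h0 (hne i)]
  exact Finset.prod_pos fun i _ => zpow_pos (hC.zeta_pos _ (hne i)) _

/-- Monomials in directions parallel to the face of the tip are constant on normal cones. -/
theorem absMonom_push_of_dir (hN : 1 ≤ N) {ε : ℝ} (hε : 0 < ε) (hεP : ε • D.P ⊆ interior D.P)
    {t : ℂ} (ht0 : t ≠ 0) {x : Vec N × (D.normals → ℝ)} (hx : x ∈ D.pairs ε) {v : Lat N}
    (hv : ∀ u ∈ D.normals, ht u (ε⁻¹ • x.1) = 0 → u ⬝ᵥ v = 0) :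
    D.absMonom t v (D.push (Real.log ‖t‖) x) = D.absMonom t v x.1 := by
  have hq := D.pairs_fst_mem hε hx
  obtain ⟨p, ⟨C⟩, hp⟩ := D.exists_vertexChart_of_mem hN hq
  rw [VertexChart.absMonom_push (C := C) hε hεP ht0 hx ⟨hq, hp⟩ fun i h0 =>
    (hv _ (C.f_mem i) h0).ge, Finset.prod_eq_one, mul_one]
  intro i _
  rcases hx.2.2 ⟨C.f i, C.f_mem i⟩ with h | h
  · rw [h, one_zpow]
  · rw [hv _ (C.f_mem i) h, zpow_zero]

end CYData

/-! ### Associated coordinates and normal cones -/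

theorem exists_eq_one_of_sum_eq_one {ι : Type*} {s : Finset ι} {f : ι → ℤ}
    (hf : ∀ i ∈ s, 0 ≤ f i) (h : ∑ i ∈ s, f i = 1) :
    ∃ i ∈ s, f i = 1 ∧ ∀ j ∈ s, j ≠ i → f j = 0 := by
  classical
  obtain ⟨i, hi, hne⟩ := Finset.exists_ne_zero_of_sum_ne_zero (by rw [h]; exact one_ne_zero)
  have h1 := hf i hi
  have hsplit := Finset.add_sum_erase s f hi
  have hnn : ∀ j ∈ s.erase i, 0 ≤ f j := fun j hj => hf j (Finset.mem_of_mem_erase hj)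
  have h2 := Finset.sum_nonneg hnn
  have h3 : ∑ j ∈ s.erase i, f j = 0 := by omega
  refine ⟨i, hi, by omega, fun j hj hji => ?_⟩
  exact (Finset.sum_eq_zero_iff_of_nonneg hnn).1 h3 j (Finset.mem_erase.2 ⟨hji, hj⟩)

namespace CYData

variable {N : ℕ} (D : CYData N)

theorem mem_latticeDir_minFace_iff {q : Vec N} (hq : q ∈ D.P) {z : Lat N} :
    z ∈ latticeDir (minFace D.P {q}) ↔ ∀ u ∈ D.normals, ht u q = 0 → u ⬝ᵥ z = 0 := by
  change latPt z ∈ vectorSpan ℝ _ ↔ _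
  rw [D.mem_vectorSpan_minFace_iff hq]
  refine forall₃_congr fun u _ _ => ?_
  rw [inner_latPt]; exact Int.cast_eq_zero

theorem latPt_mem_polar {u : Lat N} (hu : u ∈ D.normals) : latPt u ∈ polarBody D.P := by
  rw [D.polar_eq]; exact subset_convexHull ℝ _ ⟨u, hu, rfl⟩

/-- The basis dual to associated coordinates: the dual vectors to the last coordinates are the
normals of the facets through the face. -/
theorem exists_dual_assocCoords {τ : Finset (Vec N)} (c : AssocCoords D.P τ) {q : Vec N}
    (hq : q ∈ D.P) (hτq : minFace D.P (τ : Set (Vec N)) = minFace D.P {q}) :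
    ∃ g : Fin N → Lat N,
      (∀ i j, g i ⬝ᵥ (c.pt j - c.base) = if i = j then 1 else 0) ∧
      (∀ z, z = ∑ i, (g i ⬝ᵥ z) • (c.pt i - c.base)) ∧
      (∀ i : Fin N, polyDim (minFace D.P (τ : Set (Vec N))) ≤ i →
        g i ∈ D.normals ∧ ht (g i) q = 0) ∧
      (∀ u ∈ D.normals, ht u q = 0 →
        ∃ i : Fin N, polyDim (minFace D.P (τ : Set (Vec N))) ≤ i ∧ u = g i) := by
  obtain ⟨g, hdual, hexp⟩ := exists_dual (fun i => c.pt i - c.base) c.basis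
  set l := polyDim (minFace D.P (τ : Set (Vec N))) with hl
  have hface : ∀ z : Lat N, z ∈ AddSubgroup.closure
      {z | ∃ i : Fin N, (i : ℕ) < l ∧ z = c.pt i - c.base} ↔
      ∀ u ∈ D.normals, ht u q = 0 → u ⬝ᵥ z = 0 := by
    intro z
    rw [← SetLike.mem_coe, c.face_basis, hτq]
    exact D.mem_latticeDir_minFace_iff hq
  have hlow : ∀ u ∈ D.normals, ht u q = 0 → ∀ i : Fin N, (i : ℕ) < l →
      u ⬝ᵥ (c.pt i - c.base) = 0 := fun u hu h0 i hi =>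
    (hface _).1 (AddSubgroup.subset_closure ⟨i, hi, rfl⟩) u hu h0
  have hbase : ∀ u ∈ D.normals, ht u q = 0 → u ⬝ᵥ c.base = -1 := by
    intro u hu h0
    have h1 : latPt c.base ∈ minFace D.P {q} := hτq ▸ fun F hF => hF.2 c.base_mem
    have h2 := ((D.mem_minFace_singleton hq).1 h1).2 u hu h0
    rw [ht_latPt] at h2
    have : 1 + u ⬝ᵥ c.base = 0 := by exact_mod_cast h2
    linarith
  -- A tight normal vanishes on the basis vectors of the face, is nonnegative on the others by
  -- `regular`, and its values there add up to 1 by `sum_eq`. Integrality leaves a single 1.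
  have hone : ∀ u ∈ D.normals, ht u q = 0 → ∃ i : Fin N, l ≤ i ∧ u = g i := by
    intro u hu h0
    have hnn : ∀ i ∈ Finset.univ.filter fun i : Fin N => l ≤ (i : ℕ),
        0 ≤ u ⬝ᵥ (c.pt i - c.base) := by
      intro i hi
      have := c.regular i (Finset.mem_filter.1 hi).2 (latPt u) (D.latPt_mem_polar hu) (by
        intro m hm
        rw [hτq] at hm
        have := ((D.mem_minFace_singleton hq).1 hm).2 u hu h0
        unfold ht at this; linarith)
      rw [inner_latPt] at this
      exact_mod_cast this
    have hsum : ∑ i ∈ Finset.univ.filter fun i : Fin N => l ≤ (i : ℕ),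
        u ⬝ᵥ (c.pt i - c.base) = 1 := by
      rw [← dotProduct_sum, ← c.sum_eq, dotProduct_neg, hbase u hu h0, neg_neg]
    obtain ⟨i, hi, hi1, hi0⟩ := exists_eq_one_of_sum_eq_one hnn hsum
    refine ⟨i, (Finset.mem_filter.1 hi).2, ?_⟩
    have hall : ∀ k, u ⬝ᵥ (c.pt k - c.base) = if i = k then 1 else 0 := by
      intro k
      by_cases hk : i = k
      · rw [if_pos hk, ← hk, hi1]
      · rw [if_neg hk]
        rcases lt_or_ge (k : ℕ) l with h | h
        · exact hlow u hu h0 k h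
        · exact hi0 k (Finset.mem_filter.2 ⟨Finset.mem_univ _, h⟩) (Ne.symm hk)
    have key : ∀ z, u ⬝ᵥ z = g i ⬝ᵥ z := by
      intro z
      conv_lhs => rw [hexp z]
      rw [dotProduct_sum]
      simp only [dotProduct_smul, hall, smul_eq_mul]
      simp
    funext k
    simpa using key (Pi.single k 1)
  refine ⟨g, hdual, hexp, fun i hi => ?_, hone⟩
  -- Otherwise all tight normals, being other dual vectors, vanish on the i-th basis vector. That
  -- vector would then be parallel to the face, hence generated by the first l vectors, on which g i
  -- is zero.
  by_contra hcon
  have hdir : ∀ u ∈ D.normals, ht u q = 0 → u ⬝ᵥ (c.pt i - c.base) = 0 := by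
    intro u hu h0
    obtain ⟨j, hj, rfl⟩ := hone u hu h0
    rw [hdual, if_neg]
    rintro rfl
    exact hcon ⟨hu, h0⟩
  have hmem := (hface _).2 hdir
  have : ∀ z ∈ AddSubgroup.closure {z | ∃ i : Fin N, (i : ℕ) < l ∧ z = c.pt i - c.base},
      g i ⬝ᵥ z = 0 := by
    intro z hz
    induction hz using AddSubgroup.closure_induction with
    | mem z hz =>
      obtain ⟨k, hk, rfl⟩ := hz
      rw [hdual, if_neg]
      rintro rfl
      omega
    | zero => exact dotProduct_zero _
    | add a b _ _ ha hb => rw [dotProduct_add, ha, hb, add_zero]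
    | neg a _ ha => rw [dotProduct_neg, ha, neg_zero]
  have h1 := this _ hmem
  rw [hdual, if_pos rfl] at h1
  exact one_ne_zero h1

theorem VertexChart.f_injective {p : Lat N} (C : D.VertexChart p) : Function.Injective C.f := by
  intro i j h
  by_contra hij
  have h1 := C.dual i j
  rw [h, C.dual, if_pos rfl, if_neg hij] at h1
  exact one_ne_zero h1

namespace VertexChart

variable {D} {p : Lat N} {C : D.VertexChart p} {m : Vec N}

theorem Near.tendsto_absMonom (hm : C.Near m) {t : ℂ} (ht0 : t ≠ 0) {v : Lat N}
    (hv : ∀ i, ht (C.f i) m = 0 → 0 ≤ C.f i ⬝ᵥ v) :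
    Filter.Tendsto (D.absMonom t v) (𝓝[interior D.P] m) (𝓝 (D.absMonom t v m)) := by
  rw [hm.absMonom_eq ht0 hv]
  have h1 : Filter.Tendsto (fun m' => ∏ i, C.zeta (Real.log ‖t‖) m' i ^ (C.f i ⬝ᵥ v))
      (𝓝[interior D.P] m) (𝓝 (∏ i, C.zeta (Real.log ‖t‖) m i ^ (C.f i ⬝ᵥ v))) := by
    refine tendsto_finsetProd _ fun i _ => ?_
    refine Filter.Tendsto.zpow₀ ((hm.continuousWithinAt_zeta _ i).mono interior_subset) _ ?_
    by_cases h : ht (C.f i) m = 0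
    · exact Or.inr (hv i h)
    · exact Or.inl (hm.zeta_pos _ h).ne'
  refine h1.congr' ?_
  filter_upwards [self_mem_nhdsWithin] with m' hm'
  exact ((near_of_mem_interior hm').absMonom_eq ht0 fun i h0 =>
    absurd h0 (D.mem_interior_iff.1 hm' _ (C.f_mem i)).ne').symm

theorem absMonom_bary_wt (C : D.VertexChart p) {t : ℂ} (ht0 : t ≠ 0) (ξ : Vec N) (v : Lat N) :
    D.absMonom t v (D.bary (D.wt (Real.log ‖t‖) ξ)) = Real.exp (inner ℝ (latPt v) ξ) := by
  have hint := D.bary_wt_mem_interior (Real.log ‖t‖) ξ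
  rw [(near_of_mem_interior (C := C) hint).absMonom_eq ht0 fun i h0 =>
    absurd h0 (D.mem_interior_iff.1 hint _ (C.f_mem i)).ne', C.exp_inner_eq_prod]
  exact Finset.prod_congr rfl fun i _ => by rw [C.zeta_bary_wt]

theorem Near.absMonom_e (hm : C.Near m) {t : ℂ} (ht0 : t ≠ 0) (j : Fin N) :
    D.absMonom t (C.e j) m = C.zeta (Real.log ‖t‖) m j := by
  rw [hm.absMonom_eq ht0 fun i _ => by rw [C.dual]; split_ifs <;> simp,
    Finset.prod_eq_single j]
  · rw [C.dual, if_pos rfl, zpow_one]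
  · intro i _ hij
    rw [C.dual, if_neg hij, zpow_zero]
  · intro h; exact absurd (Finset.mem_univ _) h

/-- Monomials are products of powers of other ones. -/
theorem Near.absMonom_eq_prod (hm : C.Near m) {t : ℂ} (ht0 : t ≠ 0) {v : Lat N}
    {b : Fin N → Lat N} {n : Fin N → ℤ} (hvn : v = ∑ k, n k • b k)
    (hb : ∀ i k, ht (C.f i) m = 0 → 0 ≤ C.f i ⬝ᵥ b k)
    (hn : ∀ k, (∀ i, ht (C.f i) m = 0 → C.f i ⬝ᵥ b k = 0) ∨ 0 ≤ n k) :
    D.absMonom t v m = ∏ k, D.absMonom t (b k) m ^ n k := by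
  have hnb : ∀ i k, ht (C.f i) m = 0 → 0 ≤ n k * (C.f i ⬝ᵥ b k) := by
    intro i k h0
    rcases hn k with h | h
    · rw [h i h0, mul_zero]
    · exact mul_nonneg h (hb i k h0)
  have hv : ∀ i, ht (C.f i) m = 0 → 0 ≤ C.f i ⬝ᵥ v := by
    intro i h0
    rw [hvn, dotProduct_sum]
    refine Finset.sum_nonneg fun k _ => ?_
    rw [dotProduct_smul, smul_eq_mul]
    exact hnb i k h0
  have hpos : ∀ k, (∀ i, ht (C.f i) m = 0 → C.f i ⬝ᵥ b k = 0) → 0 < D.absMonom t (b k) m := by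
    intro k hk
    rw [hm.absMonom_eq ht0 fun i h0 => hb i k h0]
    refine Finset.prod_pos fun i _ => ?_
    by_cases h0 : ht (C.f i) m = 0
    · rw [hk i h0, zpow_zero]; exact one_pos
    · exact zpow_pos (hm.zeta_pos _ h0) _
  have := hm.neBot
  refine tendsto_nhds_unique_of_eventuallyEq (hm.tendsto_absMonom ht0 hv)
    (tendsto_finsetProd _ fun k _ => (hm.tendsto_absMonom ht0 fun i h0 => hb i k h0).zpow₀ (n k) ?_) ?_
  · rcases hn k with h | h
    · exact Or.inl (hpos k h).ne'
    · exact Or.inr h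
  · filter_upwards [self_mem_nhdsWithin] with m' hm'
    obtain ⟨ξ, rfl⟩ := D.exists_bary_wt_eq (Real.log ‖t‖) hm'
    simp only [C.absMonom_bary_wt ht0, ← exp_int_mul, ← Real.exp_sum]
    rw [hvn, latPt_sum, sum_inner]
    congr 1
    refine Finset.sum_congr rfl fun k _ => ?_
    rw [latPt_zsmul, inner_smul_left, conj_trivial]

end VertexChart

theorem subset_minFace (S : Set (Vec N)) : S ⊆ minFace D.P S := fun _ hx _ hF => hF.2 hx

/-- A point of the chart is determined by its associated coordinates. -/
theorem eq_of_coord_eq (hN : 1 ≤ N) {t : ℂ} (ht0 : t ≠ 0) {τ : Finset (Vec N)}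
    (c : AssocCoords D.P τ) {q : Vec N} (hq : q ∈ D.P)
    (hτq : minFace D.P (τ : Set (Vec N)) = minFace D.P {q}) {m m' : Vec N}
    (hm : m ∈ chart D.P (minFace D.P {q})) (hm' : m' ∈ chart D.P (minFace D.P {q}))
    (h : ∀ i, D.coord t c i m = D.coord t c i m') : m = m' := by
  obtain ⟨g, hdual, hexp, hg, hgu⟩ := D.exists_dual_assocCoords c hq hτq
  set l := polyDim (minFace D.P (τ : Set (Vec N))) with hl
  obtain ⟨p, ⟨C⟩, hp⟩ := D.exists_vertexChart_of_mem hN hq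
  have hnear : ∀ z ∈ chart D.P (minFace D.P {q}), C.Near z := fun z hz =>
    ⟨hz.1, fun u hu h0 => hp u hu (((D.mem_chart_iff hq).1 hz).2 u hu h0)⟩
  -- The vertex coordinates are monomials in the associated ones. Negative exponents can occur only
  -- for the first l coordinates, which do not vanish on the chart.
  have hz : ∀ z ∈ chart D.P (minFace D.P {q}), ∀ j, C.zeta (Real.log ‖t‖) z j =
      ∏ k, D.coord t c k z ^ (g k ⬝ᵥ C.e j) := by
    intro z hz j
    have hzt := ((D.mem_chart_iff hq).1 hz).2
    rw [← (hnear z hz).absMonom_e ht0 j]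
    refine (hnear z hz).absMonom_eq_prod ht0 (hexp (C.e j)) ?_ fun k => ?_
    · intro i k h0
      obtain ⟨i', hi', heq⟩ := hgu _ (C.f_mem i) (hzt _ (C.f_mem i) h0)
      rw [heq, hdual]; split_ifs <;> simp
    · rcases lt_or_ge (k : ℕ) l with hk | hk
      · left
        intro i h0
        obtain ⟨i', hi', heq⟩ := hgu _ (C.f_mem i) (hzt _ (C.f_mem i) h0)
        rw [heq, hdual, if_neg]
        rintro rfl; omega
      · right
        obtain ⟨hgk, hgk0⟩ := hg k hk
        obtain ⟨i, hi⟩ := C.tight _ hgk (hp _ hgk hgk0)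
        rw [hi, C.dual]; split_ifs <;> simp
  refine (hnear m hm).eq_of_zeta_eq (hnear m' hm') (L := Real.log ‖t‖) fun j => ?_
  rw [hz m hm, hz m' hm']
  exact Finset.prod_congr rfl fun k _ => by rw [h k]

section Pairs

variable {ε : ℝ} (hN : 1 ≤ N) (hε : 0 < ε) (hεP : ε • D.P ⊆ interior D.P) {t : ℂ} (ht0 : t ≠ 0)
include hN hε hεP ht0

theorem absMonom_push_dual {x : Vec N × (D.normals → ℝ)} (hx : x ∈ D.pairs ε) {v g : Lat N}
    (hg : g ∈ D.normals) (hg0 : ht g (ε⁻¹ • x.1) = 0) (hgv : g ⬝ᵥ v = 1)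
    (hv : ∀ u ∈ D.normals, ht u (ε⁻¹ • x.1) = 0 → u ≠ g → u ⬝ᵥ v = 0) :
    D.absMonom t v (D.push (Real.log ‖t‖) x) = D.absMonom t v x.1 * x.2 ⟨g, hg⟩ := by
  have hq := D.pairs_fst_mem hε hx
  obtain ⟨p, ⟨C⟩, hp⟩ := D.exists_vertexChart_of_mem hN hq
  obtain ⟨i, hi⟩ := C.tight g hg (hp g hg hg0)
  subst hi
  rw [VertexChart.absMonom_push (C := C) hε hεP ht0 hx ⟨hq, hp⟩, Finset.prod_eq_single i]
  · rw [hgv, zpow_one]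
  · intro j _ hji
    rcases hx.2.2 ⟨C.f j, C.f_mem j⟩ with h | h
    · rw [h, one_zpow]
    · rw [hv _ (C.f_mem j) h (fun he => hji (C.f_injective D he)), zpow_zero]
  · intro h; exact absurd (Finset.mem_univ _) h
  · intro j h0
    by_cases hji : j = i
    · rw [hji, hgv]; exact zero_le_one
    · rw [hv _ (C.f_mem j) h0 (fun he => hji (C.f_injective D he))]

variable {τ : Finset (Vec N)} (c : AssocCoords D.P τ)

theorem coord_push_of_lt {x : Vec N × (D.normals → ℝ)} (hx : x ∈ D.pairs ε)
    (hτ : minFace D.P (τ : Set (Vec N)) = minFace D.P {ε⁻¹ • x.1}) {i : Fin N}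
    (hi : (i : ℕ) < polyDim (minFace D.P (τ : Set (Vec N)))) :
    D.coord t c i (D.push (Real.log ‖t‖) x) = D.coord t c i x.1 := by
  have hq := D.pairs_fst_mem hε hx
  obtain ⟨g, hdual, hexp, hg, hgu⟩ := D.exists_dual_assocCoords c hq hτ
  refine D.absMonom_push_of_dir hN hε hεP ht0 hx fun u hu h0 => ?_
  obtain ⟨k, hk, rfl⟩ := hgu u hu h0
  rw [hdual, if_neg]
  rintro rfl; omega

/-- The dictionary between factors and transverse coordinates: the i-th basis vector pairs to 1 with
its dual normal and to 0 with the other tight normals, so the coordinate is scaled by exactly one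
factor. -/
theorem coord_push_of_ge {x : Vec N × (D.normals → ℝ)} (hx : x ∈ D.pairs ε)
    {g : Fin N → Lat N} (hdual : ∀ i j, g i ⬝ᵥ (c.pt j - c.base) = if i = j then 1 else 0)
    (hgu : ∀ u ∈ D.normals, ht u (ε⁻¹ • x.1) = 0 →
        ∃ i : Fin N, polyDim (minFace D.P (τ : Set (Vec N))) ≤ i ∧ u = g i) {i : Fin N}
    (hg : g i ∈ D.normals) (hg0 : ht (g i) (ε⁻¹ • x.1) = 0) :
    D.coord t c i (D.push (Real.log ‖t‖) x) = D.coord t c i x.1 * x.2 ⟨g i, hg⟩ := by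
  refine D.absMonom_push_dual hN hε hεP ht0 hx hg hg0 (by rw [hdual, if_pos rfl])
    fun u hu h0 hne => ?_
  obtain ⟨k, hk, rfl⟩ := hgu u hu h0
  rw [hdual, if_neg]
  rintro rfl; exact hne rfl

omit hε hεP in
theorem coord_pos_of_interior {m : Vec N} (hm : m ∈ interior D.P) (i : Fin N) :
    0 < D.coord t c i m := D.absMonom_pos_of_interior hN ht0 hm _

omit hN hεP ht0 in
theorem fst_mem_of_frontier {s' : Vec N} (hs' : s' ∈ frontier (ε • D.P)) : ε⁻¹ • s' ∈ D.P :=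
  D.frontier_subset_P ((D.mem_frontier_smul_iff hε).1 hs')

/-- Taking the factors to be the ratios m_i / s'_i of the transverse coordinates gives a pushed
point with the same coordinates as m, and a point of the chart is determined by its coordinates. The
pushed description no longer mentions τ or the coordinates. -/
theorem mem_coneIn_iff {s' : Vec N} (hs' : s' ∈ frontier (ε • D.P))
    (hτ : minFace D.P (τ : Set (Vec N)) = minFace D.P {ε⁻¹ • s'}) {m : Vec N} :
    m ∈ D.coneIn t c s' ↔ ∃ y, (s', y) ∈ D.pairs ε ∧ D.push (Real.log ‖t‖) (s', y) = m := by
  have hq := D.fst_mem_of_frontier hε hs'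
  have hint : s' ∈ interior D.P := hεP (D.frontier_smul_subset hs')
  have hpos := D.coord_pos_of_interior hN ht0 c hint
  obtain ⟨g, hdual, hexp, hg, hgu⟩ := D.exists_dual_assocCoords c hq hτ
  set l := polyDim (minFace D.P (τ : Set (Vec N))) with hl
  constructor
  · rintro ⟨hmc, hlow, hhigh⟩
    rw [hτ] at hmc
    have hmt := ((D.mem_chart_iff hq).1 hmc).2
    have hnn : ∀ i : Fin N, 0 ≤ D.coord t c i m := by
      obtain ⟨p, ⟨C⟩, hp⟩ := D.exists_vertexChart_of_mem hN hq
      have hnear : C.Near m := ⟨hmc.1, fun u hu h0 => hp u hu (hmt u hu h0)⟩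
      intro i
      rw [coord, hnear.absMonom_eq ht0]
      · exact Finset.prod_nonneg fun j _ => zpow_nonneg (hnear.zeta_nonneg _ j) _
      · intro j h0
        obtain ⟨k, hk, heq⟩ := hgu _ (C.f_mem j) (hmt _ (C.f_mem j) h0)
        rw [heq, hdual]; split_ifs <;> simp
    -- At most one index k has g k = u; the empty product supplies the required factor 1 for the
    -- normals that are not tight.
    set y : D.normals → ℝ := fun u => ∏ k ∈ Finset.univ.filter
      (fun k : Fin N => l ≤ (k : ℕ) ∧ g k = (u : Lat N)),
        (D.coord t c k m / D.coord t c k s') with hy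
    have hginj : Function.Injective g := by
      intro i j h
      by_contra hij
      have h1 := hdual i j
      rw [h, hdual, if_pos rfl, if_neg hij] at h1
      exact one_ne_zero h1
    have hyg : ∀ k : Fin N, l ≤ (k : ℕ) → ∀ hk : g k ∈ D.normals,
        y ⟨g k, hk⟩ = D.coord t c k m / D.coord t c k s' := by
      intro k hk hkm
      rw [hy]
      simp only
      rw [Finset.prod_eq_single k]
      · intro j hj hjk
        exact absurd (hginj (Finset.mem_filter.1 hj).2.2) hjk
      · intro h
        exact absurd (Finset.mem_filter.2 ⟨Finset.mem_univ _, hk, rfl⟩) h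
    have hpair : (s', y) ∈ D.pairs ε := by
      have hy1 : ∀ u, y u ≤ 1 := fun u => by
        refine Finset.prod_le_one (fun k _ => div_nonneg (hnn k) (hpos k).le) fun k hk => ?_
        exact (div_le_one (hpos k)).2 (hhigh k (Finset.mem_filter.1 hk).2.1)
      have hy0 : ∀ u, 0 ≤ y u := fun u =>
        Finset.prod_nonneg fun k _ => div_nonneg (hnn k) (hpos k).le
      refine ⟨hs', fun u => ⟨hy0 u, hy1 u⟩, fun u => ?_⟩
      by_cases h0 : ht (u : Lat N) (ε⁻¹ • s') = 0
      · exact Or.inr h0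
      · left
        change y u = 1
        refine Finset.prod_eq_one fun k hk => absurd ?_ h0
        obtain ⟨-, hk1, hk2⟩ := Finset.mem_filter.1 hk
        exact hk2 ▸ (hg k hk1).2
    refine ⟨y, hpair, ?_⟩
    refine D.eq_of_coord_eq hN ht0 c hq hτ ?_ hmc fun k => ?_
    · rw [D.mem_chart_iff hq]
      exact ⟨D.push_mem_P hε hεP _ hpair, fun u hu h0 => D.push_tight hε hεP _ hpair hu h0⟩
    · rcases lt_or_ge (k : ℕ) l with hk | hk
      · rw [D.coord_push_of_lt hN hε hεP ht0 c hpair hτ hk]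
        exact (hlow k hk).symm
      · rw [D.coord_push_of_ge hN hε hεP ht0 c hpair hdual hgu (hg k hk).1 (hg k hk).2]
        change D.coord t c k s' * y ⟨g k, _⟩ = _
        rw [hyg k hk, mul_div_cancel₀ _ (hpos k).ne']
  · rintro ⟨y, hpair, rfl⟩
    refine ⟨?_, fun i hi => ?_, fun i hi => ?_⟩
    · rw [hτ, D.mem_chart_iff hq]
      exact ⟨D.push_mem_P hε hεP _ hpair, fun u hu h0 => D.push_tight hε hεP _ hpair hu h0⟩
    · exact D.coord_push_of_lt hN hε hεP ht0 c hpair hτ hi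
    · rw [D.coord_push_of_ge hN hε hεP ht0 c hpair hdual hgu (hg i hi).1 (hg i hi).2]
      exact mul_le_of_le_one_right (hpos i).le (hpair.2.1 _).2

end Pairs

end CYData

/-! ### Existence of associated coordinates -/

/-- In Smith normal form the submodule is generated by multiples of basis vectors, and saturation
allows division by the coefficients. -/
theorem exists_basis_of_saturated {M : Type*} [AddCommGroup M] {n : ℕ}
    (b₀ : Module.Basis (Fin n) ℤ M) (K : Submodule ℤ M)
    (hK : ∀ c : ℤ, c ≠ 0 → ∀ z, c • z ∈ K → z ∈ K) :
    ∃ (b : Module.Basis (Fin n) ℤ M) (s : Set (Fin n)), K = Submodule.span ℤ (b '' s) := by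
  obtain ⟨m, snf⟩ := K.smithNormalForm b₀
  have ha : ∀ i, snf.a i ≠ 0 := by
    intro i h
    have h1 := snf.snf i
    rw [h, zero_smul] at h1
    exact snf.bN.ne_zero i (Subtype.ext h1)
  refine ⟨snf.bM, range snf.f, le_antisymm (fun z hz => ?_) (Submodule.span_le.2 ?_)⟩
  · have h1 := congrArg (Submodule.subtype K) (snf.bN.sum_repr ⟨z, hz⟩)
    simp only [map_sum, map_smul, Submodule.subtype_apply] at h1
    rw [← h1]
    refine Submodule.sum_mem _ fun i _ => Submodule.smul_mem _ _ ?_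
    rw [snf.snf]
    exact Submodule.smul_mem _ _ (Submodule.subset_span ⟨_, ⟨i, rfl⟩, rfl⟩)
  · rintro _ ⟨_, ⟨i, rfl⟩, rfl⟩
    refine hK _ (ha i) _ ?_
    rw [← snf.snf]
    exact (snf.bN i).2

theorem mem_iff_lt_card_of_lower {n : ℕ} (S : Finset (Fin n))
    (h : ∀ i j, i ≤ j → j ∈ S → i ∈ S) (i : Fin n) : i ∈ S ↔ (i : ℕ) < S.card := by
  constructor
  · intro hi
    have : Finset.Iic i ⊆ S := fun j hj => h j i (Finset.mem_Iic.1 hj) hi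
    have := Finset.card_le_card this
    rw [Fin.card_Iic] at this; omega
  · intro hi
    by_contra hcon
    have : S ⊆ Finset.Iio i := fun j hj => Finset.mem_Iio.2 <| by
      by_contra hji
      exact hcon (h i j (not_lt.1 hji) hj)
    have := Finset.card_le_card this
    rw [Fin.card_Iio] at this; omega

/-- The lattice vectors parallel to a set, as a submodule. -/
def latticeDirSubmodule {N : ℕ} (S : Set (Vec N)) : Submodule ℤ (Lat N) where
  carrier := latticeDir S
  add_mem' {a b} ha hb := by
    change latPt (a + b) ∈ vectorSpan ℝ S
    rw [latPt_add]; exact Submodule.add_mem _ ha hb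
  zero_mem' := by
    change latPt 0 ∈ vectorSpan ℝ S
    rw [latPt_zero]; exact Submodule.zero_mem _
  smul_mem' c a ha := by
    change latPt (c • a) ∈ vectorSpan ℝ S
    rw [latPt_zsmul]; exact Submodule.smul_mem _ _ ha

theorem mem_latticeDir_of_smul {N : ℕ} {S : Set (Vec N)} {c : ℤ} (hc : c ≠ 0) {z : Lat N}
    (h : c • z ∈ latticeDir S) : z ∈ latticeDir S := by
  change latPt (c • z) ∈ vectorSpan ℝ S at h
  change latPt z ∈ vectorSpan ℝ S
  rw [latPt_zsmul] at h
  have hc' : (c : ℝ) ≠ 0 := Int.cast_ne_zero.2 hc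
  have := Submodule.smul_mem _ (c : ℝ)⁻¹ h
  rwa [smul_smul, inv_mul_cancel₀ hc', one_smul] at this

/-- A ℤ-basis of the lattice stays independent over ℝ, as pairing with the dual basis shows. The
hypothesis that lattice vectors span the direction of S is what lets the dimension be counted on the
lattice. -/
theorem polyDim_eq_card {N : ℕ} {S : Set (Vec N)}
    (hS : vectorSpan ℝ S ≤ Submodule.span ℝ (latPt '' latticeDir S)) {b : Fin N → Lat N}
    (hb : AddSubgroup.closure (range b) = ⊤) (I : Finset (Fin N))
    (hI : latticeDir S = (Submodule.span ℤ (b '' (I : Set (Fin N))) : Set (Lat N))) :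
    polyDim S = I.card := by
  obtain ⟨g, hdual, -⟩ := exists_dual b hb
  have hli : LinearIndependent ℝ fun i => latPt (b i) := by
    rw [Fintype.linearIndependent_iff]
    intro c hc i
    have := congrArg (fun x => inner ℝ (latPt (g i)) x) hc
    simp only [inner_sum, inner_smul_right, inner_latPt, hdual, inner_zero_right] at this
    simpa using this
  have hspan : vectorSpan ℝ S = Submodule.span ℝ (range fun i : I => latPt (b i)) := by
    refine le_antisymm (hS.trans (Submodule.span_le.2 ?_)) (Submodule.span_le.2 ?_)
    · rintro _ ⟨z, hz, rfl⟩
      rw [hI, SetLike.mem_coe] at hz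
      change latPt z ∈ Submodule.span ℝ (range fun i : I => latPt (b i))
      induction hz using Submodule.span_induction with
      | mem z hz =>
        obtain ⟨i, hi, rfl⟩ := hz
        exact Submodule.subset_span ⟨⟨i, hi⟩, rfl⟩
      | zero => rw [latPt_zero]; exact Submodule.zero_mem _
      | add x y _ _ hx hy => rw [latPt_add]; exact Submodule.add_mem _ hx hy
      | smul c x _ hx => rw [latPt_zsmul]; exact Submodule.smul_mem _ _ hx
    · rintro _ ⟨i, rfl⟩
      have : b i ∈ latticeDir S := by
        rw [hI]; exact Submodule.subset_span ⟨i, i.2, rfl⟩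
      exact this
  have h := finrank_span_eq_card (hli.comp ((↑) : I → Fin N) Subtype.val_injective)
  rw [polyDim, hspan]
  exact h.trans (Fintype.card_coe I)

theorem sum_inner_smul_eq {N : ℕ} {e f : Fin N → Lat N}
    (h : ∀ z : Lat N, z = ∑ i, (f i ⬝ᵥ z) • e i) (z : Vec N) :
    z = ∑ i, (inner ℝ (latPt (f i)) z : ℝ) • latPt (e i) := by
  have h1 : ∀ k : Fin N, latPt (Pi.single k 1 : Lat N) =
      ∑ i, (f i k : ℝ) • latPt (e i) := by
    intro k
    conv_lhs => rw [h (Pi.single k 1)]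
    simp [latPt_sum, latPt_zsmul, -zsmul_eq_mul]
  have h2 : z = ∑ k, z k • latPt (Pi.single k 1 : Lat N) := by
    ext j
    simp [latPt, Pi.single_apply]
  have h3 : ∀ i, (inner ℝ (latPt (f i)) z : ℝ) = ∑ k, z k * f i k := by
    intro i
    simp [latPt, PiLp.inner_apply]
  simp only [h3, Finset.sum_smul]
  conv_lhs => rw [h2]
  simp only [h1, Finset.smul_sum, smul_smul]
  exact Finset.sum_comm

theorem exists_sorting_equiv {κ : Type*} [Fintype κ] {n : ℕ} (hn : Fintype.card κ = n)
    (key : κ → ℕ) : ∃ σ : Fin n ≃ κ, Monotone fun i => key (σ i) := by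
  classical
  let e : Fin n ≃ κ := (Fintype.equivFinOfCardEq hn).symm
  exact ⟨(Tuple.sort fun i => key (e i)).trans e, Tuple.monotone_sort fun i => key (e i)⟩

namespace CYData

variable {N : ℕ} (D : CYData N)

theorem exists_latPt_eq_of_mem_face {τ : Finset (Vec N)} (hτ : τ ∈ D.T.faces) {v : Vec N}
    (hv : v ∈ τ) : ∃ z ∈ D.A, latPt z = v := by
  have : v ∈ D.T.vertices := D.T.down_closed hτ (Finset.singleton_subset_iff.2 hv)
    (Finset.singleton_nonempty v)
  obtain ⟨z, hz, rfl⟩ := D.vertices_subset this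
  exact ⟨z, hz, rfl⟩

theorem coe_subset_P {τ : Finset (Vec N)} (hτ : τ ∈ D.T.faces) : (τ : Set (Vec N)) ⊆ D.P := by
  intro v hv
  obtain ⟨z, hz, rfl⟩ := D.exists_latPt_eq_of_mem_face hτ hv
  exact D.latPt_mem hz

theorem face_nonempty {τ : Finset (Vec N)} (hτ : τ ∈ D.T.faces) : τ.Nonempty :=
  D.T.nonempty_of_mem_faces hτ

theorem polyDim_face {τ : Finset (Vec N)} (hτ : τ ∈ D.T.faces) :
    polyDim (τ : Set (Vec N)) + 1 = τ.card := by
  have h := D.T.indep hτ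
  have hc : Fintype.card ((τ : Set (Vec N))) = (τ.card - 1) + 1 := by
    have := Finset.card_pos.2 (D.face_nonempty hτ)
    simp; omega
  have h1 : Module.finrank ℝ (vectorSpan ℝ (range fun x : (τ : Set (Vec N)) => x.1)) =
      τ.card - 1 := h.finrank_vectorSpan hc
  rw [show (fun x : (τ : Set (Vec N)) => x.1) = Subtype.val from rfl, Subtype.range_coe] at h1
  have h2 : polyDim (τ : Set (Vec N)) = τ.card - 1 := h1
  have := Finset.card_pos.2 (D.face_nonempty hτ)
  omega

theorem vectorSpan_face_le {τ : Finset (Vec N)} (hτ : τ ∈ D.T.faces) :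
    vectorSpan ℝ (τ : Set (Vec N)) ≤
      Submodule.span ℝ (latPt '' latticeDir (τ : Set (Vec N))) := by
  refine Submodule.span_le.2 ?_
  rintro _ ⟨x, hx, y, hy, rfl⟩
  obtain ⟨a, -, rfl⟩ := D.exists_latPt_eq_of_mem_face hτ hx
  obtain ⟨b, -, rfl⟩ := D.exists_latPt_eq_of_mem_face hτ hy
  refine Submodule.subset_span ⟨a - b, ?_, by rw [latPt_sub]; rfl⟩
  change latPt (a - b) ∈ vectorSpan ℝ _
  rw [latPt_sub]
  exact vsub_mem_vectorSpan ℝ hx hy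

/-- In the expansion along the edges at a vertex of the face, a vector parallel to the face has zero
coefficient at every edge transverse to the face; the remaining edge vectors are lattice vectors of
the face. -/
theorem vectorSpan_minFace_le (hN : 1 ≤ N) {q : Vec N} (hq : q ∈ D.P) :
    vectorSpan ℝ (minFace D.P {q}) ≤
      Submodule.span ℝ (latPt '' latticeDir (minFace D.P {q})) := by
  obtain ⟨p, ⟨C⟩, hp⟩ := D.exists_vertexChart_of_mem hN hq
  intro z hz
  have hz' := (D.mem_vectorSpan_minFace_iff hq).1 hz
  have hexp := sum_inner_smul_eq C.expand z
  rw [hexp]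
  refine Submodule.sum_mem _ fun i _ => ?_
  by_cases h0 : ht (C.f i) q = 0
  · rw [hz' _ (C.f_mem i) h0, zero_smul]; exact Submodule.zero_mem _
  · refine Submodule.smul_mem _ _ (Submodule.subset_span ⟨C.e i, ?_, rfl⟩)
    rw [D.mem_latticeDir_minFace_iff hq]
    intro u hu hu0
    obtain ⟨j, rfl⟩ := C.tight u hu (hp u hu hu0)
    rw [C.dual, if_neg]
    rintro rfl; exact h0 hu0

/-- The lattice of τ is saturated in that of its face, so a basis of the former extends to one of
the latter. The transverse edge vectors at a vertex of the face complete it to a basis of ℤ^N, after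
a correction parallel to the face that makes their sum equal to -Ω. -/
theorem exists_assocCoords (hN : 1 ≤ N) {τ : Finset (Vec N)} (hτ : τ ∈ D.T.faces) {q : Vec N}
    (hq : q ∈ frontier D.P) (hτq : minFace D.P (τ : Set (Vec N)) = minFace D.P {q}) :
    Nonempty (AssocCoords D.P τ) := by
  classical
  obtain ⟨hqP, u₀, hu₀, hu₀q⟩ := D.mem_frontier_iff.1 hq
  obtain ⟨p, ⟨C⟩, hp⟩ := D.exists_vertexChart_of_mem hN hqP
  obtain ⟨j₀, rfl⟩ := C.tight u₀ hu₀ (hp u₀ hu₀ hu₀q)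
  have hτΘ : (τ : Set (Vec N)) ⊆ minFace D.P {q} := hτq ▸ subset_minFace D (τ : Set (Vec N))
  obtain ⟨v₀, hv₀⟩ := D.face_nonempty hτ
  obtain ⟨Ω, hΩA, rfl⟩ := D.exists_latPt_eq_of_mem_face hτ hv₀
  set T : Finset (Fin N) := Finset.univ.filter fun j => ht (C.f j) q = 0 with hT
  have hTm : ∀ j, j ∈ T ↔ ht (C.f j) q = 0 := fun j => by simp [hT]
  have hΩT : ∀ j ∈ T, C.f j ⬝ᵥ Ω = -1 := by
    intro j hj
    have := ((D.mem_minFace_singleton hqP).1 (hτΘ hv₀)).2 _ (C.f_mem j) ((hTm j).1 hj)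
    rw [ht_latPt] at this
    have : 1 + C.f j ⬝ᵥ Ω = 0 := by exact_mod_cast this
    linarith
  set L2 : Submodule ℤ (Lat N) := latticeDirSubmodule (minFace D.P {q}) with hL2
  set L1 : Submodule ℤ (Lat N) := latticeDirSubmodule (τ : Set (Vec N)) with hL1
  have hL12 : L1 ≤ L2 := fun z hz => vectorSpan_mono ℝ hτΘ hz
  have hL2m : ∀ z, z ∈ L2 ↔ ∀ j ∈ T, C.f j ⬝ᵥ z = 0 := by
    intro z
    refine (D.mem_latticeDir_minFace_iff hqP).trans ⟨fun h j hj => h _ (C.f_mem j) ((hTm j).1 hj),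
      fun h u hu hu0 => ?_⟩
    obtain ⟨j, rfl⟩ := C.tight u hu (hp u hu hu0)
    exact h j ((hTm j).2 hu0)
  obtain ⟨n, b₀⟩ := Submodule.basisOfPid (Pi.basisFun ℤ (Fin N)) L2
  obtain ⟨b, s, hs⟩ := exists_basis_of_saturated b₀ (L1.comap L2.subtype) (by
    intro c hc z hz
    exact mem_latticeDir_of_smul hc hz)
  have hL1s : L1 = Submodule.span ℤ ((fun i => (b i : Lat N)) '' s) := by
    have h1 := congrArg (Submodule.map L2.subtype) hs
    rw [Submodule.map_comap_subtype, inf_eq_right.2 hL12, Submodule.map_span, image_image] at h1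
    exact h1
  have hL2s : L2 = Submodule.span ℤ (range fun i => (b i : Lat N)) := by
    have h1 := congrArg (Submodule.map L2.subtype) b.span_eq
    rw [Submodule.map_subtype_top, Submodule.map_span, ← range_comp] at h1
    exact h1.symm
  -- The defect in the required sum. Both -Ω and the sum of the transverse edge vectors pair to 1
  -- with each tight normal, so w is parallel to the face; adding it to the single vector e_{j₀}
  -- repairs the sum without changing the pairings. That T is nonempty uses that q is a boundary
  -- point.
  set w : Lat N := -Ω - ∑ j ∈ T, C.e j with hw
  have hwL : w ∈ L2 := by
    rw [hL2m]
    intro j hj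
    rw [hw, dotProduct_sub, dotProduct_neg, hΩT j hj, dotProduct_sum]
    simp [C.dual, hj]
  have hj₀ : j₀ ∈ T := (hTm j₀).2 hu₀q
  set e' : Fin N → Lat N := fun j => C.e j + if j = j₀ then w else 0 with he'
  have hfe' : ∀ i ∈ T, ∀ j, C.f i ⬝ᵥ e' j = if i = j then 1 else 0 := by
    intro i hi j
    rw [he']
    simp only
    rw [dotProduct_add, C.dual]
    split_ifs <;> simp [(hL2m w).1 hwL i hi]
  have hsume' : ∑ j ∈ T, e' j = -Ω := by
    rw [he']
    simp only
    rw [Finset.sum_add_distrib, Finset.sum_ite_eq' T j₀, if_pos hj₀, hw]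
    abel
  let B : Fin n ⊕ T → Lat N := Sum.elim (fun i => (b i : Lat N)) fun j => e' j
  have hBli : LinearIndependent ℤ B := by
    rw [Fintype.linearIndependent_iff]
    intro c hc
    rw [Fintype.sum_sum_type] at hc
    simp only [B, Sum.elim_inl, Sum.elim_inr] at hc
    have hr : ∀ j : T, c (Sum.inr j) = 0 := by
      intro j
      have h1 := congrArg (fun z => C.f j ⬝ᵥ z) hc
      simp only [dotProduct_add, dotProduct_sum, dotProduct_smul, dotProduct_zero,
        (hL2m _).1 (b _).2 j j.2, hfe' j j.2, smul_zero, Finset.sum_const_zero, zero_add] at h1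
      have h2 : ∀ k : T, c (Sum.inr k) • (if (j : Fin N) = k then (1 : ℤ) else 0) =
          if j = k then c (Sum.inr k) else 0 := by
        intro k
        by_cases hjk : j = k
        · simp [hjk]
        · rw [if_neg hjk, if_neg (fun h => hjk (Subtype.ext h)), smul_zero]
      simp only [h2] at h1
      simpa using h1
    simp only [hr, zero_smul, Finset.sum_const_zero, add_zero] at hc
    have hl := Fintype.linearIndependent_iff.1 b.linearIndependent (fun i => c (Sum.inl i))
      (by
        apply Subtype.ext
        simpa using hc)
    rintro (i | j)
    · exact hl i
    · exact hr j
  have hBspan : ⊤ ≤ Submodule.span ℤ (range B) := by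
    intro z _
    have h1 : z - ∑ j : T, (C.f j ⬝ᵥ z) • e' j ∈ L2 := by
      rw [hL2m]
      intro i hi
      rw [dotProduct_sub, dotProduct_sum, sub_eq_zero]
      simp only [dotProduct_smul, hfe' i hi]
      rw [Finset.sum_coe_sort T fun j => (C.f j ⬝ᵥ z) • if i = j then (1 : ℤ) else 0]
      simp [hi]
    have h2 : z = (z - ∑ j : T, (C.f j ⬝ᵥ z) • e' j) + ∑ j : T, (C.f j ⬝ᵥ z) • e' j := by abel
    rw [h2]
    refine Submodule.add_mem _ ?_ (Submodule.sum_mem _ fun j _ => Submodule.smul_mem _ _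
      (Submodule.subset_span ⟨Sum.inr j, rfl⟩))
    rw [hL2s] at h1
    refine Submodule.span_mono ?_ h1
    rintro _ ⟨i, rfl⟩
    exact ⟨Sum.inl i, rfl⟩
  have hcard : Fintype.card (Fin n ⊕ T) = N := by
    have := Module.finrank_eq_card_basis (Module.Basis.mk hBli hBspan)
    rw [← this]; simp
  -- Sorting by this key puts the vectors along τ first, then the remaining ones along the face,
  -- then the transverse ones, as the numbering of associated coordinates demands.
  let key : Fin n ⊕ T → ℕ := Sum.elim (fun i => if i ∈ s then 0 else 1) fun _ => 2
  obtain ⟨σ, hσ⟩ := exists_sorting_equiv hcard key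
  have hvspan : AddSubgroup.closure (range fun i => B (σ i)) = ⊤ := by
    have : (range fun i => B (σ i)) = range B := σ.surjective.range_comp B
    rw [this, ← Submodule.span_int_eq_addSubgroupClosure, top_le_iff.1 hBspan]
    rfl
  have hlow : ∀ c : ℕ, ∀ i, (i ∈ Finset.univ.filter fun i => key (σ i) ≤ c) ↔
      (i : ℕ) < (Finset.univ.filter fun i => key (σ i) ≤ c).card := fun c i =>
    mem_iff_lt_card_of_lower _ (fun i j hij hj => by
      rw [Finset.mem_filter] at hj ⊢
      exact ⟨Finset.mem_univ _, (hσ hij).trans hj.2⟩) i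
  have him1 : (fun i => B (σ i)) '' ((Finset.univ.filter fun i => key (σ i) ≤ 0 : Finset (Fin N)) :
      Set (Fin N)) = (fun i => (b i : Lat N)) '' s := by
    ext z
    constructor
    · rintro ⟨i, hi, rfl⟩
      have hi' : key (σ i) ≤ 0 := (Finset.mem_filter.1 hi).2
      rcases h : σ i with k | k
      · rw [h] at hi'
        refine ⟨k, ?_, by simp [B, h]⟩
        by_contra hk
        simp [key, hk] at hi'
      · rw [h] at hi'; simp [key] at hi'
    · rintro ⟨k, hk, rfl⟩
      refine ⟨σ.symm (Sum.inl k), ?_, by simp [B]⟩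
      simp [key, hk]
  have him2 : (fun i => B (σ i)) '' ((Finset.univ.filter fun i => key (σ i) ≤ 1 : Finset (Fin N)) :
      Set (Fin N)) = range fun i => (b i : Lat N) := by
    ext z
    constructor
    · rintro ⟨i, hi, rfl⟩
      have hi' : key (σ i) ≤ 1 := (Finset.mem_filter.1 hi).2
      rcases h : σ i with k | k
      · exact ⟨k, by simp [B, h]⟩
      · rw [h] at hi'; simp [key] at hi'
    · rintro ⟨k, rfl⟩
      refine ⟨σ.symm (Sum.inl k), ?_, by simp [B]⟩
      simp only [Finset.coe_filter, Finset.mem_univ, true_and, mem_ofPred_eq, Equiv.apply_symm_apply,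
        key, Sum.elim_inl]
      split_ifs <;> simp
  have hc1 := polyDim_eq_card (D.vectorSpan_face_le hτ) hvspan _
    (show latticeDir (τ : Set (Vec N)) = _ by rw [him1, ← hL1s]; rfl)
  have hc2 := polyDim_eq_card (D.vectorSpan_minFace_le hN hqP) hvspan _
    (show latticeDir (minFace D.P {q}) = _ by rw [him2, ← hL2s]; rfl)
  have hτc := D.polyDim_face hτ
  have hface2 : ∀ i : Fin N, (i : ℕ) < polyDim (minFace D.P {q}) ↔ key (σ i) ≤ 1 := by
    intro i; rw [hc2, ← hlow]; simp
  have hface1 : ∀ i : Fin N, (i : ℕ) + 1 < τ.card ↔ key (σ i) ≤ 0 := by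
    intro i; rw [← hτc, hc1, Nat.add_lt_add_iff_right, ← hlow]; simp
  refine ⟨⟨Ω, fun i => Ω + B (σ i), hv₀, ?_, ?_, ?_, ?_, ?_⟩⟩
  · simpa using hvspan
  · have : {z | ∃ i : Fin N, (i : ℕ) + 1 < τ.card ∧ z = Ω + B (σ i) - Ω} =
        (fun i => (b i : Lat N)) '' s := by
      rw [← him1]
      ext z
      simp [hface1, eq_comm]
    rw [this, ← Submodule.span_int_eq_addSubgroupClosure, ← hL1s]; rfl
  · rw [hτq]
    have : {z | ∃ i : Fin N, (i : ℕ) < polyDim (minFace D.P {q}) ∧ z = Ω + B (σ i) - Ω} =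
        range fun i => (b i : Lat N) := by
      rw [← him2]
      ext z
      simp [hface2, eq_comm]
    rw [this, ← Submodule.span_int_eq_addSubgroupClosure, ← hL2s]; rfl
  · rw [hτq, ← hsume', ← Finset.sum_coe_sort T e']
    simp only [add_sub_cancel_left]
    rw [Finset.sum_filter, ← Equiv.sum_comp σ.symm]
    simp only [Equiv.apply_symm_apply]
    rw [Fintype.sum_sum_type]
    have hinl : ∀ i : Fin n, ¬ polyDim (minFace D.P {q}) ≤ (σ.symm (Sum.inl i) : ℕ) := by
      intro i
      rw [not_le, hface2]
      simp only [Equiv.apply_symm_apply, key, Sum.elim_inl]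
      split_ifs <;> simp
    have hinr : ∀ j : T, polyDim (minFace D.P {q}) ≤ (σ.symm (Sum.inr j) : ℕ) := by
      intro j
      by_contra hcon
      have := (hface2 _).1 (not_le.1 hcon)
      simp [key] at this
    simp [hinl, hinr, B]
  · rw [hτq]
    intro i hi u hu hu1
    have hvs : ∀ z ∈ vectorSpan ℝ (minFace D.P {q}), inner ℝ u z = 0 := by
      have : vectorSpan ℝ (minFace D.P {q}) ≤
          LinearMap.ker (innerSL ℝ u : Vec N →L[ℝ] ℝ).toLinearMap := by
        refine Submodule.span_le.2 ?_
        rintro _ ⟨x, hx, y, hy, rfl⟩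
        simp [inner_sub_right, hu1 x hx, hu1 y hy]
      intro z hz
      simpa using this hz
    have hkey : ¬ key (σ i) ≤ 1 := fun h => absurd ((hface2 i).2 h) (not_lt.2 hi)
    simp only [add_sub_cancel_left]
    rcases h : σ i with k | k
    · rw [h] at hkey
      exfalso; apply hkey
      simp only [key, Sum.elim_inl]
      split_ifs <;> simp
    · simp only [B, Sum.elim_inr, he']
      rw [latPt_add, inner_add_right]
      have h1 : inner ℝ u (latPt (if (k : Fin N) = j₀ then w else 0)) = 0 := by
        split_ifs
        · exact hvs _ hwL
        · rw [latPt_zero, inner_zero_right]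
      -- Here u is any polar vector equal to -1 on the face, not necessarily one of the chosen
      -- normals. Comparing its values at a_k, at least -1, and at p, equal to -1, gives the sign on
      -- the edge vector.
      have h2 := hu _ (D.latPt_mem (C.a_mem k))
      have h3 : latPt p ∈ minFace D.P {q} :=
        (D.mem_minFace_singleton hqP).2 ⟨D.latPt_mem C.p_mem, hp⟩
      rw [C.a_eq, latPt_add, latPt_zsmul, inner_add_right, inner_smul_right, hu1 _ h3] at h2
      have h4 : (0 : ℝ) < ((C.κ k : ℤ) : ℝ) := by exact_mod_cast C.κ_pos k
      rw [h1, add_zero]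
      exact nonneg_of_mul_nonneg_right (by linarith) h4

end CYData

/-! ### Curved normal cones and intervals -/

namespace CYData

variable {N : ℕ} (D : CYData N)

theorem exists_face_pos {q : Vec N} (hq : q ∈ D.P) :
    ∃ ρ ∈ D.T.faces, ∃ w : Vec N → ℝ, (∀ v ∈ ρ, 0 < w v) ∧ ∑ v ∈ ρ, w v = 1 ∧
      ∑ v ∈ ρ, w v • v = q := by
  classical
  rw [← D.space_eq, Geometry.SimplicialComplex.mem_space_iff] at hq
  obtain ⟨s, hs, hqs⟩ := hq
  rw [Finset.mem_convexHull'] at hqs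
  obtain ⟨w, hw0, hw1, hwq⟩ := hqs
  have h1 : ∑ v ∈ s.filter (fun v => w v ≠ 0), w v = 1 := by
    rw [Finset.sum_filter_ne_zero, hw1]
  refine ⟨s.filter fun v => w v ≠ 0, D.T.down_closed hs (Finset.filter_subset _ _) ?_, w, ?_, h1, ?_⟩
  · by_contra hne
    rw [Finset.not_nonempty_iff_eq_empty] at hne
    rw [hne, Finset.sum_empty] at h1
    exact zero_ne_one h1
  · intro v hv
    rw [Finset.mem_filter] at hv
    exact lt_of_le_of_ne (hw0 v hv.1) (Ne.symm hv.2)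
  · rw [← hwq]
    refine Finset.sum_subset (Finset.filter_subset _ _) fun v hv hv' => ?_
    have : w v = 0 := by
      by_contra h
      exact hv' (Finset.mem_filter.2 ⟨hv, h⟩)
    rw [this, zero_smul]

theorem ht_eq_zero_iff_of_pos {ρ : Finset (Vec N)} (hρ : ρ ∈ D.T.faces) {w : Vec N → ℝ}
    (hw0 : ∀ v ∈ ρ, 0 < w v) (hw1 : ∑ v ∈ ρ, w v = 1) {u : Lat N} (hu : u ∈ D.normals) :
    ht u (∑ v ∈ ρ, w v • v) = 0 ↔ ∀ v ∈ ρ, ht u v = 0 := by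
  constructor
  · intro h v hv
    exact D.ht_eq_zero_of_sum hu (fun v hv => D.coe_subset_P hρ hv) (fun v hv => (hw0 v hv).le) hw1 h
      hv (hw0 v hv)
  · intro h
    rw [ht_sum ρ u w (fun v => v) hw1]
    exact Finset.sum_eq_zero fun v hv => by rw [h v hv, mul_zero]

theorem minFace_eq_of_pos {ρ : Finset (Vec N)} (hρ : ρ ∈ D.T.faces) {w : Vec N → ℝ}
    (hw0 : ∀ v ∈ ρ, 0 < w v) (hw1 : ∑ v ∈ ρ, w v = 1) {q : Vec N} (hq : ∑ v ∈ ρ, w v • v = q) :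
    minFace D.P (ρ : Set (Vec N)) = minFace D.P {q} := by
  have hqP : q ∈ D.P := hq ▸ D.convex_P.sum_mem (fun v hv => (hw0 v hv).le) hw1
    fun v hv => D.coe_subset_P hρ hv
  ext x
  rw [D.mem_minFace_iff (D.face_nonempty hρ) (D.coe_subset_P hρ), D.mem_minFace_singleton hqP]
  refine and_congr_right fun _ => forall₂_congr fun u hu => ?_
  rw [← hq, D.ht_eq_zero_iff_of_pos hρ hw0 hw1 hu]
  rfl

theorem mem_bdry_of_pos {ρ : Finset (Vec N)} (hρ : ρ ∈ D.T.faces) {w : Vec N → ℝ}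
    (hw0 : ∀ v ∈ ρ, 0 < w v) (hw1 : ∑ v ∈ ρ, w v = 1) {q : Vec N} (hq : ∑ v ∈ ρ, w v • v = q)
    (hqf : q ∈ frontier D.P) : ρ ∈ D.bdry := by
  obtain ⟨-, u, hu, hu0⟩ := D.mem_frontier_iff.1 hqf
  rw [← hq, D.ht_eq_zero_iff_of_pos hρ hw0 hw1 hu] at hu0
  refine ⟨hρ, fun x hx => ?_⟩
  have hxP : x ∈ D.P := convexHull_min (D.coe_subset_P hρ) D.convex_P hx
  refine D.mem_frontier_iff.2 ⟨hxP, u, hu, ?_⟩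
  rw [Finset.mem_convexHull'] at hx
  obtain ⟨c, -, hc1, rfl⟩ := hx
  rw [ht_sum ρ u c (fun v => v) hc1]
  exact Finset.sum_eq_zero fun v hv => by rw [hu0 v hv, mul_zero]

theorem exists_carries {ε : ℝ} (hε : 0 < ε) {s' : Vec N} (hs' : s' ∈ frontier (ε • D.P)) :
    ∃ τ, D.Carries ε τ s' := by
  rw [D.mem_frontier_smul_iff hε] at hs'
  obtain ⟨ρ, hρ, w, hw0, hw1, hq⟩ := D.exists_face_pos (D.frontier_subset_P hs')
  exact ⟨ρ, D.mem_bdry_of_pos hρ hw0 hw1 hq hs', D.minFace_eq_of_pos hρ hw0 hw1 hq⟩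

theorem exists_carries_assocCoords (hN : 1 ≤ N) {ε : ℝ} (hε : 0 < ε) {s' : Vec N}
    (hs' : s' ∈ frontier (ε • D.P)) :
    ∃ τ, D.Carries ε τ s' ∧ Nonempty (AssocCoords D.P τ) := by
  obtain ⟨τ, hτ⟩ := D.exists_carries hε hs'
  exact ⟨τ, hτ, D.exists_assocCoords hN hτ.1.1 ((D.mem_frontier_smul_iff hε).1 hs') hτ.2⟩

/-- Move the factors of a pair towards `1`. -/
def slide (x : Vec N × (D.normals → ℝ)) (θ : ℝ) : Vec N × (D.normals → ℝ) :=
  (x.1, fun u => (1 - θ) * x.2 u + θ)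

theorem slide_mem {ε : ℝ} {x : Vec N × (D.normals → ℝ)} (hx : x ∈ D.pairs ε) {θ : ℝ}
    (hθ : θ ∈ Icc (0 : ℝ) 1) : D.slide x θ ∈ D.pairs ε := by
  refine ⟨hx.1, fun u => ?_, fun u => ?_⟩
  · have h := hx.2.1 u
    change (1 - θ) * x.2 u + θ ∈ Icc (0 : ℝ) 1
    constructor
    · nlinarith [h.1, h.2, hθ.1, hθ.2, mul_nonneg (sub_nonneg.2 hθ.2) h.1]
    · nlinarith [h.1, h.2, hθ.1, hθ.2, mul_nonneg (sub_nonneg.2 hθ.2) (sub_nonneg.2 h.2)]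
  · refine (hx.2.2 u).imp (fun h => ?_) id
    change (1 - θ) * x.2 u + θ = 1
    rw [h]; ring

section Pairs

variable {ε : ℝ} (hN : 1 ≤ N) (hε : 0 < ε) (hεP : ε • D.P ⊆ interior D.P) {t : ℂ} (ht0 : t ≠ 0)
include hN hε hεP ht0

/-- The union over all choices in the definition collapses, since each choice gives the same set;
existence of associated coordinates keeps the union from being empty. -/
theorem mem_normalCone_iff {s' : Vec N} (hs' : s' ∈ frontier (ε • D.P)) {m : Vec N} :
    m ∈ D.normalCone t ε s' ↔ ∃ y, (s', y) ∈ D.pairs ε ∧ D.push (Real.log ‖t‖) (s', y) = m := by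
  constructor
  · rintro ⟨τ, hτ, c, hm⟩
    exact (D.mem_coneIn_iff hN hε hεP ht0 c hs' hτ.2).1 hm
  · intro h
    obtain ⟨τ, hτ, ⟨c⟩⟩ := D.exists_carries_assocCoords hN hε hs'
    exact ⟨τ, hτ, c, (D.mem_coneIn_iff hN hε hεP ht0 c hs' hτ.2).2 h⟩

/-- The transverse coordinates of a pushed point are s'_i y_u, with y = 1 at the tip, so affine
interpolation towards s' is interpolation of the factors towards 1. Injectivity of `push` makes the
tip and the factors of the starting point unambiguous. -/
theorem mem_interval_iff {x : Vec N × (D.normals → ℝ)} (hx : x ∈ D.pairs ε) {m : Vec N} :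
    m ∈ D.interval t ε (D.push (Real.log ‖t‖) x) ↔
      ∃ θ ∈ Icc (0 : ℝ) 1, D.push (Real.log ‖t‖) (D.slide x θ) = m := by
  constructor
  · rintro ⟨s', hs', τ, hτ, c, hs, hm, θ, hθ, h⟩
    obtain ⟨y, hy, hys⟩ := (D.mem_coneIn_iff hN hε hεP ht0 c hs' hτ.2).1 hs
    obtain ⟨y', hy', rfl⟩ := (D.mem_coneIn_iff hN hε hεP ht0 c hs' hτ.2).1 hm
    obtain rfl := D.injOn_push hε hεP hN _ hy hx hys
    refine ⟨θ, hθ, ?_⟩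
    congr 1
    refine Prod.ext rfl (funext fun u => ?_)
    change (1 - θ) * y u + θ = y' u
    by_cases hu0 : ht (u : Lat N) (ε⁻¹ • s') = 0
    · obtain ⟨g, hdual, hexp, hg, hgu⟩ :=
        D.exists_dual_assocCoords c (D.fst_mem_of_frontier hε hs') hτ.2
      obtain ⟨u, hu⟩ := u
      obtain ⟨i, hi, rfl⟩ := hgu u hu hu0
      have h1 := h i hi
      rw [D.coord_push_of_ge hN hε hεP ht0 c hx hdual hgu hu hu0,
        D.coord_push_of_ge hN hε hεP ht0 c hy' hdual hgu hu hu0] at h1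
      have hpos := D.coord_pos_of_interior hN ht0 c (hεP (D.frontier_smul_subset hs')) i
      have h2 : D.coord t c i s' * y' ⟨g i, hu⟩ =
          D.coord t c i s' * ((1 - θ) * y ⟨g i, hu⟩ + θ) := by
        simp only at h1
        rw [h1]; ring
      exact (mul_left_cancel₀ hpos.ne' h2).symm
    · have h1 : y u = 1 := (hy.2.2 u).resolve_right hu0
      have h2 : y' u = 1 := (hy'.2.2 u).resolve_right hu0
      rw [h1, h2]; ring
  · rintro ⟨θ, hθ, rfl⟩
    obtain ⟨τ, hτ, ⟨c⟩⟩ := D.exists_carries_assocCoords hN hε hx.1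
    refine ⟨x.1, hx.1, τ, hτ, c, (D.mem_coneIn_iff hN hε hεP ht0 c hx.1 hτ.2).2 ⟨x.2, hx, rfl⟩,
      (D.mem_coneIn_iff hN hε hεP ht0 c hx.1 hτ.2).2 ⟨_, D.slide_mem hx hθ, rfl⟩, θ, hθ,
      fun i hi => ?_⟩
    obtain ⟨g, hdual, hexp, hg, hgu⟩ :=
      D.exists_dual_assocCoords c (D.fst_mem_of_frontier hε hx.1) hτ.2
    rw [D.coord_push_of_ge hN hε hεP ht0 c hx hdual hgu (hg i hi).1 (hg i hi).2,
      D.coord_push_of_ge hN hε hεP ht0 c (D.slide_mem hx hθ) hdual hgu (hg i hi).1 (hg i hi).2]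
    change D.coord t c i x.1 * ((1 - θ) * x.2 _ + θ) = _
    ring

/-- Points of the curved normal cones of a face `Θ ⊇ τ` are `τ`-points. -/
theorem isTauPoint_push {x : Vec N × (D.normals → ℝ)} (hx : x ∈ D.pairs ε) {τ : Finset (Vec N)}
    (hτ : (τ : Set (Vec N)) ⊆ minFace D.P {ε⁻¹ • x.1}) :
    D.IsTauPoint t ε τ (D.push (Real.log ‖t‖) x) := by
  have hq := D.pairs_fst_mem hε hx
  constructor
  · intro c i hi
    have hv : c.pt i - c.base ∈ latticeDir (τ : Set (Vec N)) := by
      rw [← c.simplex_basis]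
      exact AddSubgroup.subset_closure ⟨i, hi, rfl⟩
    have hv' : c.pt i - c.base ∈ latticeDir (minFace D.P {ε⁻¹ • x.1}) :=
      vectorSpan_mono ℝ hτ hv
    rw [D.mem_latticeDir_minFace_iff hq] at hv'
    have key : ∀ m ∈ D.interval t ε (D.push (Real.log ‖t‖) x),
        D.coord t c i m = D.coord t c i x.1 := by
      intro m hm
      obtain ⟨θ, hθ, rfl⟩ := (D.mem_interval_iff hN hε hεP ht0 hx).1 hm
      exact D.absMonom_push_of_dir hN hε hεP ht0 (D.slide_mem hx hθ) hv'
    intro m hm m' hm'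
    rw [key m hm, key m' hm']
  · have hF := D.isFace_minFace (singleton_nonempty (ε⁻¹ • x.1)) (singleton_subset_iff.2 hq)
    refine ⟨minFace D.P {ε⁻¹ • x.1}, hF, ?_, sInter_subset_of_mem ⟨hF, hτ⟩, fun m hm => ?_⟩
    · obtain ⟨-, u, hu, hu0⟩ := D.mem_frontier_iff.1 ((D.mem_frontier_smul_iff hε).1 hx.1)
      intro z hz
      have hz' := (D.mem_minFace_singleton hq).1 hz
      exact D.mem_frontier_iff.2 ⟨hz'.1, u, hu, hz'.2 u hu hu0⟩
    · obtain ⟨θ, hθ, rfl⟩ := (D.mem_interval_iff hN hε hεP ht0 hx).1 hm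
      exact ⟨x.1, hx.1, rfl, (D.mem_normalCone_iff hN hε hεP ht0 hx.1).2
        ⟨_, D.slide_mem hx hθ, rfl⟩⟩

omit hN ht0 in
theorem exists_push_eq_of_frontier (L : ℝ) {s : Vec N} (hs : s ∈ frontier D.P) :
    ∃ x ∈ D.pairs ε, D.push L x = s :=
  D.exists_push_eq hε hεP L (D.frontier_subset_P hs) fun h => by
    rw [frontier, D.isClosed_P.closure_eq] at hs
    exact hs.2 (hεP h)

theorem existsUnique_normalCone {s : Vec N} (hs : s ∈ frontier D.P) :
    ∃! s', s' ∈ frontier (ε • D.P) ∧ s ∈ D.normalCone t ε s' := by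
  obtain ⟨x, hx, rfl⟩ := D.exists_push_eq_of_frontier hε hεP (Real.log ‖t‖) hs
  refine ⟨x.1, ⟨hx.1, (D.mem_normalCone_iff hN hε hεP ht0 hx.1).2 ⟨x.2, hx, rfl⟩⟩, ?_⟩
  rintro s' ⟨hs', hcone⟩
  obtain ⟨y, hy, hys⟩ := (D.mem_normalCone_iff hN hε hεP ht0 hs').1 hcone
  exact D.push_fst_eq hε hεP _ hy hx hys

end Pairs

end CYData

/-! ### Concentration of the weights -/

/-- A concave function that agrees with a chord at an inner point agrees with it everywhere. -/
theorem concaveOn_eq_chord {E : Type*} [AddCommGroup E] [Module ℝ E] {S : Set E} {ψ : E → ℝ}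
    (hψ : ConcaveOn ℝ S ψ) {x z : E} (hx : x ∈ S) (hz : z ∈ S) {β : ℝ} (hβ0 : 0 < β) (hβ1 : β < 1)
    (h : ψ (β • x + (1 - β) • z) ≤ β * ψ x + (1 - β) * ψ z) {γ : ℝ} (hγ0 : 0 ≤ γ) (hγ1 : γ ≤ 1) :
    ψ (γ • x + (1 - γ) • z) = γ * ψ x + (1 - γ) * ψ z := by
  have hy : γ • x + (1 - γ) • z ∈ S := hψ.1 hx hz hγ0 (by linarith) (by ring)
  refine le_antisymm ?_ (hψ.2 hx hz hγ0 (by linarith) (by ring))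
  rcases le_or_gt β γ with hle | hlt
  · have hγ : 0 < γ := hβ0.trans_le hle
    have h1 := hψ.2 hy hz (show 0 ≤ β / γ by positivity)
      (show 0 ≤ 1 - β / γ by rw [sub_nonneg, div_le_one hγ]; exact hle) (by ring)
    have h2 : (β / γ) • (γ • x + (1 - γ) • z) + (1 - β / γ) • z = β • x + (1 - β) • z := by
      rw [smul_add, smul_smul, smul_smul, add_assoc, ← add_smul, div_mul_cancel₀ _ hγ.ne']
      congr 2
      field_simp; ring
    rw [h2, smul_eq_mul, smul_eq_mul] at h1
    have h3 := h1.trans h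
    have h4 : β / γ * ψ (γ • x + (1 - γ) • z) ≤ β / γ * (γ * ψ x + (1 - γ) * ψ z) := by
      have : β / γ * (γ * ψ x + (1 - γ) * ψ z) =
          β * ψ x + (1 - β) * ψ z - (1 - β / γ) * ψ z := by
        field_simp; ring
      linarith
    exact le_of_mul_le_mul_left h4 (by positivity)
  · have hγ : 0 < 1 - γ := by linarith
    have h1 := hψ.2 hy hx (show 0 ≤ (1 - β) / (1 - γ) from div_nonneg (by linarith) hγ.le)
      (show 0 ≤ 1 - (1 - β) / (1 - γ) by rw [sub_nonneg, div_le_one hγ]; linarith) (by ring)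
    have h2 : ((1 - β) / (1 - γ)) • (γ • x + (1 - γ) • z) + (1 - (1 - β) / (1 - γ)) • x =
        β • x + (1 - β) • z := by
      rw [smul_add, smul_smul, smul_smul, add_right_comm, ← add_smul, div_mul_cancel₀ _ hγ.ne']
      congr 2
      field_simp; ring
    rw [h2, smul_eq_mul, smul_eq_mul] at h1
    have h3 := h1.trans h
    have h4 : (1 - β) / (1 - γ) * ψ (γ • x + (1 - γ) • z) ≤
        (1 - β) / (1 - γ) * (γ * ψ x + (1 - γ) * ψ z) := by
      have : (1 - β) / (1 - γ) * (γ * ψ x + (1 - γ) * ψ z) =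
          β * ψ x + (1 - β) * ψ z - (1 - (1 - β) / (1 - γ)) * ψ x := by
        field_simp; ring
      linarith
    exact le_of_mul_le_mul_left h4 (div_pos (by linarith) hγ)

/-- This puts equality in the concavity inequality into the form to which strict convexity for the
triangulation applies: the whole segment becomes a domain of linearity. -/
theorem concaveOn_eqOn_segment {E : Type*} [NormedAddCommGroup E] [InnerProductSpace ℝ E]
    {S : Set E} {ψ : E → ℝ}
    (hψ : ConcaveOn ℝ S ψ) {x z : E} (hx : x ∈ S) (hz : z ∈ S) {β : ℝ} (hβ0 : 0 < β) (hβ1 : β < 1)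
    (h : ψ (β • x + (1 - β) • z) ≤ β * ψ x + (1 - β) * ψ z) :
    ∃ a : E →ᵃ[ℝ] ℝ, EqOn ψ a (segment ℝ x z) := by
  -- The slope along x - z. For x = z the quotient is 0, which is the right value.
  let l : E →ₗ[ℝ] ℝ := ((ψ x - ψ z) / ‖x - z‖ ^ 2) • (innerSL ℝ (x - z) : E →L[ℝ] ℝ).toLinearMap
  refine ⟨l.toAffineMap + AffineMap.const ℝ E (ψ z - l z), ?_⟩
  rintro _ ⟨γ, γ', hγ, hγ', hsum, rfl⟩
  obtain rfl : γ' = 1 - γ := by linarith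
  rw [concaveOn_eq_chord hψ hx hz hβ0 hβ1 h hγ (by linarith)]
  have hl : l (x - z) = ψ x - ψ z := by
    by_cases hxz : x = z
    · simp [hxz]
    · have : ‖x - z‖ ^ 2 ≠ 0 := pow_ne_zero _ (norm_ne_zero_iff.2 (sub_ne_zero.2 hxz))
      change (ψ x - ψ z) / ‖x - z‖ ^ 2 * inner ℝ (x - z) (x - z) = _
      rw [real_inner_self_eq_norm_sq, div_mul_cancel₀ _ this]
  rw [map_sub] at hl
  simp only [AffineMap.coe_add, Pi.add_apply, LinearMap.coe_toAffineMap, AffineMap.const_apply,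
    map_add, map_smul, smul_eq_mul]
  linear_combination (-γ) * hl

/-! ### Gibbs estimates and the tropical limit -/

namespace CYData

variable {N : ℕ} (D : CYData N)

theorem finite_faces : D.T.faces.Finite := by
  classical
  refine (Finset.finite_toSet (D.A.image latPt).powerset).subset fun s hs => ?_
  rw [Finset.mem_coe, Finset.mem_powerset]
  intro v hv
  obtain ⟨z, hz, rfl⟩ := D.exists_latPt_eq_of_mem_face hs hv
  exact Finset.mem_image_of_mem _ hz

theorem mem_of_mem_vertices {v : Vec N} (hv : v ∈ D.T.vertices) {s : Finset (Vec N)}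
    (hs : s ∈ D.T.faces) (h : v ∈ convexHull ℝ (s : Set (Vec N))) : v ∈ s := by
  have h1 := D.T.inter_subset_convexHull hv hs ⟨by simp, h⟩
  by_contra hcon
  have : ((({v} : Finset (Vec N)) : Set (Vec N)) ∩ s) = ∅ := by
    ext z; simp only [Finset.coe_singleton, mem_inter_iff, mem_singleton_iff, mem_empty_iff_false,
      iff_false, not_and]
    rintro rfl hz; exact hcon hz
  rw [this, convexHull_empty] at h1
  exact h1

/-- Uniqueness of barycentric coordinates. -/
theorem eq_of_sum_smul_eq {s : Finset (Vec N)} (hs : s ∈ D.T.faces) {c d : Vec N → ℝ}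
    (hsum : ∑ v ∈ s, c v = ∑ v ∈ s, d v) (h : ∑ v ∈ s, c v • v = ∑ v ∈ s, d v • v) {v : Vec N}
    (hv : v ∈ s) : c v = d v := by
  have h1 := affineIndependent_iff.1 (D.T.indep hs) Finset.univ (fun v => c v - d v) (by
    rw [Finset.sum_coe_sort s fun v => c v - d v, Finset.sum_sub_distrib, hsum, sub_self]) (by
    rw [Finset.sum_coe_sort s fun v => (c v - d v) • v]
    simp only [sub_smul]
    rw [Finset.sum_sub_distrib, h, sub_self]) ⟨v, hv⟩ (Finset.mem_univ _)
  exact sub_eq_zero.1 h1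

/-- Equality would force ω to be a vertex of T and ψ to be affine on the segment from ω through the
mean. This segment then lies in one simplex s having ω as a vertex, and the mean has positive
coefficient at ω there, whereas it lies in the face s ∩ ρ that omits ω. -/
theorem sum_lam_lt {ψ : Vec N → ℝ} (hψ : IsStrictlyConvexFor D.T D.P ψ)
    (hlam : ∀ ω ∈ D.A, (D.lam ω : ℝ) ≤ ψ (latPt ω) ∧
      (ψ (latPt ω) = D.lam ω ↔ latPt ω ∈ D.T.vertices))
    {ρ : Finset (Vec N)} (hρ : ρ ∈ D.T.faces) {w : D.A → ℝ} (hw : w ∈ stdSimplex ℝ D.A)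
    (hwρ : D.bary w ∈ convexHull ℝ (ρ : Set (Vec N))) {ω : D.A} (hω : latPt (ω : Lat N) ∉ ρ)
    (hpos : 0 < w ω) : ∑ ω, w ω * D.lam ω < ψ (D.bary w) := by
  classical
  by_contra hcon
  push Not at hcon
  have hle : ∀ v ∈ stdSimplex ℝ D.A, ∑ ω, v ω * ψ (latPt (ω : Lat N)) ≤ ψ (D.bary v) := by
    intro v hv
    have := hψ.1.le_map_sum (t := Finset.univ) (w := v) (p := fun ω : D.A => latPt (ω : Lat N))
      (fun ω _ => hv.1 ω) hv.2 fun ω _ => D.latPt_mem ω.2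
    simpa [bary] using this
  have hterm : ∀ ω ∈ Finset.univ, w ω * (D.lam ω : ℝ) ≤ w ω * ψ (latPt (ω : Lat N)) :=
    fun ω _ => mul_le_mul_of_nonneg_left (hlam ω ω.2).1 (hw.1 ω)
  have hsum := Finset.sum_le_sum hterm
  have hω_eq : w ω * (D.lam ω : ℝ) = w ω * ψ (latPt (ω : Lat N)) :=
    (Finset.sum_eq_sum_iff_of_le hterm).1 (le_antisymm hsum ((hle w hw).trans hcon)) ω
      (Finset.mem_univ _)
  have hvert : latPt (ω : Lat N) ∈ D.T.vertices :=
    (hlam ω ω.2).2.1 (mul_left_cancel₀ hpos.ne' hω_eq).symm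
  have hw1 : w ω ≤ 1 := by
    rw [← hw.2]
    exact Finset.single_le_sum (fun i _ => hw.1 i) (Finset.mem_univ ω)
  -- Half of the weight is split off, so that the rest stays nonnegative and 1 - β > 0 even when ω
  -- carries all the weight.
  set β : ℝ := w ω / 2 with hβ
  have hβ0 : 0 < β := by positivity
  have hβ1 : β < 1 := by rw [hβ]; linarith
  have hβ1' : 0 < 1 - β := by linarith
  set v : D.A → ℝ := (1 - β)⁻¹ • (w - Pi.single ω β) with hv
  have hvapp : ∀ ω', v ω' = (1 - β)⁻¹ * (w ω' - (Pi.single ω β : D.A → ℝ) ω') := fun ω' => rfl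
  have hvs : v ∈ stdSimplex ℝ D.A := by
    constructor
    · intro ω'
      rw [hvapp]
      refine mul_nonneg (inv_nonneg.2 hβ1'.le) ?_
      by_cases h : ω' = ω
      · subst h; rw [Pi.single_eq_same, hβ]; linarith
      · rw [Pi.single_eq_of_ne h, sub_zero]; exact hw.1 _
    · simp only [hvapp]
      rw [← Finset.mul_sum, Finset.sum_sub_distrib, hw.2, Finset.sum_pi_single']
      simp [hβ1'.ne']
  have hbw : D.bary w = β • latPt (ω : Lat N) + (1 - β) • D.bary v := by
    rw [hv, bary_smul, smul_smul, mul_inv_cancel₀ hβ1'.ne', one_smul, bary_sub, bary_single]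
    abel
  have hsw : ∑ ω, w ω * ψ (latPt (ω : Lat N)) =
      β * ψ (latPt (ω : Lat N)) + (1 - β) * ∑ ω, v ω * ψ (latPt (ω : Lat N)) := by
    simp only [hvapp, mul_assoc]
    rw [← Finset.mul_sum, ← mul_assoc, mul_inv_cancel₀ hβ1'.ne', one_mul]
    simp only [sub_mul, Finset.sum_sub_distrib]
    rw [Finset.sum_eq_single (f := fun x => (Pi.single ω β : D.A → ℝ) x * ψ (latPt (x : Lat N))) ω]
    · rw [Pi.single_eq_same]; ring
    · intro b _ hb; rw [Pi.single_eq_of_ne hb, zero_mul]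
    · intro h; exact absurd (Finset.mem_univ _) h
  have hωP := D.latPt_mem ω.2
  have hchord : ψ (β • latPt (ω : Lat N) + (1 - β) • D.bary v) ≤
      β * ψ (latPt (ω : Lat N)) + (1 - β) * ψ (D.bary v) := by
    rw [← hbw]
    have h1 := mul_le_mul_of_nonneg_left (hle v hvs) hβ1'.le
    linarith [hcon.trans hsum]
  have hvP := D.bary_mem_P hvs
  obtain ⟨s, hs, hseg⟩ := hψ.2 (segment ℝ (latPt (ω : Lat N)) (D.bary v))
    (D.convex_P.segment_subset hωP hvP) (convex_segment _ _)
    (concaveOn_eqOn_segment hψ.1 hωP hvP hβ0 hβ1 hchord)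
  have hωs : latPt (ω : Lat N) ∈ s :=
    D.mem_of_mem_vertices hvert hs (hseg (left_mem_segment ℝ _ _))
  have hmρ : D.bary w ∈ convexHull ℝ ((s : Set (Vec N)) ∩ ρ) :=
    D.T.inter_subset_convexHull hs hρ ⟨hseg ⟨β, 1 - β, hβ0.le, hβ1'.le, by ring, hbw.symm⟩, hwρ⟩
  rw [← Finset.coe_inter, Finset.mem_convexHull'] at hmρ
  obtain ⟨d, hd0, hd1, hdm⟩ := hmρ
  have hvs' := hseg (right_mem_segment ℝ _ _)
  rw [Finset.mem_convexHull'] at hvs'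
  obtain ⟨c, hc0, hc1, hcm⟩ := hvs'
  have := D.eq_of_sum_smul_eq hs
    (c := fun x => β * (if x = latPt (ω : Lat N) then 1 else 0) + (1 - β) * c x)
    (d := fun x => if x ∈ ρ then d x else 0) (v := latPt (ω : Lat N)) (by
      rw [Finset.sum_add_distrib, ← Finset.mul_sum, ← Finset.mul_sum, hc1, Finset.sum_ite_eq' s,
        if_pos hωs, ← Finset.sum_filter, Finset.filter_mem_eq_inter, hd1]
      ring) (by
      simp only [ite_smul, zero_smul]
      rw [← Finset.sum_filter, Finset.filter_mem_eq_inter, hdm, hbw]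
      simp only [add_smul, mul_smul]
      rw [Finset.sum_add_distrib, ← Finset.smul_sum, ← Finset.smul_sum, hcm]
      simp [ite_smul, hωs]) hωs
  simp only [if_pos, if_neg hω, mul_one] at this
  have := mul_nonneg hβ1'.le (hc0 _ hωs)
  linarith

theorem neg_mul_log_le_one {x : ℝ} (hx : 0 < x) : -(x * Real.log x) ≤ 1 := by
  have h1 := Real.log_le_sub_one_of_pos (inv_pos.2 hx)
  rw [Real.log_inv] at h1
  have h2 := mul_le_mul_of_nonneg_left h1 hx.le
  rw [mul_sub, mul_inv_cancel₀ hx.ne', mul_one] at h2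
  linarith

/-- The weights at a point nearly maximize the mean value of `lam`. -/
theorem mul_sub_sum_lam_le {ψ : Vec N → ℝ} (hψ : IsCharacteristic D.T D.lam ψ)
    {ρ : Finset (Vec N)} (hρ : ρ ∈ D.T.faces) (L : ℝ) {m : Vec N}
    (hm : m ∈ interior D.P) (hmρ : m ∈ convexHull ℝ (ρ : Set (Vec N))) :
    L * (ψ m - ∑ ω, D.weights L m ω * D.lam ω) ≤ Fintype.card D.A := by
  obtain ⟨ξ, hξ, hw⟩ := D.exists_wt_eq_weights L hm
  rw [hw]
  obtain ⟨a, ha⟩ := hψ.1 ρ hρ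
  have hψm := ha hmρ
  have hmρ' := hmρ
  rw [Finset.mem_convexHull'] at hmρ
  obtain ⟨c, hc0, hc1, hcm⟩ := hmρ
  set Z := Real.log (D.part L ξ) with hZ
  have hwm := D.wt_mem L ξ
  have h1 : ∑ ω, D.wt L ξ ω * (Real.log (D.wt L ξ ω) - L * D.lam ω) = inner ℝ m ξ - Z := by
    rw [← hξ, inner_bary]
    have : ∀ ω, D.wt L ξ ω * (Real.log (D.wt L ξ ω) - L * D.lam ω) =
        D.wt L ξ ω * inner ℝ (latPt (ω : Lat N)) ξ - D.wt L ξ ω * Z := by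
      intro ω; rw [log_wt, expo]; ring
    simp only [this]
    rw [Finset.sum_sub_distrib, ← Finset.sum_mul, hwm.2, one_mul]
  -- Each single exponent is at most log Z. Averaging this over the vertices of ρ with the
  -- barycentric coordinates of m turns λ into ψ(m).
  have h2 : inner ℝ m ξ - Z ≤ -(L * ψ m) := by
    have hψm' : ψ m = ∑ v ∈ ρ, c v * ψ v := by
      rw [hψm, ← hcm]
      have : ∀ v ∈ ρ, c v * ψ v = c v * a v := fun v hv => by
        rw [ha (subset_convexHull ℝ _ hv)]
      rw [Finset.sum_congr rfl this]
      have h3 := Finset.map_affineCombination ρ (fun v : Vec N => v) c hc1 a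
      rw [Finset.affineCombination_eq_linear_combination _ _ _ hc1,
        Finset.affineCombination_eq_linear_combination _ _ _ hc1] at h3
      simpa using h3
    have : inner ℝ m ξ - Z = ∑ v ∈ ρ, c v * (inner ℝ v ξ - Z) := by
      simp only [mul_sub]
      rw [Finset.sum_sub_distrib, ← Finset.sum_mul, hc1, one_mul, ← hcm, sum_inner]
      simp only [inner_smul_left, conj_trivial]
    rw [this, hψm', Finset.mul_sum, ← Finset.sum_neg_distrib]
    refine Finset.sum_le_sum fun v hv => ?_
    obtain ⟨z, hz, rfl⟩ := D.exists_latPt_eq_of_mem_face hρ hv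
    have hvert : latPt z ∈ D.T.vertices := D.T.down_closed hρ (Finset.singleton_subset_iff.2 hv)
      (Finset.singleton_nonempty _)
    rw [hψ.2 z hvert]
    have h3 := D.expo_le_log_part L ξ hz
    rw [expo] at h3
    have := mul_le_mul_of_nonneg_left (show inner ℝ (latPt z) ξ - Z ≤ -(L * D.lam z) by linarith)
      (hc0 _ hv)
    linarith
  -- The entropy is bounded independently of L, so the gap in the mean of λ must be of order 1/L.
  have h3 : -∑ ω, D.wt L ξ ω * Real.log (D.wt L ξ ω) ≤ Fintype.card D.A := by
    rw [← Finset.sum_neg_distrib]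
    refine (Finset.sum_le_sum fun ω _ => neg_mul_log_le_one (D.wt_pos L ξ ω)).trans ?_
    simp
  simp only [mul_sub, Finset.sum_sub_distrib] at h1
  have h4 : ∑ ω, D.wt L ξ ω * (L * D.lam ω) = L * ∑ ω, D.wt L ξ ω * D.lam ω := by
    rw [Finset.mul_sum]
    exact Finset.sum_congr rfl fun _ _ => by ring
  rw [h4] at h1
  linarith

/-- Weight vectors with mean in ρ and weight at least δ at ω form a compact set, on which the strict
inequality of `sum_lam_lt` gives a uniform gap κ. The Gibbs bound L κ ≤ |A| excludes them once L is
large. -/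
theorem exists_forall_weights_le {ρ : Finset (Vec N)} (hρ : ρ ∈ D.T.faces) {ω : D.A}
    (hω : latPt (ω : Lat N) ∉ ρ) {δ : ℝ} (hδ : 0 < δ) :
    ∃ L₀, ∀ L, L₀ ≤ L → ∀ m ∈ interior D.P, m ∈ convexHull ℝ (ρ : Set (Vec N)) →
      D.weights L m ω ≤ δ := by
  obtain ⟨ψ, hψ, hconv, hlam⟩ := D.lam_interior
  obtain ⟨a, ha⟩ := hψ.1 ρ hρ
  set K : Set (D.A → ℝ) := {w | w ∈ stdSimplex ℝ D.A ∧
    D.bary w ∈ convexHull ℝ (ρ : Set (Vec N)) ∧ δ ≤ w ω} with hK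
  have hKc : IsCompact K := by
    refine (isCompact_stdSimplex ℝ D.A).of_isClosed_subset ?_ fun w hw => hw.1
    refine (isClosed_stdSimplex ℝ _).inter (IsClosed.inter ?_ ?_)
    · exact (Set.Finite.isCompact_convexHull ℝ (Finset.finite_toSet ρ)).isClosed.preimage
        D.continuous_bary
    · exact isClosed_le continuous_const (continuous_apply ω)
  rcases K.eq_empty_or_nonempty with hempty | hne
  · refine ⟨0, fun L _ m hm hmρ => ?_⟩
    by_contra hcon
    have : D.weights L m ∈ K := ⟨D.weights_mem L (interior_subset hm), by
      rwa [D.bary_weights L (interior_subset hm)], (not_le.1 hcon).le⟩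
    rw [hempty] at this; exact this
  have hcont : Continuous fun w : D.A → ℝ => a (D.bary w) - ∑ ω, w ω * D.lam ω :=
    (a.continuous_of_finiteDimensional.comp D.continuous_bary).sub (by fun_prop)
  obtain ⟨w₀, hw₀, hmin⟩ := hKc.exists_isMinOn hne hcont.continuousOn
  have hpos : 0 < a (D.bary w₀) - ∑ ω, w₀ ω * D.lam ω := by
    have := D.sum_lam_lt hconv hlam hρ hw₀.1 hw₀.2.1 hω (hδ.trans_le hw₀.2.2)
    rw [ha hw₀.2.1] at this
    linarith
  set κ := a (D.bary w₀) - ∑ ω, w₀ ω * D.lam ω with hκ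
  refine ⟨(Fintype.card D.A + 1) / κ, fun L hL m hm hmρ => ?_⟩
  by_contra hcon
  have hmem : D.weights L m ∈ K := ⟨D.weights_mem L (interior_subset hm), by
      rwa [D.bary_weights L (interior_subset hm)], (not_le.1 hcon).le⟩
  have h1 : κ ≤ a (D.bary (D.weights L m)) - ∑ ω, D.weights L m ω * D.lam ω := hmin hmem
  rw [D.bary_weights L (interior_subset hm), ← ha hmρ] at h1
  have h2 := D.mul_sub_sum_lam_le hψ hρ L hm hmρ
  have hL0 : 0 < L := lt_of_lt_of_le (by positivity) hL
  have h3 := mul_le_mul_of_nonneg_left h1 hL0.le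
  rw [div_le_iff₀ hpos] at hL
  linarith

/-- The simplices with vertex `0` cover `P`. -/
theorem exists_face_zero_mem {q : Vec N} (hq : q ∈ D.P) :
    ∃ σ ∈ D.T.faces, (0 : Vec N) ∈ σ ∧ q ∈ convexHull ℝ (σ : Set (Vec N)) := by
  set S := {σ | σ ∈ D.T.faces ∧ σ.card = N + 1} with hS
  set S' := {σ | σ ∈ D.T.faces ∧ σ.card ≠ N + 1} with hS'
  have hSf : S.Finite := D.finite_faces.subset fun σ h => h.1
  have hSf' : S'.Finite := D.finite_faces.subset fun σ h => h.1
  have hclosed : IsClosed (⋃ σ ∈ S, convexHull ℝ (σ : Set (Vec N))) :=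
    hSf.isClosed_biUnion fun σ _ =>
      (Set.Finite.isCompact_convexHull ℝ (Finset.finite_toSet σ)).isClosed
  -- The simplices of lower dimension cannot fill a nonempty open subset of P, so the closed union
  -- of the full-dimensional ones is all of P.
  have hnull : MeasureTheory.volume (⋃ σ ∈ S', convexHull ℝ (σ : Set (Vec N))) = 0 := by
    rw [MeasureTheory.measure_biUnion_null_iff hSf'.countable]
    rintro σ ⟨hσ, hcard⟩
    refine MeasureTheory.measure_mono_null (convexHull_subset_affineSpan _)
      (MeasureTheory.Measure.addHaar_affineSubspace _ _ fun htop => hcard ?_)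
    have h1 := D.polyDim_face hσ
    rw [polyDim, ← direction_affineSpan, htop, AffineSubspace.direction_top, finrank_top] at h1
    simpa using h1.symm
  by_contra hcon
  have hqS : q ∈ (⋃ σ ∈ S, convexHull ℝ (σ : Set (Vec N)))ᶜ := by
    intro h
    simp only [mem_iUnion] at h
    obtain ⟨σ, hσ, hqσ⟩ := h
    exact hcon ⟨σ, hσ.1, D.central σ hσ.1 hσ.2, hqσ⟩
  rw [← D.closure_interior] at hq
  have hne := mem_closure_iff.1 hq _ hclosed.isOpen_compl hqS
  have hopen := hclosed.isOpen_compl.inter (isOpen_interior (s := D.P))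
  refine (hopen.measure_pos MeasureTheory.volume hne).ne'
    (MeasureTheory.measure_mono_null ?_ hnull)
  rintro z ⟨hz, hzP⟩
  have hz' := interior_subset hzP
  rw [← D.space_eq, Geometry.SimplicialComplex.mem_space_iff] at hz'
  obtain ⟨σ, hσ, hzσ⟩ := hz'
  simp only [mem_iUnion]
  by_cases hc : σ.card = N + 1
  · exact absurd (mem_biUnion (show σ ∈ S from ⟨hσ, hc⟩) hzσ) hz
  · exact ⟨σ, ⟨hσ, hc⟩, hzσ⟩

/-- For large `L`, the weights at a point of `∂(ε P)` are concentrated on the face and on `0`. -/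
theorem exists_forall_weights_frontier_le {ε : ℝ} (hε : 0 < ε) (hεP : ε • D.P ⊆ interior D.P)
    {δ : ℝ} (hδ : 0 < δ) :
    ∃ L₀, ∀ L, L₀ ≤ L → ∀ s' ∈ frontier (ε • D.P), ∀ ω : D.A, (ω : Lat N) ≠ 0 →
      latPt (ω : Lat N) ∉ minFace D.P {ε⁻¹ • s'} → D.weights L s' ω ≤ δ := by
  classical
  have h1 : ∀ ρ : Finset (Vec N), ∀ ω : D.A, ∃ L₀ : ℝ, ρ ∈ D.T.faces → latPt (ω : Lat N) ∉ ρ →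
      ∀ L, L₀ ≤ L → ∀ m ∈ interior D.P, m ∈ convexHull ℝ (ρ : Set (Vec N)) →
      D.weights L m ω ≤ δ := by
    intro ρ ω
    by_cases h : ρ ∈ D.T.faces ∧ latPt (ω : Lat N) ∉ ρ
    · obtain ⟨L₀, hL₀⟩ := D.exists_forall_weights_le h.1 h.2 hδ
      exact ⟨L₀, fun _ _ => hL₀⟩
    · exact ⟨0, fun h1 h2 => absurd ⟨h1, h2⟩ h⟩
  choose f hf using h1
  obtain ⟨L₀, hL₀⟩ := ((D.finite_faces.toFinset ×ˢ (Finset.univ : Finset D.A)).image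
    fun z => f z.1 z.2).bddAbove
  refine ⟨L₀, fun L hL s' hs' ω hω0 hω => ?_⟩
  have hq := (D.mem_frontier_smul_iff hε).1 hs'
  obtain ⟨hqP, u, hu, hu0⟩ := D.mem_frontier_iff.1 hq
  have hs'int := hεP (D.frontier_smul_subset hs')
  have hs'q : s' = ε • (ε⁻¹ • s') := by rw [smul_smul, mul_inv_cancel₀ hε.ne', one_smul]
  have hε1 : ε ≤ 1 := by
    have h1 := D.mem_interior_iff.1 hs'int u hu
    rw [hs'q] at h1
    simp only [ht, inner_smul_right] at h1 hu0
    nlinarith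
  obtain ⟨σ, hσ, h0σ, hqσ⟩ := D.exists_face_zero_mem hqP
  rw [Finset.mem_convexHull'] at hqσ
  obtain ⟨c, hc0, hc1, hcq⟩ := hqσ
  -- The simplex carrying s'/ε, with 0 adjoined. It contains s' because s' lies between 0 and s'/ε,
  -- and its vertices other than 0 lie on the minimal face of s'/ε.
  set ρ := σ.filter fun v => v = 0 ∨ c v ≠ 0 with hρ
  have h0ρ : (0 : Vec N) ∈ ρ := Finset.mem_filter.2 ⟨h0σ, Or.inl rfl⟩
  have hρT : ρ ∈ D.T.faces := D.T.down_closed hσ (Finset.filter_subset _ _) ⟨0, h0ρ⟩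
  have hqρ : ε⁻¹ • s' ∈ convexHull ℝ (ρ : Set (Vec N)) := by
    have hzero : ∀ v ∈ σ, v ∉ ρ → c v = 0 := by
      intro v hv hv'
      by_contra h
      exact hv' (Finset.mem_filter.2 ⟨hv, Or.inr h⟩)
    rw [Finset.mem_convexHull']
    refine ⟨c, fun v hv => hc0 v (Finset.mem_filter.1 hv).1, ?_, ?_⟩
    · rw [← hc1]
      exact Finset.sum_subset (Finset.filter_subset _ _) hzero
    · rw [← hcq]
      exact Finset.sum_subset (Finset.filter_subset _ _) fun v hv hv' => by
        rw [hzero v hv hv', zero_smul]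
  have hs'ρ : s' ∈ convexHull ℝ (ρ : Set (Vec N)) := by
    have := convex_convexHull ℝ (ρ : Set (Vec N)) hqρ (subset_convexHull ℝ _ h0ρ) hε.le
      (sub_nonneg.2 hε1) (by ring)
    rwa [smul_zero, add_zero, ← hs'q] at this
  have hωρ : latPt (ω : Lat N) ∉ ρ := by
    intro h
    obtain ⟨hωσ, h | h⟩ := Finset.mem_filter.1 h
    · exact hω0 (latPt_injective (h.trans latPt_zero.symm))
    · refine hω ((D.mem_minFace_singleton hqP).2 ⟨D.latPt_mem ω.2, fun u hu h0 => ?_⟩)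
      rw [← hcq] at h0
      exact D.ht_eq_zero_of_sum hu (fun v hv => D.coe_subset_P hσ hv) hc0 hc1 h0 hωσ
        (lt_of_le_of_ne (hc0 _ hωσ) (Ne.symm h))
  refine hf ρ ω hρT hωρ L (le_trans (hL₀ ?_) hL) s' hs'int hs'ρ
  exact Finset.mem_coe.2 (Finset.mem_image_of_mem (fun z => f z.1 z.2) (a := (ρ, ω))
    (Finset.mem_product.2 ⟨D.finite_faces.mem_toFinset.2 hρT, Finset.mem_univ _⟩))

end CYData

/-! ### Estimates for large parameters -/

theorem eventually_mul_lt (B : ℝ) {c : ℝ} (hc : 0 < c) : ∀ᶠ δ : ℝ in 𝓝[>] 0, B * δ < c := by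
  have h : Filter.Tendsto (fun δ : ℝ => B * δ) (𝓝 0) (𝓝 (B * 0)) :=
    (continuous_const.mul continuous_id).tendsto 0
  rw [mul_zero] at h
  exact (h.mono_left nhdsWithin_le_nhds).eventually (gt_mem_nhds hc)

theorem exists_pos_forall_le {α : Type*} (s : Finset α) {f : α → ℝ} (hf : ∀ a ∈ s, 0 < f a) :
    ∃ c > 0, ∀ a ∈ s, c ≤ f a := by
  rcases s.eq_empty_or_nonempty with rfl | hs
  · exact ⟨1, one_pos, by simp⟩
  · obtain ⟨a, ha, hmin⟩ := s.exists_min_image f hs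
    exact ⟨f a, hf a ha, hmin⟩

/-- With the ratios p_i = a_i / b_i ≤ 1 one has ∏ p_i^{n_i} ≥ (∏ p_i)^K, and Bernoulli's inequality
finishes. It bounds the growth of every twisting factor by the relative growth of the product of all
y_u, the factor of the origin. -/
theorem prod_pow_sub_prod_pow_le {ι : Type*} [Fintype ι] {a b : ι → ℝ} (ha : ∀ i, 0 < a i)
    (hab : ∀ i, a i ≤ b i) (hb : ∀ i, b i ≤ 1) {n : ι → ℕ} {K : ℕ} (hn : ∀ i, n i ≤ K) :
    ∏ i, b i ^ n i - ∏ i, a i ^ n i ≤ K * (1 - (∏ i, a i) / ∏ i, b i) := by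
  have hb0 : ∀ i, 0 < b i := fun i => (ha i).trans_le (hab i)
  have hp0 : ∀ i, 0 ≤ a i / b i := fun i => (div_pos (ha i) (hb0 i)).le
  have hp1 : ∀ i, a i / b i ≤ 1 := fun i => (div_le_one (hb0 i)).2 (hab i)
  have h1 : (∏ i, a i / b i) ^ K ≤ ∏ i, (a i / b i) ^ n i := by
    rw [← Finset.prod_pow]
    exact Finset.prod_le_prod (fun i _ => pow_nonneg (hp0 i) _) fun i _ =>
      pow_le_pow_of_le_one (hp0 i) (hp1 i) (hn i)
  have h2 : ∏ i, a i ^ n i = (∏ i, b i ^ n i) * ∏ i, (a i / b i) ^ n i := by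
    rw [← Finset.prod_mul_distrib]
    refine Finset.prod_congr rfl fun i _ => ?_
    rw [← mul_pow, mul_div_cancel₀ _ (hb0 i).ne']
  have h3 : 0 ≤ ∏ i, a i / b i := Finset.prod_nonneg fun i _ => hp0 i
  have h4 := one_add_mul_le_pow (a := ∏ i, a i / b i - 1) (by linarith) K
  rw [add_sub_cancel] at h4
  have h5 : ∏ i, b i ^ n i ≤ 1 :=
    Finset.prod_le_one (fun i _ => pow_nonneg (hb0 i).le _) fun i _ =>
      pow_le_one₀ (hb0 i).le (hb i)
  have h6 : ∏ i, (a i / b i) ^ n i ≤ 1 :=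
    Finset.prod_le_one (fun i _ => pow_nonneg (hp0 i) _) fun i _ =>
      pow_le_one₀ (hp0 i) (hp1 i)
  rw [h2, ← Finset.prod_div_distrib]
  have h7 := mul_le_mul_of_nonneg_right h5 (sub_nonneg.2 h6)
  nlinarith

namespace CYData

variable {N : ℕ} (D : CYData N)

/-- The weights at points of `∂(ε P)` are at most `δ`, except on the face and at `0`. -/
def IsConcentrated (ε δ L : ℝ) : Prop :=
  ∀ s' ∈ frontier (ε • D.P), ∀ ω : D.A, (ω : Lat N) ≠ 0 →
    latPt (ω : Lat N) ∉ minFace D.P {ε⁻¹ • s'} → D.weights L s' ω ≤ δ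

theorem push_eq_inv_smul (L : ℝ) (x : Vec N × (D.normals → ℝ)) :
    D.push L x = (∑ ω, D.twist x.2 (D.weights L x.1) ω)⁻¹ •
      D.bary (D.twist x.2 (D.weights L x.1)) := by
  rw [← bary_smul, push]
  congr 1
  funext ω
  rw [twistN, div_eq_inv_mul]; rfl

theorem prod_latHt_zero (y : D.normals → ℝ) :
    ∏ u : D.normals, y u ^ latHt (u : Lat N) ((⟨0, D.zero_mem⟩ : D.A) : Lat N) = ∏ u, y u := by
  refine Finset.prod_congr rfl fun u _ => ?_
  simp [latHt]

section Pairs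

variable {ε : ℝ} (hε : 0 < ε) (hεP : ε • D.P ⊆ interior D.P) {δ L : ℝ} (hδ : 0 ≤ δ)
  (hL : D.IsConcentrated ε δ L) {x : Vec N × (D.normals → ℝ)} (hx : x ∈ D.pairs ε)

include hx

theorem twist_eq_of_mem_minFace (hε : 0 < ε) {ω : D.A}
    (hω : latPt (ω : Lat N) ∈ minFace D.P {ε⁻¹ • x.1}) :
    D.twist x.2 (D.weights L x.1) ω = D.weights L x.1 ω := by
  rw [twist, D.pairs_prod_eq_one hx
    ((D.mem_minFace_singleton (D.pairs_fst_mem hε hx)).1 hω).2, mul_one]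

include hεP

theorem twist_le_weights (ω : D.A) :
    D.twist x.2 (D.weights L x.1) ω ≤ D.weights L x.1 ω :=
  mul_le_of_le_one_right (D.weights_pos L (D.pairs_fst_mem_interior hεP hx) ω).le
    (Finset.prod_le_one (fun u _ => pow_nonneg (hx.2.1 u).1 _) fun u _ =>
      pow_le_one₀ (hx.2.1 u).1 (hx.2.1 u).2)

include hε hδ hL

/-- The height of the tip over a facet of its face is 1 - ε, so the origin has weight at most 1 - ε
there. Concentration leaves weight at least ε/2 on the face, and twisting does not touch the face.
-/
theorem half_le_sum_twist (hn : Fintype.card D.A * δ ≤ ε / 2) :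
    ε / 2 ≤ ∑ ω, D.twist x.2 (D.weights L x.1) ω := by
  classical
  have hint := D.pairs_fst_mem_interior hεP hx
  have hw := D.weights_mem L (interior_subset hint)
  have hq := D.pairs_fst_mem hε hx
  obtain ⟨-, u, hu, hu0⟩ := D.mem_frontier_iff.1 ((D.mem_frontier_smul_iff hε).1 hx.1)
  have hxq : x.1 = ε • (ε⁻¹ • x.1) := by rw [smul_smul, mul_inv_cancel₀ hε.ne', one_smul]
  set o : D.A := ⟨0, D.zero_mem⟩ with ho
  have h0 : D.weights L x.1 o ≤ 1 - ε := by
    have h1 : ht u x.1 = 1 - ε := by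
      rw [hxq]
      simp only [ht, inner_smul_right] at hu0 ⊢
      linear_combination ε * hu0
    rw [← h1, ← D.bary_weights L (interior_subset hint), D.ht_bary u hw,
      D.bary_weights L (interior_subset hint)]
    have := Finset.single_le_sum (f := fun ω : D.A => D.weights L x.1 ω * ht u (latPt (ω : Lat N)))
      (fun ω _ => mul_nonneg (hw.1 ω) (D.ht_nonneg (D.latPt_mem ω.2) hu)) (Finset.mem_univ o)
    simpa [ho, latPt_zero, ht_zero] using this
  have hterm : ∀ ω ∈ Finset.univ, D.weights L x.1 ω ≤
      (if ω = o then D.weights L x.1 o else 0) + D.twist x.2 (D.weights L x.1) ω + δ := by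
    intro ω _
    have ht := D.twist_nonneg (fun u => (hx.2.1 u).1) hw.1 ω
    by_cases h : ω = o
    · rw [if_pos h, h]; rw [h] at ht; linarith
    rw [if_neg h]
    by_cases hΘ : latPt (ω : Lat N) ∈ minFace D.P {ε⁻¹ • x.1}
    · rw [D.twist_eq_of_mem_minFace hx hε hΘ]; linarith
    · have := hL x.1 hx.1 ω (fun h' => h (Subtype.ext h')) hΘ
      linarith
  have := Finset.sum_le_sum hterm
  rw [hw.2, Finset.sum_add_distrib, Finset.sum_add_distrib, Finset.sum_ite_eq' Finset.univ o,
    if_pos (Finset.mem_univ _), Finset.sum_const, Finset.card_univ, nsmul_eq_mul] at this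
  linarith

theorem twistN_le (hn : Fintype.card D.A * δ ≤ ε / 2) {ω : D.A} (hω0 : (ω : Lat N) ≠ 0)
    (hω : latPt (ω : Lat N) ∉ minFace D.P {ε⁻¹ • x.1}) :
    D.twistN x.2 (D.weights L x.1) ω ≤ 2 / ε * δ := by
  have hZ := D.half_le_sum_twist hε hεP hδ hL hx hn
  rw [twistN, div_le_iff₀ (D.pairs_sum_pos hε hεP L hx)]
  have h1 := (D.twist_le_weights hεP hx ω).trans (hL x.1 hx.1 ω hω0 hω)
  have h2 := mul_le_mul_of_nonneg_left hZ (show 0 ≤ 2 / ε * δ by positivity)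
  have h3 : 2 / ε * δ * (ε / 2) = δ := by field_simp
  linarith

end Pairs

theorem exists_face_bdry_of_mem_minFace {q q' : Vec N} (hq : q ∈ frontier D.P)
    (hq' : q' ∈ minFace D.P {q}) : ∃ ρ ∈ D.bdry, q' ∈ convexHull ℝ (ρ : Set (Vec N)) ∧
      (ρ : Set (Vec N)) ⊆ minFace D.P {q} := by
  obtain ⟨hqP, u, hu, hu0⟩ := D.mem_frontier_iff.1 hq
  have h := (D.mem_minFace_singleton hqP).1 hq'
  have hfr : q' ∈ frontier D.P := D.mem_frontier_iff.2 ⟨h.1, u, hu, h.2 u hu hu0⟩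
  obtain ⟨ρ, hρ, w, hw0, hw1, hwq⟩ := D.exists_face_pos h.1
  refine ⟨ρ, D.mem_bdry_of_pos hρ hw0 hw1 hwq hfr, ?_, ?_⟩
  · rw [Finset.mem_convexHull']
    exact ⟨w, fun v hv => (hw0 v hv).le, hw1, hwq⟩
  · refine (subset_minFace D _).trans ?_
    rw [D.minFace_eq_of_pos hρ hw0 hw1 hwq, D.minFace_subset_minFace_iff h.1 hqP]
    exact h.2

/-- For large `L`, the points of `V_τ` lie in curved normal cones of faces that contain `τ`. -/
theorem exists_forall_subset_minFace {V : Finset (Vec N) → Set (Vec N)} (hV : D.IsDualCover V)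
    {ε : ℝ} (hε : 0 < ε) (hεP : ε • D.P ⊆ interior D.P) :
    ∃ L₀, ∀ L, L₀ ≤ L → ∀ x ∈ D.pairs ε, (∃ u, x.2 u = 0) → ∀ τ ∈ D.bdry,
      D.push L x ∈ closure (V τ) → (τ : Set (Vec N)) ⊆ minFace D.P {ε⁻¹ • x.1} := by
  classical
  have hcomp : ∀ τ ∈ D.bdry, IsCompact (closure (V τ)) := by
    intro τ hτ
    obtain ⟨O, -, hO⟩ := hV.isOpen τ hτ
    refine D.isCompact_P.of_isClosed_subset isClosed_closure (closure_minimal ?_ D.isClosed_P)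
    rw [hO]; exact inter_subset_right.trans D.frontier_subset_P
  have hclP : ∀ τ ∈ D.bdry, closure (V τ) ⊆ D.P := by
    intro τ hτ
    obtain ⟨O, -, hO⟩ := hV.isOpen τ hτ
    refine closure_minimal ?_ D.isClosed_P
    rw [hO]; exact inter_subset_right.trans D.frontier_subset_P
  -- A face enters only through its set U of tight normals, so there are finitely many pairs (τ, U)
  -- and the lower bound can be chosen before L and x.
  have h1 : ∀ z : Finset (Vec N) × Finset (Lat N), ∃ c : ℝ, 0 < c ∧ (z.1 ∈ D.bdry → z.2 ⊆ D.normals →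
      (∀ m ∈ closure (V z.1), ∃ u ∈ z.2, ht u m ≠ 0) →
      ∀ m ∈ closure (V z.1), c ≤ ∑ u ∈ z.2, ht u m) := by
    rintro ⟨τ, U⟩
    by_cases h : τ ∈ D.bdry ∧ U ⊆ D.normals ∧ (∀ m ∈ closure (V τ), ∃ u ∈ U, ht u m ≠ 0) ∧
      (closure (V τ)).Nonempty
    · obtain ⟨hτ, hU, hm, hne⟩ := h
      have hcont : Continuous fun m => ∑ u ∈ U, ht u m :=
        continuous_finsetSum _ fun u _ => continuous_ht u
      obtain ⟨m₀, hm₀, hmin⟩ := (hcomp τ hτ).exists_isMinOn hne hcont.continuousOn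
      refine ⟨∑ u ∈ U, ht u m₀, ?_, fun _ _ _ m hm => hmin hm⟩
      have hnn : ∀ u ∈ U, 0 ≤ ht u m₀ := fun u hu => D.ht_nonneg (hclP τ hτ hm₀) (hU hu)
      obtain ⟨u, hu, hu0⟩ := hm m₀ hm₀
      exact Finset.sum_pos' hnn ⟨u, hu, lt_of_le_of_ne (hnn u hu) (Ne.symm hu0)⟩
    · refine ⟨1, one_pos, fun h1 h2 h3 m hm => absurd ⟨h1, h2, h3, m, hm⟩ h⟩
  choose f hf0 hf using h1
  obtain ⟨c, hc0, hc⟩ := exists_pos_forall_le (D.finite_faces.toFinset ×ˢ D.normals.powerset)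
    fun z _ => hf0 z
  obtain ⟨B, hB⟩ := (Finset.univ.image fun ω : D.A =>
    ∑ u ∈ D.normals, ht u (latPt (ω : Lat N))).bddAbove
  have hB : ∀ ω : D.A, ∑ u ∈ D.normals, ht u (latPt (ω : Lat N)) ≤ B := fun ω =>
    hB (Finset.mem_coe.2 (Finset.mem_image_of_mem _ (Finset.mem_univ ω)))
  obtain ⟨δ, ⟨h2, h3⟩, hδ⟩ := (((eventually_mul_lt (Fintype.card D.A) (half_pos hε)).and
    (eventually_mul_lt (Fintype.card D.A * (2 / ε * B)) hc0)).and self_mem_nhdsWithin).exists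
  have hδ : 0 < δ := hδ
  obtain ⟨L₀, hL₀⟩ := D.exists_forall_weights_frontier_le hε hεP hδ
  refine ⟨L₀, fun L hL x hx ⟨u₀, hu₀⟩ τ hτ hmem => ?_⟩
  by_contra hcon
  have hconc : D.IsConcentrated ε δ L := hL₀ L hL
  have hq := (D.mem_frontier_smul_iff hε).1 hx.1
  have hqP := D.frontier_subset_P hq
  set U := D.normals.filter fun u => ht u (ε⁻¹ • x.1) = 0 with hU
  have hUn : U ⊆ D.normals := Finset.filter_subset _ _
  -- If τ is not contained in the face, neither is it contained in any simplex of ∂T inside the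
  -- face; the star condition then keeps the closure of V τ off the face.
  have hkey : ∀ m ∈ closure (V τ), ∃ u ∈ U, ht u m ≠ 0 := by
    intro m hm
    by_contra h
    push Not at h
    have hmΘ : m ∈ minFace D.P {ε⁻¹ • x.1} := (D.mem_minFace_singleton hqP).2
      ⟨hclP τ hτ hm, fun u hu hu0 => h u (Finset.mem_filter.2 ⟨hu, hu0⟩)⟩
    obtain ⟨ρ, hρ, hmρ, hρΘ⟩ := D.exists_face_bdry_of_mem_minFace hq hmΘ
    exact disjoint_left.1 (hV.star τ hτ ρ hρ fun h => hcon (fun v hv => hρΘ (h hv))) hm hmρ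
  have hlow : c ≤ ∑ u ∈ U, ht u (D.push L x) :=
    (hc (τ, U) (Finset.mem_product.2 ⟨D.finite_faces.mem_toFinset.2 hτ.1,
      Finset.mem_powerset.2 hUn⟩)).trans (hf (τ, U) hτ hUn hkey _ hmem)
  set v := D.twistN x.2 (D.weights L x.1) with hv
  have hvs : v ∈ stdSimplex ℝ D.A := D.toric_subset L (D.pairs_twistN_mem hε hεP L hx)
  have hval : ∑ u ∈ U, ht u (D.push L x) = ∑ ω, v ω * ∑ u ∈ U, ht u (latPt (ω : Lat N)) := by
    have h : ∀ u, ht u (D.push L x) = ∑ ω, v ω * ht u (latPt (ω : Lat N)) := fun u =>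
      D.ht_bary u hvs
    simp only [h, Finset.mul_sum]
    exact Finset.sum_comm
  have hB0 : 0 ≤ B := le_trans (Finset.sum_nonneg fun u hu => D.ht_nonneg
    (D.latPt_mem D.zero_mem) hu) (hB ⟨0, D.zero_mem⟩)
  -- The origin has lost its weight through y_{u₀} = 0, points of the face have height 0 over U, and
  -- all other weights are small.
  have hterm : ∀ ω ∈ Finset.univ, v ω * ∑ u ∈ U, ht u (latPt (ω : Lat N)) ≤ 2 / ε * δ * B := by
    intro ω _
    have hr : 0 ≤ 2 / ε * δ * B := by positivity
    by_cases h0 : (ω : Lat N) = 0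
    · have : v ω = 0 := by
        have hω : ω = ⟨0, D.zero_mem⟩ := Subtype.ext h0
        rw [hv, twistN, twist, hω, D.prod_latHt_zero, Finset.prod_eq_zero (Finset.mem_univ u₀) hu₀,
          mul_zero, zero_div]
      rw [this, zero_mul]; exact hr
    by_cases hΘ : latPt (ω : Lat N) ∈ minFace D.P {ε⁻¹ • x.1}
    · rw [Finset.sum_eq_zero, mul_zero]
      · exact hr
      · intro u hu
        obtain ⟨hu1, hu2⟩ := Finset.mem_filter.1 hu
        exact ((D.mem_minFace_singleton hqP).1 hΘ).2 u hu1 hu2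
    · refine mul_le_mul (D.twistN_le hε hεP hδ.le hconc hx h2.le h0 hΘ) ?_ ?_ (by positivity)
      · exact (Finset.sum_le_sum_of_subset_of_nonneg hUn fun u hu _ =>
          D.ht_nonneg (D.latPt_mem ω.2) hu).trans (hB ω)
      · exact Finset.sum_nonneg fun u hu => D.ht_nonneg (D.latPt_mem ω.2) (hUn hu)
  have hfin := Finset.sum_le_sum hterm
  rw [← hval, Finset.sum_const, Finset.card_univ, nsmul_eq_mul] at hfin
  have : (Fintype.card D.A : ℝ) * (2 / ε * δ * B) = Fintype.card D.A * (2 / ε * B) * δ := by ring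
  linarith

/-! ### Intervals cross the sphere only once -/

/-- A point of the ball has height at least η over a facet through the tip's face. The points of A
on the face contribute nothing and the others at most η/2 in total, so the origin must supply the
rest. -/
theorem half_le_twistN_zero {r η M : ℝ} (hη : ∀ u ∈ D.normals, ∀ m ∈ Metric.closedBall (0 : Vec N) r,
      η ≤ ht u m)
    (hM : ∀ (ω : D.A) (u : D.normals), ht (u : Lat N) (latPt (ω : Lat N)) ≤ M)
    {ε : ℝ} (hε : 0 < ε) (hεP : ε • D.P ⊆ interior D.P) {δ L : ℝ} (hδ : 0 ≤ δ)
    (hL : D.IsConcentrated ε δ L) (h1 : Fintype.card D.A * δ ≤ ε / 2)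
    (h2 : Fintype.card D.A * (2 / ε * M) * δ ≤ η / 2) {x : Vec N × (D.normals → ℝ)}
    (hx : x ∈ D.pairs ε) (hnorm : ‖D.push L x‖ ≤ r) :
    η / 2 ≤ D.twistN x.2 (D.weights L x.1) ⟨0, D.zero_mem⟩ := by
  classical
  have hqP := D.pairs_fst_mem hε hx
  obtain ⟨-, u, hu, hu0⟩ := D.mem_frontier_iff.1 ((D.mem_frontier_smul_iff hε).1 hx.1)
  have hM0 : 0 ≤ M := (D.ht_nonneg (D.latPt_mem D.zero_mem) hu).trans
    (hM ⟨0, D.zero_mem⟩ ⟨u, hu⟩)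
  obtain ⟨v, hv⟩ : ∃ v, v = D.twistN x.2 (D.weights L x.1) := ⟨_, rfl⟩
  have hvs : v ∈ stdSimplex ℝ D.A := hv ▸ D.toric_subset L (D.pairs_twistN_mem hε hεP L hx)
  have h4 : η ≤ ht u (D.push L x) := hη u hu _ (by simpa using hnorm)
  rw [push, ← hv, D.ht_bary u hvs] at h4
  rw [← hv]
  have hterm : ∀ ω ∈ Finset.univ, v ω * ht u (latPt (ω : Lat N)) ≤
      (if ω = ⟨0, D.zero_mem⟩ then v ⟨0, D.zero_mem⟩ else 0) + 2 / ε * δ * M := by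
    intro ω _
    have hr : 0 ≤ 2 / ε * δ * M := by positivity
    by_cases h0 : ω = ⟨0, D.zero_mem⟩
    · rw [if_pos h0, h0, latPt_zero, ht_zero, mul_one]; linarith
    rw [if_neg h0, zero_add]
    by_cases hΘ : latPt (ω : Lat N) ∈ minFace D.P {ε⁻¹ • x.1}
    · rw [((D.mem_minFace_singleton hqP).1 hΘ).2 u hu hu0, mul_zero]; exact hr
    · have h5 := D.twistN_le hε hεP hδ hL hx h1 (fun h' => h0 (Subtype.ext h')) hΘ
      rw [← hv] at h5
      exact mul_le_mul h5 (hM ω ⟨u, hu⟩) (D.ht_nonneg (D.latPt_mem ω.2) hu) (by positivity)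
  have h5 := h4.trans (Finset.sum_le_sum hterm)
  rw [Finset.sum_add_distrib, Finset.sum_ite_eq' Finset.univ, if_pos (Finset.mem_univ _),
    Finset.sum_const, Finset.card_univ, nsmul_eq_mul] at h5
  have : (Fintype.card D.A : ℝ) * (2 / ε * δ * M) = Fintype.card D.A * (2 / ε * M) * δ := by ring
  linarith

/-- The change of the twisted weights when the factors grow from `y₁` to `y₂`, compared to the
change of the weight of `0`. -/
theorem twist_sub_twist_le {K : ℕ} (hK : ∀ (ω : D.A) (u : D.normals), latHt (u : Lat N) (ω : Lat N) ≤ K)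
    {ε : ℝ} (hε : 0 < ε) {δ L : ℝ} (hδ : 0 ≤ δ)
    (hL : D.IsConcentrated ε δ L) {s' : Vec N} {y₁ y₂ : D.normals → ℝ}
    (hx₁ : (s', y₁) ∈ D.pairs ε) (hx₂ : (s', y₂) ∈ D.pairs ε) (hw : ∀ ω, 0 < D.weights L s' ω)
    (hy₁ : ∀ u, 0 < y₁ u) (hle : ∀ u, y₁ u ≤ y₂ u)
    {ω : D.A} (h0 : (ω : Lat N) ≠ 0) :
    D.twist y₂ (D.weights L s') ω - D.twist y₁ (D.weights L s') ω ≤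
      δ * (K * (1 - (∏ u, y₁ u) / ∏ u, y₂ u)) := by
  have hy₂ : ∀ u, 0 < y₂ u := fun u => (hy₁ u).trans_le (hle u)
  have hQ : 0 ≤ 1 - (∏ u, y₁ u) / ∏ u, y₂ u := by
    rw [sub_nonneg, div_le_one (Finset.prod_pos fun u _ => hy₂ u)]
    exact Finset.prod_le_prod (fun u _ => (hy₁ u).le) fun u _ => hle u
  by_cases hΘ : latPt (ω : Lat N) ∈ minFace D.P {ε⁻¹ • s'}
  · have e1 : D.twist y₁ (D.weights L s') ω = D.weights L s' ω :=
      D.twist_eq_of_mem_minFace hx₁ hε hΘ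
    have e2 : D.twist y₂ (D.weights L s') ω = D.weights L s' ω :=
      D.twist_eq_of_mem_minFace hx₂ hε hΘ
    rw [e1, e2, sub_self]; positivity
  · rw [twist, twist, ← mul_sub]
    have h4 := prod_pow_sub_prod_pow_le hy₁ hle (fun u => (hx₂.2.1 u).2) (hK ω)
    have h5 := hL s' hx₁.1 ω h0 hΘ
    refine (mul_le_mul_of_nonneg_left h4 (hw ω).le).trans ?_
    exact mul_le_mul_of_nonneg_right h5 (by positivity)

/-- Unnormalized weights are compared to avoid quotients. Extra mass at the origin enlarges the
total but does not move the weighted sum, whose increment is kept below r c by the smallness of the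
other contributions. -/
theorem norm_bary_lt {g₁ g₂ : D.A → ℝ} {r c B : ℝ} (hr : 0 < r) (hc : ∀ ω, g₁ ω ≤ g₂ ω)
    (h : ‖D.bary g₁‖ ≤ r * ∑ ω, g₁ ω)
    (h0 : c ≤ g₂ ⟨0, D.zero_mem⟩ - g₁ ⟨0, D.zero_mem⟩)
    (hB : ∀ ω, (g₂ ω - g₁ ω) * ‖latPt (ω : Lat N)‖ ≤ B)
    (hBc : Fintype.card D.A * B < r * c) : ‖D.bary g₂‖ < r * ∑ ω, g₂ ω := by
  have hbary : ‖D.bary (g₂ - g₁)‖ ≤ Fintype.card D.A * B := by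
    refine (norm_sum_le _ _).trans ?_
    have h5 : ∀ ω ∈ Finset.univ, ‖(g₂ - g₁) ω • latPt (ω : Lat N)‖ ≤ B := fun ω _ => by
      rw [norm_smul, Pi.sub_apply, Real.norm_of_nonneg (sub_nonneg.2 (hc ω))]
      exact hB ω
    refine (Finset.sum_le_sum h5).trans ?_
    rw [Finset.sum_const, Finset.card_univ, nsmul_eq_mul]
  have h4 : D.bary g₂ = D.bary g₁ + D.bary (g₂ - g₁) := by rw [← bary_add, add_sub_cancel]
  have h5 : c ≤ ∑ ω, g₂ ω - ∑ ω, g₁ ω := by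
    rw [← Finset.sum_sub_distrib]
    exact h0.trans (Finset.single_le_sum (f := fun ω => g₂ ω - g₁ ω)
      (fun ω _ => sub_nonneg.2 (hc ω)) (Finset.mem_univ _))
  have h6 := mul_le_mul_of_nonneg_left h5 hr.le
  have h7 := norm_add_le (D.bary g₁) (D.bary (g₂ - g₁))
  rw [← h4] at h7
  linarith

/-- With Q = 1 - ∏ y₁ / ∏ y₂, the unnormalized weight of the origin grows by at least (η/2)(ε/2) Q
inside the ball, while every other weight grows by at most δ K Q. Both are proportional to Q, so
smallness of δ decides uniformly, however close y₁ and y₂ are. -/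
theorem norm_push_lt {r η M₁ M₂ : ℝ} (hr : 0 < r) (hη0 : 0 < η)
    (hη : ∀ u ∈ D.normals, ∀ m ∈ Metric.closedBall (0 : Vec N) r, η ≤ ht u m)
    (hM₁ : ∀ (ω : D.A) (u : D.normals), ht (u : Lat N) (latPt (ω : Lat N)) ≤ M₁)
    (hM₂ : ∀ ω : D.A, ‖latPt (ω : Lat N)‖ ≤ M₂)
    {K : ℕ} (hK : ∀ (ω : D.A) (u : D.normals), latHt (u : Lat N) (ω : Lat N) ≤ K)
    {ε : ℝ} (hε : 0 < ε) (hεP : ε • D.P ⊆ interior D.P) {δ L : ℝ} (hδ : 0 ≤ δ)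
    (hL : D.IsConcentrated ε δ L) (h1 : Fintype.card D.A * δ ≤ ε / 2)
    (h2 : Fintype.card D.A * (2 / ε * M₁) * δ ≤ η / 2)
    (h3 : Fintype.card D.A * (K * M₂) * δ < r * (η / 2 * (ε / 2))) {s' : Vec N}
    {y₁ y₂ : D.normals → ℝ} (hx₁ : (s', y₁) ∈ D.pairs ε) (hx₂ : (s', y₂) ∈ D.pairs ε)
    (hle : ∀ u, y₁ u ≤ y₂ u) (hlt : ∃ u, y₁ u < y₂ u) (hnorm : ‖D.push L (s', y₁)‖ ≤ r) :
    ‖D.push L (s', y₂)‖ < r := by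
  have hwpos := D.weights_pos L (D.pairs_fst_mem_interior hεP hx₁)
  have hZ₁h := D.half_le_sum_twist hε hεP hδ hL hx₁ h1
  have hZ₁ := D.pairs_sum_pos hε hεP L hx₁
  have hZ₂ := D.pairs_sum_pos hε hεP L hx₂
  have hv0 := D.half_le_twistN_zero hη hM₁ hε hεP hδ hL h1 h2 hx₁ hnorm
  rw [push_eq_inv_smul, norm_smul, norm_inv, Real.norm_of_nonneg hZ₁.le, inv_mul_le_iff₀ hZ₁,
    mul_comm] at hnorm
  rw [push_eq_inv_smul, norm_smul, norm_inv, Real.norm_of_nonneg hZ₂.le, inv_mul_lt_iff₀ hZ₂,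
    mul_comm]
  rw [twistN, le_div_iff₀ hZ₁] at hv0
  change ∀ ω, 0 < D.weights L s' ω at hwpos
  change _ ≤ D.twist y₁ (D.weights L s') _ at hv0
  change ‖D.bary (D.twist y₁ (D.weights L s'))‖ ≤ r * ∑ ω, D.twist y₁ (D.weights L s') ω at hnorm
  change ε / 2 ≤ ∑ ω, D.twist y₁ (D.weights L s') ω at hZ₁h
  change ‖D.bary (D.twist y₂ (D.weights L s'))‖ < r * ∑ ω, D.twist y₂ (D.weights L s') ω
  have ht0 : ∀ y : D.normals → ℝ, D.twist y (D.weights L s') ⟨0, D.zero_mem⟩ =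
      D.weights L s' ⟨0, D.zero_mem⟩ * ∏ u, y u := fun y => by
    rw [twist, D.prod_latHt_zero]
  have hκ : η / 2 * (ε / 2) ≤ D.weights L s' ⟨0, D.zero_mem⟩ * ∏ u, y₁ u := by
    rw [← ht0]
    exact (mul_le_mul_of_nonneg_left hZ₁h (half_pos hη0).le).trans hv0
  have hκ0 : 0 < η / 2 * (ε / 2) := by positivity
  have hP₁ : 0 < ∏ u, y₁ u := (pos_iff_pos_of_mul_pos (hκ0.trans_le hκ)).1 (hwpos _)
  have hy₁ : ∀ u, 0 < y₁ u := by
    intro u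
    refine lt_of_le_of_ne (hx₁.2.1 u).1 fun h => hP₁.ne' ?_
    exact Finset.prod_eq_zero (Finset.mem_univ u) h.symm
  have hP₁₂ : ∏ u, y₁ u < ∏ u, y₂ u :=
    Finset.prod_lt_prod (fun u _ => hy₁ u) (fun u _ => hle u)
      (hlt.imp fun u h => ⟨Finset.mem_univ u, h⟩)
  have hP₂ := hP₁.trans hP₁₂
  have hdω := fun ω h0 => D.twist_sub_twist_le (ω := ω) hK hε hδ hL hx₁ hx₂ hwpos hy₁ hle h0
  have hQ0 : 0 < 1 - (∏ u, y₁ u) / ∏ u, y₂ u := by rw [sub_pos, div_lt_one hP₂]; exact hP₁₂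
  have hP₂Q : ∏ u, y₂ u - ∏ u, y₁ u = (∏ u, y₂ u) * (1 - (∏ u, y₁ u) / ∏ u, y₂ u) := by
    field_simp
  generalize 1 - (∏ u, y₁ u) / ∏ u, y₂ u = Q at hdω hQ0 hP₂Q
  have hM₂0 : 0 ≤ M₂ := (norm_nonneg _).trans (hM₂ ⟨0, D.zero_mem⟩)
  refine D.norm_bary_lt hr (c := η / 2 * (ε / 2) * Q) (B := δ * (K * Q) * M₂) (fun ω => ?_) hnorm
    ?_ (fun ω => ?_) ?_
  · exact mul_le_mul_of_nonneg_left (Finset.prod_le_prod (fun u _ => pow_nonneg (hy₁ u).le _)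
      fun u _ => pow_le_pow_left₀ (hy₁ u).le (hle u) _) (hwpos ω).le
  · rw [ht0, ht0, ← mul_sub, hP₂Q, ← mul_assoc]
    exact mul_le_mul_of_nonneg_right (hκ.trans
      (mul_le_mul_of_nonneg_left hP₁₂.le (hwpos _).le)) hQ0.le
  · by_cases h0 : (ω : Lat N) = 0
    · rw [h0, latPt_zero, norm_zero, mul_zero]; positivity
    · exact mul_le_mul (hdω ω h0) (hM₂ ω) (norm_nonneg _) (by positivity)
  · have := mul_lt_mul_of_pos_right h3 hQ0
    calc (Fintype.card D.A : ℝ) * (δ * (K * Q) * M₂) =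
        Fintype.card D.A * (K * M₂) * δ * Q := by ring
      _ < r * (η / 2 * (ε / 2)) * Q := this
      _ = r * (η / 2 * (ε / 2) * Q) := by ring

theorem exists_pos_forall_le_ht {r : ℝ} (hr : 0 < r)
    (hrP : Metric.closedBall (0 : Vec N) r ⊆ interior D.P) :
    ∃ η > 0, ∀ u ∈ D.normals, ∀ m ∈ Metric.closedBall (0 : Vec N) r, η ≤ ht u m := by
  have h1 : ∀ u, ∃ c : ℝ, 0 < c ∧ (u ∈ D.normals → ∀ m ∈ Metric.closedBall (0 : Vec N) r,
      c ≤ ht u m) := by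
    intro u
    by_cases hu : u ∈ D.normals
    · obtain ⟨m₀, hm₀, hmin⟩ := (isCompact_closedBall (0 : Vec N) r).exists_isMinOn
        ⟨0, Metric.mem_closedBall_self hr.le⟩ (continuous_ht u).continuousOn
      exact ⟨_, D.mem_interior_iff.1 (hrP hm₀) u hu, fun _ m hm => hmin hm⟩
    · exact ⟨1, one_pos, fun h => absurd h hu⟩
  choose f hf0 hf using h1
  obtain ⟨c, hc0, hc⟩ := exists_pos_forall_le D.normals fun u _ => hf0 u
  exact ⟨c, hc0, fun u hu m hm => (hc u hu).trans (hf u hu m hm)⟩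

/-- For large `L`, the intervals enter the ball of radius `r` and stay there. -/
theorem exists_forall_norm_push_lt {r : ℝ} (hr : 0 < r)
    (hrP : Metric.closedBall (0 : Vec N) r ⊆ interior D.P)
    {ε : ℝ} (hε : 0 < ε) (hεP : ε • D.P ⊆ interior D.P) :
    ∃ L₀, ∀ L, L₀ ≤ L → ∀ s' y₁ y₂, (s', y₁) ∈ D.pairs ε → (s', y₂) ∈ D.pairs ε →
      (∀ u, y₁ u ≤ y₂ u) → (∃ u, y₁ u < y₂ u) → ‖D.push L (s', y₁)‖ ≤ r →
      ‖D.push L (s', y₂)‖ < r := by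
  obtain ⟨η, hη0, hη⟩ := D.exists_pos_forall_le_ht hr hrP
  obtain ⟨M₁, hM₁⟩ := (finite_range fun z : D.A × D.normals =>
    ht (z.2 : Lat N) (latPt (z.1 : Lat N))).bddAbove
  obtain ⟨M₂, hM₂⟩ := (finite_range fun ω : D.A => ‖latPt (ω : Lat N)‖).bddAbove
  obtain ⟨K, hK⟩ := (finite_range fun z : D.A × D.normals =>
    latHt (z.2 : Lat N) (z.1 : Lat N)).bddAbove
  obtain ⟨δ, ⟨⟨h1, h2⟩, h3⟩, hδ⟩ := ((((eventually_mul_lt (Fintype.card D.A) (half_pos hε)).and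
    (eventually_mul_lt (Fintype.card D.A * (2 / ε * M₁)) (half_pos hη0))).and
    (eventually_mul_lt (Fintype.card D.A * (K * M₂))
      (show 0 < r * (η / 2 * (ε / 2)) by positivity))).and self_mem_nhdsWithin).exists
  have hδ : 0 < δ := hδ
  obtain ⟨L₀, hL₀⟩ := D.exists_forall_weights_frontier_le hε hεP hδ
  exact ⟨L₀, fun L hL s' y₁ y₂ hx₁ hx₂ hle hlt hnorm =>
    D.norm_push_lt hr hη0 hη (fun ω u => hM₁ ⟨(ω, u), rfl⟩) (fun ω => hM₂ ⟨ω, rfl⟩)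
      (fun ω u => hK ⟨(ω, u), rfl⟩) hε hεP hδ.le (hL₀ L hL) h1.le h2.le h3 hx₁ hx₂ hle hlt hnorm⟩

end CYData

/-! ### The trivialization -/

/-- The closed graph theorem in the compact setting: the projection of the compact graph to X is a
continuous bijection onto a Hausdorff space. -/
theorem exists_continuous_of_existsUnique {X Y : Type*} [TopologicalSpace X] [TopologicalSpace Y]
    [CompactSpace X] [CompactSpace Y] [T2Space X] {Γ : Set (X × Y)} (hΓ : IsClosed Γ)
    (h : ∀ x, ∃! y, (x, y) ∈ Γ) : ∃ f : X → Y, Continuous f ∧ ∀ x, (x, f x) ∈ Γ := by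
  have hcomp : CompactSpace Γ := isCompact_iff_compactSpace.1 hΓ.isCompact
  let e : Γ ≃ X := Equiv.ofBijective (fun z => z.1.1) ⟨by
    rintro ⟨⟨x, y⟩, hz⟩ ⟨⟨x', y'⟩, hz'⟩ hxx
    obtain rfl : x = x' := hxx
    obtain rfl := (h x).unique hz hz'
    rfl, fun x => by
    obtain ⟨y, hy, -⟩ := h x
    exact ⟨⟨(x, y), hy⟩, rfl⟩⟩
  have he : Continuous e := continuous_fst.comp continuous_subtype_val
  let H := he.homeoOfEquivCompactToT2
  refine ⟨fun x => (H.symm x).1.2, by fun_prop, fun x => ?_⟩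
  have h1 : (H.symm x).1.1 = x := H.apply_symm_apply x
  have h2 := (H.symm x).2
  convert h2 using 1
  exact Prod.ext h1.symm rfl

/-- A family of functions on `[0, 1]` that fall below the level `r` once and for all does so at a
time that depends continuously on the parameter. -/
theorem exists_crossing {X : Type*} [TopologicalSpace X] [CompactSpace X] [T2Space X]
    {F : X → ℝ → ℝ} {r : ℝ} (hF : Continuous fun z : X × Icc (0 : ℝ) 1 => F z.1 z.2)
    (h0 : ∀ x, r < F x 0) (h1 : ∀ x, F x 1 < r)
    (hlt : ∀ x, ∀ θ ∈ Icc (0 : ℝ) 1, ∀ θ' ∈ Icc (0 : ℝ) 1, θ < θ' → F x θ ≤ r → F x θ' < r) :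
    ∃ f : X → Icc (0 : ℝ) 1, Continuous f ∧ (∀ x, 0 < (f x : ℝ)) ∧
      (∀ x, (f x : ℝ) < 1) ∧ ∀ x, ∀ θ ∈ Icc (0 : ℝ) 1, r ≤ F x θ ↔ θ ≤ f x := by
  have hΓ : IsClosed {z : X × Icc (0 : ℝ) 1 | F z.1 z.2 = r} := isClosed_eq hF continuous_const
  obtain ⟨f, hf, hfr⟩ := exists_continuous_of_existsUnique hΓ (by
    intro x
    have hc : Continuous fun θ : Icc (0 : ℝ) 1 => F x θ := hF.comp (Continuous.prodMk_right x)
    obtain ⟨θ, hθ⟩ := mem_range_of_exists_le_of_exists_ge hc ⟨1, (h1 x).le⟩ ⟨0, (h0 x).le⟩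
    have hθ : F x θ = r := hθ
    refine ⟨θ, hθ, fun θ' hθ' => ?_⟩
    have hθ' : F x θ' = r := hθ'
    rcases lt_trichotomy (θ : ℝ) θ' with h | h | h
    · exact absurd hθ' (hlt x θ θ.2 θ' θ'.2 h hθ.le).ne
    · exact Subtype.ext h.symm
    · exact absurd hθ (hlt x θ' θ'.2 θ θ.2 h hθ'.le).ne)
  have hfr : ∀ x, F x (f x) = r := hfr
  refine ⟨f, hf, fun x => ?_, fun x => ?_, fun x θ hθ => ⟨fun h => ?_, fun h => ?_⟩⟩
  · refine lt_of_le_of_ne (f x).2.1 fun h => ?_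
    have := h0 x
    rw [h, hfr] at this
    exact lt_irrefl _ this
  · refine lt_of_le_of_ne (f x).2.2 fun h => ?_
    have := h1 x
    rw [← h, hfr] at this
    exact lt_irrefl _ this
  · by_contra hcon
    exact absurd h (not_le.2 (hlt x _ (f x).2 θ hθ (not_le.1 hcon) (hfr x).le))
  · by_contra hcon
    have hle := (not_le.1 hcon).le
    rcases h.eq_or_lt with h | h
    · rw [h, hfr] at hcon; exact hcon le_rfl
    · exact absurd (hfr x) (hlt x θ hθ _ (f x).2 h hle).ne

namespace CYData

variable {N : ℕ} (D : CYData N)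

/-- The pairs that are mapped to `∂P`. -/
def bdryPairs (ε : ℝ) : Set (Vec N × (D.normals → ℝ)) := {x | x ∈ D.pairs ε ∧ ∃ u, x.2 u = 0}

theorem isCompact_bdryPairs {ε : ℝ} : IsCompact (D.bdryPairs ε) := by
  refine D.isCompact_pairs.inter_right ?_
  change IsClosed {x : Vec N × (D.normals → ℝ) | ∃ u, x.2 u = 0}
  simp only [ofPred_exists]
  exact isClosed_iUnion_of_finite fun u => isClosed_eq (by fun_prop) continuous_const

theorem continuous_slide : Continuous fun z : (Vec N × (D.normals → ℝ)) × ℝ => D.slide z.1 z.2 := by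
  unfold slide; fun_prop

theorem slide_zero (x : Vec N × (D.normals → ℝ)) : D.slide x 0 = x := by simp [slide]

section Pairs

variable {ε : ℝ} (hN : 1 ≤ N) (hε : 0 < ε) (hεP : ε • D.P ⊆ interior D.P)

theorem push_slide_one (L : ℝ) {x : Vec N × (D.normals → ℝ)} (hx : x.1 ∈ D.P) :
    D.push L (D.slide x 1) = x.1 := by
  have h1 : D.twist (D.slide x 1).2 (D.weights L (D.slide x 1).1) = D.weights L x.1 := by
    funext ω; simp [twist, slide]
  rw [push_eq_inv_smul, h1, (D.weights_mem L hx).2, inv_one, one_smul, D.bary_weights L hx]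

include hN hε hεP

theorem exists_homeomorph_frontier (L : ℝ) :
    ∃ e : D.bdryPairs ε ≃ₜ frontier D.P, ∀ x, (e x : Vec N) = D.push L x := by
  have hcomp : CompactSpace (D.bdryPairs ε) := isCompact_iff_compactSpace.1 D.isCompact_bdryPairs
  let e : D.bdryPairs ε ≃ frontier D.P := Equiv.ofBijective
    (fun x => ⟨D.push L x, (D.push_mem_frontier_iff hε hεP L x.2.1).2 x.2.2⟩) ⟨by
      intro x x' h
      exact Subtype.ext (D.injOn_push hε hεP hN L x.2.1 x'.2.1 (congrArg Subtype.val h)), by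
      rintro ⟨s, hs⟩
      obtain ⟨x, hx, rfl⟩ := D.exists_push_eq_of_frontier hε hεP L hs
      exact ⟨⟨x, hx, (D.push_mem_frontier_iff hε hεP L hx).1 hs⟩, rfl⟩⟩
  have he : Continuous e := Continuous.subtype_mk
    (((D.continuousOn_push hε hεP L).comp_continuous continuous_subtype_val fun x => x.2.1)) _
  exact ⟨he.homeoOfEquivCompactToT2, fun x => rfl⟩

omit hN in
theorem continuous_push_slide (L : ℝ) :
    Continuous fun z : D.bdryPairs ε × Icc (0 : ℝ) 1 => D.push L (D.slide z.1 z.2) :=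
  (D.continuousOn_push hε hεP L).comp_continuous
    (D.continuous_slide.comp (f := fun z : D.bdryPairs ε × Icc (0 : ℝ) 1 =>
      ((z.1 : Vec N × (D.normals → ℝ)), (z.2 : ℝ))) (by fun_prop)) fun z => D.slide_mem z.1.2.1 z.2.2

omit hN hε hεP in
-- A boundary pair has a factor 0, so θ is the smallest factor after sliding; for θ < 1 the original
-- factors can then be solved for.
theorem slide_injective {x x' : Vec N × (D.normals → ℝ)} (hx : x ∈ D.bdryPairs ε)
    (hx' : x' ∈ D.bdryPairs ε) {θ θ' : ℝ} (hθ : θ < 1) (hθ' : θ' < 1)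
    (h : D.slide x θ = D.slide x' θ') : x = x' ∧ θ = θ' := by
  have hy : ∀ u, (1 - θ) * x.2 u + θ = (1 - θ') * x'.2 u + θ' := fun u =>
    congrFun (congrArg Prod.snd h) u
  have h1 : θ = θ' := by
    obtain ⟨u, hu⟩ := hx.2
    obtain ⟨u', hu'⟩ := hx'.2
    have e1 := hy u
    have e2 := hy u'
    rw [hu] at e1
    rw [hu'] at e2
    have := mul_nonneg (sub_nonneg.2 hθ'.le) (hx'.1.2.1 u).1
    have := mul_nonneg (sub_nonneg.2 hθ.le) (hx.1.2.1 u').1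
    linarith
  subst h1
  refine ⟨Prod.ext (congrArg Prod.fst h :) (funext fun u => ?_), rfl⟩
  have := hy u
  exact mul_left_cancel₀ (sub_pos.2 hθ).ne' (by linarith)

omit hN hε hεP in
-- Take θ to be the smallest factor and rescale the interval from θ to 1 onto [0, 1].
theorem exists_slide_eq {x' : Vec N × (D.normals → ℝ)} (hx' : x' ∈ D.pairs ε)
    (h : ∃ u, x'.2 u ≠ 1) : ∃ x ∈ D.bdryPairs ε, ∃ θ ∈ Icc (0 : ℝ) 1, D.slide x θ = x' := by
  obtain ⟨u₁, hu₁⟩ := h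
  obtain ⟨u₀, -, hmin⟩ := Finset.univ.exists_min_image x'.2 ⟨u₁, Finset.mem_univ _⟩
  have hmin : ∀ u, x'.2 u₀ ≤ x'.2 u := fun u => hmin u (Finset.mem_univ u)
  have hlt : x'.2 u₀ < 1 := (hmin u₁).trans_lt (lt_of_le_of_ne (hx'.2.1 u₁).2 hu₁)
  have hpos : 0 < 1 - x'.2 u₀ := sub_pos.2 hlt
  refine ⟨(x'.1, fun u => (x'.2 u - x'.2 u₀) / (1 - x'.2 u₀)), ⟨⟨hx'.1, fun u => ?_, fun u => ?_⟩,
    u₀, ?_⟩, x'.2 u₀, hx'.2.1 u₀, Prod.ext rfl (funext fun u => ?_)⟩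
  · exact ⟨div_nonneg (sub_nonneg.2 (hmin u)) hpos.le,
      (div_le_one hpos).2 (sub_le_sub_right (hx'.2.1 u).2 _)⟩
  · refine (hx'.2.2 u).imp (fun h => ?_) id
    change (x'.2 u - x'.2 u₀) / (1 - x'.2 u₀) = 1
    rw [h, div_self hpos.ne']
  · change (x'.2 u₀ - x'.2 u₀) / (1 - x'.2 u₀) = 0
    rw [sub_self, zero_div]
  · change (1 - x'.2 u₀) * ((x'.2 u - x'.2 u₀) / (1 - x'.2 u₀)) + x'.2 u₀ = x'.2 u
    rw [mul_div_cancel₀ _ hpos.ne']; ring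

variable {r L : ℝ} (hrP : Metric.closedBall (0 : Vec N) r ⊆ interior D.P)
  (hεr : ε • D.P ⊆ Metric.ball (0 : Vec N) r)
  (hT : ∀ s' y₁ y₂, (s', y₁) ∈ D.pairs ε → (s', y₂) ∈ D.pairs ε →
      (∀ u, y₁ u ≤ y₂ u) → (∃ u, y₁ u < y₂ u) → ‖D.push L (s', y₁)‖ ≤ r →
      ‖D.push L (s', y₂)‖ < r)

include hrP hεr hT

omit hN hε hεP hrP hεr in
theorem norm_push_slide_lt {x : Vec N × (D.normals → ℝ)} (hx : x ∈ D.bdryPairs ε) {θ θ' : ℝ}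
    (hθ : θ ∈ Icc (0 : ℝ) 1) (hθ' : θ' ∈ Icc (0 : ℝ) 1) (hlt : θ < θ')
    (h : ‖D.push L (D.slide x θ)‖ ≤ r) : ‖D.push L (D.slide x θ')‖ < r := by
  obtain ⟨u₀, hu₀⟩ := hx.2
  refine hT x.1 _ _ (D.slide_mem hx.1 hθ) (D.slide_mem hx.1 hθ') (fun u => ?_) ⟨u₀, ?_⟩ h
  · nlinarith [(hx.1.2.1 u).2]
  · rw [hu₀]; linarith

omit hN hεr hT in
theorem lt_norm_push_slide_zero {x : Vec N × (D.normals → ℝ)} (hx : x ∈ D.bdryPairs ε) :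
    r < ‖D.push L (D.slide x 0)‖ := by
  rw [slide_zero]
  have h := (D.push_mem_frontier_iff hε hεP L hx.1).2 hx.2
  by_contra hcon
  exact h.2 (hrP (by simpa using hcon))

omit hN hε hrP hT in
theorem norm_push_slide_one_lt {x : Vec N × (D.normals → ℝ)} (hx : x ∈ D.bdryPairs ε) :
    ‖D.push L (D.slide x 1)‖ < r := by
  rw [D.push_slide_one L (interior_subset (D.pairs_fst_mem_interior hεP hx.1))]
  simpa using hεr (D.frontier_smul_subset hx.1.1)

/-- Pairs on the boundary parametrize ∂P, and sliding them sweeps out the complement of ε P. Cutting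
each path at its unique crossing with the sphere of radius r, at a time depending continuously on
the path, and rescaling this time to 1 gives a continuous bijection from a compact space. -/
theorem exists_trivialization :
    ∃ (h : Metric.sphere (0 : Vec N) 1 ≃ₜ frontier D.P)
      (Φ : (Metric.sphere (0 : Vec N) 1 × Icc (0 : ℝ) 1) ≃ₜ D.P0 r),
      (∀ p, (Φ (p, 0) : Vec N) = h p) ∧
      ∀ p, ∃ x ∈ D.pairs ε, D.push L x = h p ∧
        (range fun θ : Icc (0 : ℝ) 1 => (Φ (p, θ) : Vec N)) =
          {m | ∃ θ ∈ Icc (0 : ℝ) 1, D.push L (D.slide x θ) = m} ∩ D.P0 r := by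
  obtain ⟨H, -, -, hH⟩ := exists_homeomorph_image_interior_closure_frontier_eq_unitBall D.convex_P
    ⟨0, D.zero_mem_interior⟩ D.isCompact_P.isBounded
  let h : Metric.sphere (0 : Vec N) 1 ≃ₜ frontier D.P := H.symm.subtype fun x => by
    rw [← hH]
    constructor
    · rintro ⟨z, hz, rfl⟩; rwa [H.symm_apply_apply]
    · intro hx; exact ⟨_, hx, H.apply_symm_apply x⟩
  obtain ⟨e, he⟩ := D.exists_homeomorph_frontier hN hε hεP L
  have hcomp : CompactSpace (D.bdryPairs ε) := isCompact_iff_compactSpace.1 D.isCompact_bdryPairs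
  obtain ⟨f, hf, hf0, hf1, hfr⟩ := exists_crossing
    (F := fun (x : D.bdryPairs ε) θ => ‖D.push L (D.slide x θ)‖)
    (D.continuous_push_slide hε hεP L).norm
    (fun x => D.lt_norm_push_slide_zero hε hεP hrP x.2)
    (fun x => D.norm_push_slide_one_lt hεP hεr x.2)
    (fun x θ hθ θ' hθ' => D.norm_push_slide_lt hT x.2 hθ hθ')
  let g : Metric.sphere (0 : Vec N) 1 ≃ₜ D.bdryPairs ε := h.trans e.symm
  have hg : ∀ p, D.push L (g p) = h p := fun p => by
    rw [← he]
    exact congrArg Subtype.val (e.apply_symm_apply (h p))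
  have hP0 : ∀ x : D.bdryPairs ε, ∀ θ ∈ Icc (0 : ℝ) 1,
      D.push L (D.slide x θ) ∈ D.P0 r ↔ θ ≤ f x := by
    intro x θ hθ
    rw [← hfr x θ hθ]
    have := D.push_mem_P hε hεP L (D.slide_mem x.2.1 hθ)
    simp [P0, this]
  have hmulmem : ∀ (x : D.bdryPairs ε) (θ : Icc (0 : ℝ) 1), (θ : ℝ) * f x ∈ Icc (0 : ℝ) 1 :=
    fun x θ => (θ * f x).2
  have hmulle : ∀ (x : D.bdryPairs ε) (θ : Icc (0 : ℝ) 1), (θ : ℝ) * f x ≤ f x :=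
    fun x θ => mul_le_of_le_one_left (hf0 x).le θ.2.2
  let Ψ : Metric.sphere (0 : Vec N) 1 × Icc (0 : ℝ) 1 → D.P0 r := fun z =>
    ⟨D.push L (D.slide (g z.1) (z.2 * f (g z.1))), (hP0 _ _ (hmulmem _ _)).2 (hmulle _ _)⟩
  have hΨc : Continuous Ψ := by
    refine Continuous.subtype_mk ?_ _
    exact (D.continuous_push_slide hε hεP L).comp
      (f := fun z : Metric.sphere (0 : Vec N) 1 × Icc (0 : ℝ) 1 => (g z.1, z.2 * f (g z.1)))
      (by fun_prop)
  have hinj : Function.Injective Ψ := by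
    rintro ⟨p, θ⟩ ⟨p', θ'⟩ heq
    have h1 : D.slide (g p) (θ * f (g p)) = D.slide (g p') (θ' * f (g p')) :=
      D.injOn_push hε hεP hN L (D.slide_mem (g p).2.1 (hmulmem _ _))
        (D.slide_mem (g p').2.1 (hmulmem _ _)) (congrArg Subtype.val heq)
    obtain ⟨h2, h3⟩ := D.slide_injective (g p).2 (g p').2 ((hmulle _ _).trans_lt (hf1 _))
      ((hmulle _ _).trans_lt (hf1 _)) h1
    have h4 : p = p' := g.injective (Subtype.ext h2)
    subst h4
    exact Prod.ext rfl (Subtype.ext (mul_right_cancel₀ (hf0 _).ne' h3))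
  have hdiv : ∀ x : D.bdryPairs ε, ∀ θ ∈ Icc (0 : ℝ) 1, θ ≤ f x →
      ∃ θ' : Icc (0 : ℝ) 1, (θ' : ℝ) * f x = θ := fun x θ hθ hle =>
    ⟨⟨θ / f x, div_nonneg hθ.1 (hf0 x).le, (div_le_one (hf0 x)).2 hle⟩,
      div_mul_cancel₀ _ (hf0 x).ne'⟩
  have hsurj : Function.Surjective Ψ := by
    rintro ⟨m, hm⟩
    have hmε : m ∉ ε • D.P := fun h' => hm.2 (hεr h')
    obtain ⟨x', hx', rfl⟩ := D.exists_push_eq hε hεP L hm.1 hmε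
    -- If all factors were 1, the point would be its own tip and lie in ε P.
    obtain ⟨x, hx, θ, hθ, rfl⟩ := D.exists_slide_eq hx' (by
      by_contra hcon
      push Not at hcon
      have h1 : D.slide x' 1 = x' := Prod.ext rfl (funext fun u => by simp [slide, hcon u])
      rw [← h1, D.push_slide_one L (interior_subset (D.pairs_fst_mem_interior hεP hx'))] at hmε
      exact hmε (D.frontier_smul_subset hx'.1))
    obtain ⟨θ', hθ'⟩ := hdiv ⟨x, hx⟩ θ hθ ((hP0 ⟨x, hx⟩ θ hθ).1 hm)
    refine ⟨(g.symm ⟨x, hx⟩, θ'), Subtype.ext ?_⟩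
    change D.push L (D.slide (g (g.symm ⟨x, hx⟩)) (θ' * f (g (g.symm ⟨x, hx⟩)))) = _
    rw [g.apply_symm_apply, hθ']
  let Φ := hΨc.homeoOfEquivCompactToT2 (f := Equiv.ofBijective Ψ ⟨hinj, hsurj⟩)
  have hΦ : ∀ p θ, (Φ (p, θ) : Vec N) = D.push L (D.slide (g p) (θ * f (g p))) := fun p θ => rfl
  refine ⟨h, Φ, fun p => ?_, fun p => ⟨g p, (g p).2.1, hg p, ?_⟩⟩
  · rw [hΦ, Icc.coe_zero, zero_mul, slide_zero, hg]
  · ext m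
    constructor
    · rintro ⟨θ, rfl⟩
      exact ⟨⟨_, hmulmem (g p) θ, (hΦ p θ).symm⟩, (Φ (p, θ)).2⟩
    · rintro ⟨⟨θ, hθ, rfl⟩, hm⟩
      obtain ⟨θ', hθ'⟩ := hdiv (g p) θ hθ ((hP0 _ θ hθ).1 hm)
      exact ⟨θ', by simp only [hΦ, hθ']⟩

end Pairs

end CYData

end TorusFib

theorem proposition3p1 (N : ℕ) (hN : 1 ≤ N) (D : TorusFib.CYData N)
    (V : Finset (TorusFib.Vec N) → Set (TorusFib.Vec N)) (hV : D.IsDualCover V)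
    (r : ℝ) (hr : 0 < r) (hrP : Metric.closedBall (0 : TorusFib.Vec N) r ⊆ interior D.P)
    (ε : ℝ) (hε : 0 < ε) (hεr : ε • D.P ⊆ Metric.ball (0 : TorusFib.Vec N) r) :
    ∃ R : ℝ, 0 < R ∧ ∀ t : ℂ, R ≤ ‖t‖ →
      D.IsTrivialization t ε r ∧ D.IsWSupported t ε V := by
  have hεP : ε • D.P ⊆ interior D.P := hεr.trans (Metric.ball_subset_closedBall.trans hrP)
  obtain ⟨L₁, hL₁⟩ := D.exists_forall_norm_push_lt hr hrP hε hεP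
  obtain ⟨L₂, hL₂⟩ := D.exists_forall_subset_minFace hV hε hεP
  -- The estimates are stated for L = log |t|, whence the exponential.
  refine ⟨Real.exp (max L₁ L₂), Real.exp_pos _, fun t ht => ?_⟩
  have ht_pos : 0 < ‖t‖ := (Real.exp_pos _).trans_le ht
  have ht0 : t ≠ 0 := norm_pos_iff.1 ht_pos
  have hL : max L₁ L₂ ≤ Real.log ‖t‖ := (Real.le_log_iff_exp_le ht_pos).2 ht
  refine ⟨⟨fun s hs => D.existsUnique_normalCone hN hε hεP ht0 hs, ?_⟩, fun τ hτ s hs => ?_⟩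
  · obtain ⟨h, Φ, hΦ, hrange⟩ := D.exists_trivialization hN hε hεP hrP hεr
      (hL₁ _ ((le_max_left _ _).trans hL))
    refine ⟨h, Φ, hΦ, fun p => ?_⟩
    obtain ⟨x, hx, hxp, hxr⟩ := hrange p
    rw [hxr, ← hxp]
    congr 1
    ext m
    exact (D.mem_interval_iff hN hε hεP ht0 hx).symm
  · have hcl := hs.1
    obtain ⟨O, -, hO⟩ := hV.isOpen τ hτ
    have hfr : s ∈ frontier D.P := by
      refine closure_minimal ?_ isClosed_frontier hcl
      rw [hO]
      exact inter_subset_right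
    obtain ⟨x, hx, rfl⟩ := D.exists_push_eq_of_frontier hε hεP (Real.log ‖t‖) hfr
    exact D.isTauPoint_push hN hε hεP ht0 hx
      (hL₂ _ ((le_max_right _ _).trans hL) x hx
        ((D.push_mem_frontier_iff hε hεP _ hx).1 hfr) τ hτ hcl)
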